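/- Let $D=\partial_{x_1}-\partial_t$ and $\Box_{x_1}=\partial_t^2-\partial_{x_1}^2$. Let $\alpha,\delta>0$ and $\beta>1/2$ satisfy $2\alpha-2\beta-\delta<-1$. For $w:\mathbb R^2\to\mathbb R$ put $$\|w\|_{H^{s}(\ln H)^{-\beta}}=\Big(\int_{\mathbb R^2}\Big|\,|\xi|^{s}(1+|\ln|\xi||)^{-\beta}\,\hat w(\xi)\Big|^2d\xi\Big)^{1/2}\in[0,\infty],\qquad \hat w(\xi)=\int e^{-2i\pi\langle x,\xi\rangle}w(x)\,dx,$$ where $\hat w$ is understood in the sense of tempered distributions and the norm is $\infty$ if $\hat w$ is not a function. Let $f:\mathbb R^4\to\mathbb R$ be smooth and bounded together with each of its derivatives. For $0<\varepsilon<1/2$ let $\psi_\varepsilon:\mathbb R\to[0,1]$ be smooth with $\psi_\varepsilon=0$ on $(-\infty,\varepsilon/2)$ and $\psi_\varepsilon=1$ on $(\varepsilon,\infty)$, and let $\chi_\varepsilon:\mathbb R^2\to(-\infty,0]$ be any smooth compactly supported function with $$\chi_\varepsilon(x_1,x_2)=-\int_0^{x_1}\psi_\varepsilon(s)|\ln s|^\alpha\,ds\quad\text{on}\quad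 \Omega_0=\Big\{x_1\ge 0,\ |x_2|\le \tfrac{\sqrt{x_1}}{|\ln x_1|^\delta}\Big\}\cap[0,\tfrac12]^2 .$$ Consider the Cauchy problem $$\Box_{x_1}u=Du\,D^2u+f(t,x_1,x_2,Du),\qquad Du\neq1,\qquad u|_{t=0}=0,\qquad \partial_tu|_{t=0}=-\chi_\varepsilon. \tag{$P_\varepsilon$}$$ Then there are $\varepsilon_0\in(0,1/2)$ and times $t_\varepsilon$ with $t_\varepsilon\to0$ as $\varepsilon\to0^+$ such that for every $\varepsilon\in(0,\varepsilon_0)$ we have $t_\varepsilon>0$, the problem $(P_\varepsilon)$ has a smooth solution on $[0,t_\varepsilon)\times\mathbb R^2$, and every such solution $u_\varepsilon$ satisfies $$\|u_\varepsilon(0,\cdot)\|_{H^{11/4}(\ln H)^{-\beta}}<\infty,\qquad \|\partial_tu_\varepsilon(0,\cdot)\|_{H^{7/4}(\ln H)^{-\beta}}<\infty,\qquad \|u_\varepsilon(t,\cdot)\|_{H^{11/4}(\ln H)^{-\beta}}\to\infty\ \text{ as } t\to t_\varepsilon^-.$$ Moreover the blow-up is local: there is a point $p\in\mathbb R^2$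 such that $\|\zeta u_\varepsilon(t,\cdot)\|_{H^{11/4}(\ln H)^{-\beta}}\to\infty$ as $t\to t_\varepsilon^-$ for every $\zeta\in C_c^\infty(\mathbb R^2)$ that equals $1$ in a neighbourhood of $p$. -/

import Mathlib

open Set Filter Topology MeasureTheory
open scoped ContDiff SchwartzMap FourierTransform ENNReal

noncomputable section

namespace LogWave

/-- The Euclidean plane of the space variables `x = (x₁, x₂)` and of the frequencies. -/
abbrev Plane := EuclideanSpace ℝ (Fin 2)

/-- A function of `(x₁, x₂)` seen as a function on the Euclidean plane. -/
def onPlane (w : ℝ → ℝ → ℝ) : Plane → ℝ := fun x => w (x 0) (x 1)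

/-! ### Logarithmic Sobolev norms -/

/-- The Fourier transform of `w`, in the sense of tempered distributions and with the convention
`∫ exp (-2 i π ⟨x, ξ⟩) w x dx`, is the function `g`. For integrable `w` this says that `g` is
almost everywhere equal to that integral. -/
def HasFourierTransform (w : Plane → ℝ) (g : Plane → ℂ) : Prop :=
  ∀ φ : 𝓢(Plane, ℂ),
    Integrable (fun x => (w x : ℂ) * (𝓕 φ) x) ∧
    Integrable (fun ξ => g ξ * φ ξ) ∧
    ∫ x, (w x : ℂ) * (𝓕 φ) x = ∫ ξ, g ξ * φ ξ

/-- The frequency weight `|ξ| ^ s (1 + |ln |ξ||) ^ (-β)`. -/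
def logWeight (s β : ℝ) (ξ : Plane) : ℝ :=
  ‖ξ‖ ^ s * (1 + |Real.log ‖ξ‖|) ^ (-β)

/-- The `H^s (ln H)^{-β}` norm of `w`, i.e. the `L²` norm of the Fourier transform of `w` times the
weight `|ξ| ^ s (1 + |ln |ξ||) ^ (-β)`, as an element of `[0, ∞]`. It is `∞` if the Fourier transform
of `w` is not a function. (The Fourier transform is unique up to null sets, so that the infimum is
over at most one value.) -/
def logSobolevNorm (s β : ℝ) (w : Plane → ℝ) : ℝ≥0∞ :=
  ⨅ (g : Plane → ℂ) (_ : HasFourierTransform w g),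
    (∫⁻ ξ, (ENNReal.ofReal (logWeight s β ξ) * ‖g ξ‖ₑ) ^ 2) ^ (1 / 2 : ℝ)

/-! ### The equation -/

/-- Time derivative of a function of `(t, x₁, x₂)`. -/
def dt (u : ℝ → ℝ → ℝ → ℝ) : ℝ → ℝ → ℝ → ℝ := fun t x₁ x₂ => deriv (fun s => u s x₁ x₂) t

/-- Derivative with respect to `x₁` of a function of `(t, x₁, x₂)`. -/
def dx₁ (u : ℝ → ℝ → ℝ → ℝ) : ℝ → ℝ → ℝ → ℝ := fun t x₁ x₂ => deriv (fun y => u t y x₂) x₁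

/-- `D = ∂_{x₁} - ∂_t`. -/
def D (u : ℝ → ℝ → ℝ → ℝ) : ℝ → ℝ → ℝ → ℝ := fun t x₁ x₂ => dx₁ u t x₁ x₂ - dt u t x₁ x₂

/-- The wave operator in the variables `(t, x₁)`, namely `∂_t² - ∂_{x₁}²`. -/
def box₁ (u : ℝ → ℝ → ℝ → ℝ) : ℝ → ℝ → ℝ → ℝ :=
  fun t x₁ x₂ => dt (dt u) t x₁ x₂ - dx₁ (dx₁ u) t x₁ x₂

/-- The source term is smooth, and it is bounded together with all its derivatives. -/
structure IsSource (f : ℝ × ℝ × ℝ × ℝ → ℝ) : Prop where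
  smooth : ContDiff ℝ ∞ f
  bounded : ∀ k : ℕ, ∃ C : ℝ, ∀ p, ‖iteratedFDeriv ℝ k f p‖ ≤ C

/-- `u` is a smooth solution on `[0, T) × ℝ²` of `□_{x₁} u = Du D²u + f (t, x₁, x₂, Du)`, `Du ≠ 1`,
with data `u = 0` and `∂_t u = -χ` at `t = 0`. -/
structure IsSolution (f : ℝ × ℝ × ℝ × ℝ → ℝ) (χ : ℝ → ℝ → ℝ) (T : ℝ) (u : ℝ → ℝ → ℝ → ℝ) :
    Prop where
  smooth : ContDiffOn ℝ ∞ (fun p : ℝ × ℝ × ℝ => u p.1 p.2.1 p.2.2) (Ico 0 T ×ˢ univ)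
  equation : ∀ t ∈ Ioo 0 T, ∀ x₁ x₂ : ℝ,
    box₁ u t x₁ x₂ = D u t x₁ x₂ * D (D u) t x₁ x₂ + f (t, x₁, x₂, D u t x₁ x₂)
  ne_one : ∀ t ∈ Ioo 0 T, ∀ x₁ x₂ : ℝ, D u t x₁ x₂ ≠ 1
  initial : ∀ x₁ x₂ : ℝ, u 0 x₁ x₂ = 0
  initial_dt : ∀ x₁ x₂ : ℝ, HasDerivWithinAt (fun t => u t x₁ x₂) (-χ x₁ x₂) (Ici 0) 0

/-! ### The initial data -/

/-- The region `{0 ≤ x₁, |x₂| ≤ √x₁ / |ln x₁| ^ δ} ∩ [0, 1/2] × [0, 1/2]`. -/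
def Ω₀ (δ : ℝ) : Set (ℝ × ℝ) :=
  {x | 0 ≤ x.1 ∧ |x.2| ≤ √x.1 / |Real.log x.1| ^ δ} ∩ Icc 0 (1 / 2) ×ˢ Icc 0 (1 / 2)

/-- A smooth transition from `0` on `(-∞, ε/2)` to `1` on `(ε, ∞)`. -/
structure IsTransition (ε : ℝ) (ψ : ℝ → ℝ) : Prop where
  smooth : ContDiff ℝ ∞ ψ
  zero : ∀ s < ε / 2, ψ s = 0
  one : ∀ s > ε, ψ s = 1
  mem : ∀ s, ψ s ∈ Icc (0 : ℝ) 1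

/-- `χ` is a smooth, compactly supported, nonpositive extension to the plane of the regularized
logarithmic profile `-∫_0^{x₁} ψ(s) |ln s| ^ α ds` on `Ω₀`. -/
structure IsProfile (α δ : ℝ) (ψ : ℝ → ℝ) (χ : ℝ → ℝ → ℝ) : Prop where
  smooth : ContDiff ℝ ∞ (fun x : ℝ × ℝ => χ x.1 x.2)
  compact : HasCompactSupport (fun x : ℝ × ℝ => χ x.1 x.2)
  nonpos : ∀ x₁ x₂ : ℝ, χ x₁ x₂ ≤ 0
  eq_on : ∀ x ∈ Ω₀ δ, χ x.1 x.2 = -∫ s in (0 : ℝ)..x.1, ψ s * |Real.log s| ^ α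

end LogWave

end

open LogWave

/-! Since `∂_t² - ∂_{x₁}² = -(∂_t + ∂_{x₁}) D`, the equation is a first-order quasilinear equation
for `v = D u`, namely `(1 - v) v_t + (1 + v) v_x = -f(t, x, y, v)` with `v = χ` at `t = 0`, where `x
= x₁` and `y = x₂` is only a parameter. Its characteristics satisfy `X' = (1 + V) / (1 - V)` and `V'
= -f / (1 - V)`. They exist, with uniform control, up to a time `r` depending only on `f`
(`exists_characteristic_flow`): the data are nonpositive, so `V ≤ 1/2` and the denominator stays
away from zero.

On the axis `y = 0` the profile falls between `ε` and `2ε` with mean slope at least `K = |ln 2ε|^α`.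
A characteristic with smaller `V` is slower, so the two starting at these points meet before time
`7/K`, which tends to `0` (`IsCharacteristics.crossing`). Let `T` be the first time at which `X_x`
vanishes somewhere (`exists_first_vanishing`). Before `T` the map `x ↦ X` is invertible, `v` is
smooth, and integrating `D u = v` gives `u` (`exists_isDevelopment`). Any other smooth solution
agrees with it, by Gronwall along the same characteristics (`IsDevelopment.eq_of_isSolution`).

At time `T` the function `X_x ≥ 0` has a zero minimum at some label `a`, hence `X_x(t, q) ≤ K' (|q -
a|² + T - t)` nearby. At `a`, `V_x` does not vanish, so `v_x = V_x / X_x` is singular there. With `w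
= u_t + u_x + v²/2` one has `2 u_xx = (1 - v) v_x + w_x`, and `w_x` stays bounded up to `T`
(`abs_dx₁_invariant_le`). In Lagrangian coordinates the local integral of `u_xx²` is thus bounded
below, up to a finite error, by a multiple of the integral of `1 / (|q - a|² + T - t)`, which
diverges logarithmically in the plane (`tendsto_lintegral_sq`).

Finally `11/4 > 2`, so the `H^{11/4} (ln H)^{-β}` norm controls `u_xx` in `L²` locally. This is
proved by duality with test functions (`lintegral_mul_sq_rpow_le`), which needs only local
information on `u` and yields the local statement as well. The data have finite norm because they
are smooth and compactly supported. -/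

namespace LogWave

/-! ### Smoothness of superposition operators on spaces of continuous functions -/

section Superposition

variable {K : Type} [TopologicalSpace K] [CompactSpace K]
  {E G : Type} [NormedAddCommGroup E] [NormedSpace ℝ E] [NormedAddCommGroup G] [NormedSpace ℝ G]

/-- Pointwise application of a continuous family of operators to a continuous function. -/
noncomputable def pointwiseApply :
    C(K, E →L[ℝ] G) →L[ℝ] C(K, E) →L[ℝ] C(K, G) :=
  LinearMap.mkContinuous₂
    (LinearMap.mk₂ ℝ (fun (A : C(K, E →L[ℝ] G)) (φ : C(K, E)) =>
        (⟨fun s => A s (φ s), A.continuous.clm_apply φ.continuous⟩ : C(K, G)))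
      (fun A B φ => by ext s; simp) (fun c A φ => by ext s; simp)
      (fun A φ ψ => by ext s; simp) (fun c A φ => by ext s; simp))
    1 (fun A φ => by
      rw [ContinuousMap.norm_le _ (by positivity)]
      intro s
      calc ‖A s (φ s)‖ ≤ ‖A s‖ * ‖φ s‖ := (A s).le_opNorm _
        _ ≤ 1 * ‖A‖ * ‖φ‖ := by
          rw [one_mul]
          exact mul_le_mul (A.norm_coe_le_norm s) (φ.norm_coe_le_norm s) (norm_nonneg _)
            (norm_nonneg A))

@[simp] lemma pointwiseApply_apply (A : C(K, E →L[ℝ] G)) (φ : C(K, E)) (s : K) :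
    pointwiseApply A φ s = A s (φ s) := rfl

lemma hasFDerivAt_superposition {F : C(E, G)} {F' : C(E, E →L[ℝ] G)}
    (hF : ∀ x, HasFDerivAt F (F' x) x) (φ : C(K, E)) :
    HasFDerivAt (fun ψ : C(K, E) => F.comp ψ) (pointwiseApply (F'.comp φ)) φ := by
  rw [hasFDerivAt_iff_isLittleO_nhds_zero, Asymptotics.isLittleO_iff]
  intro ε hε
  have hc : Continuous fun ψ : C(K, E) => F'.comp ψ := ContinuousMap.continuous_postcomp F'
  obtain ⟨δ, hδ, h⟩ := (Metric.continuous_iff (α := C(K, E)) (β := C(K, E →L[ℝ] G))).1 hc φ ε hε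
  filter_upwards [Metric.ball_mem_nhds (0 : C(K, E)) hδ] with η hη
  rw [mem_ball_zero_iff] at hη
  rw [ContinuousMap.norm_le _ (by positivity)]
  intro s
  -- Continuity of `ψ ↦ F' ∘ ψ` at `φ` serves as uniform continuity of `F'` near the compact range
  -- of `φ`. It is tested on the translate of `φ` by the constant `z - φ s`, so that `δ` does not
  -- depend on `s`.
  have key : ∀ z ∈ Metric.ball (φ s) δ, ‖F' z - F' (φ s)‖ ≤ ε := by
    intro z hz
    have h1 := h (φ + ContinuousMap.const K (z - φ s)) (by
      rw [dist_eq_norm, add_sub_cancel_left]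
      refine lt_of_le_of_lt ?_ (mem_ball_iff_norm.1 hz)
      rw [ContinuousMap.norm_le _ (norm_nonneg _)]
      intro _; simp)
    have h2 := (ContinuousMap.dist_apply_le_dist s).trans h1.le
    simpa [dist_eq_norm] using h2
  have h3 := (convex_ball (φ s) δ).norm_image_sub_le_of_norm_hasFDerivWithin_le'
    (f := F) (f' := F') (φ := F' (φ s)) (C := ε) (x := φ s) (y := φ s + η s)
    (fun z _ => (hF z).hasFDerivWithinAt) key (Metric.mem_ball_self hδ)
    (by rw [mem_ball_iff_norm, add_sub_cancel_left]
        exact (η.norm_coe_le_norm s).trans_lt hη)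
  simp only [add_sub_cancel_left] at h3
  calc _ ≤ ε * ‖η s‖ := by simpa using h3
    _ ≤ ε * ‖η‖ := by gcongr; exact η.norm_coe_le_norm s

/-- Induction on the order: the derivative is again a superposition operator, that of `F'`, followed
by the bounded linear map `pointwiseApply`. The target changes from `G` to `E →L[ℝ] G`, so the
spaces are quantified inside the induction. -/
lemma contDiff_superposition_nat (n : ℕ) : ∀ {E G : Type} [NormedAddCommGroup E] [NormedSpace ℝ E]
    [NormedAddCommGroup G] [NormedSpace ℝ G] (F : C(E, G)), ContDiff ℝ n F →
    ContDiff ℝ n (fun ψ : C(K, E) => F.comp ψ) := by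
  induction n with
  | zero => intro E G _ _ _ _ F _; exact contDiff_zero.2 (ContinuousMap.continuous_postcomp F)
  | succ n ih =>
    intro E G _ _ _ _ F hF
    obtain ⟨F', hF', h⟩ := contDiff_succ_iff_hasFDerivAt.1 (by exact_mod_cast hF)
    rw [Nat.cast_add, Nat.cast_one, contDiff_succ_iff_hasFDerivAt]
    have hB : ContDiff ℝ n (fun A : C(K, E →L[ℝ] G) => pointwiseApply A) :=
      ContinuousLinearMap.contDiff _
    refine ⟨fun φ => pointwiseApply ((⟨F', hF'.continuous⟩ : C(E, E →L[ℝ] G)).comp φ),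
      hB.comp (ih (⟨F', hF'.continuous⟩ : C(E, E →L[ℝ] G)) hF'), fun φ => ?_⟩
    exact hasFDerivAt_superposition (F' := ⟨F', hF'.continuous⟩) h φ

/-- The superposition operator of a smooth function is smooth on continuous functions. -/
lemma contDiff_superposition (F : C(E, G)) (hF : ContDiff ℝ ∞ F) :
    ContDiff ℝ ∞ (fun ψ : C(K, E) => F.comp ψ) :=
  contDiff_infty.2 fun n => contDiff_superposition_nat n F (contDiff_infty.1 hF n)

end Superposition

/-! ### The primitive as a bounded operator -/

section Volterra

variable {E : Type} [NormedAddCommGroup E] [NormedSpace ℝ E]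

/-- The value at `s` of the primitive of a continuous function on the unit interval. -/
noncomputable def primitiveFun (φ : C(unitInterval, E)) (s : ℝ) : E :=
  ∫ r in (0 : ℝ)..s, IccExtend zero_le_one φ r

omit [NormedSpace ℝ E] in
lemma continuous_iccExtend (φ : C(unitInterval, E)) :
    Continuous (IccExtend (zero_le_one (α := ℝ)) φ) := φ.continuous.Icc_extend'

omit [NormedSpace ℝ E] in
lemma norm_iccExtend_le (φ : C(unitInterval, E)) (r : ℝ) :
    ‖IccExtend (zero_le_one (α := ℝ)) φ r‖ ≤ ‖φ‖ := φ.norm_coe_le_norm _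

lemma norm_primitiveFun_le (φ : C(unitInterval, E)) (s : unitInterval) :
    ‖primitiveFun φ s‖ ≤ ‖φ‖ := by
  have := intervalIntegral.norm_integral_le_of_norm_le_const (a := 0) (b := (s : ℝ))
    (f := IccExtend zero_le_one φ) (C := ‖φ‖) (fun r _ => norm_iccExtend_le φ r)
  refine this.trans ?_
  rw [sub_zero, abs_of_nonneg s.2.1]
  exact mul_le_of_le_one_right (norm_nonneg _) s.2.2

variable [CompleteSpace E]

lemma hasDerivAt_primitiveFun (φ : C(unitInterval, E)) (s : ℝ) :
    HasDerivAt (primitiveFun φ) (IccExtend zero_le_one φ s) s :=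
  intervalIntegral.integral_hasDerivAt_right ((continuous_iccExtend φ).intervalIntegrable _ _)
    ((continuous_iccExtend φ).stronglyMeasurableAtFilter _ _) (continuous_iccExtend φ).continuousAt

/-- The primitive vanishing at `0`, as an operator on continuous functions. -/
noncomputable def primitive : C(unitInterval, E) →L[ℝ] C(unitInterval, E) :=
  LinearMap.mkContinuous
    { toFun := fun φ => ⟨fun s => primitiveFun φ s,
        (continuous_iff_continuousAt.2 fun s =>
          (hasDerivAt_primitiveFun φ s).continuousAt).comp continuous_subtype_val⟩
      map_add' := fun φ ψ => by
        ext s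
        exact intervalIntegral.integral_add ((continuous_iccExtend φ).intervalIntegrable _ _)
          ((continuous_iccExtend ψ).intervalIntegrable _ _)
      map_smul' := fun c φ => by
        ext s
        exact intervalIntegral.integral_smul c _ }
    1 (fun φ => by
      rw [one_mul, ContinuousMap.norm_le _ (norm_nonneg _)]
      exact norm_primitiveFun_le φ)

lemma primitive_apply (φ : C(unitInterval, E)) (s : unitInterval) :
    primitive φ s = primitiveFun φ s := rfl

lemma norm_primitive_le (φ : C(unitInterval, E)) : ‖primitive φ‖ ≤ ‖φ‖ := by
  rw [ContinuousMap.norm_le _ (norm_nonneg _)]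
  exact norm_primitiveFun_le φ

end Volterra

lemma contDiff_evalOne {E : Type} [NormedAddCommGroup E] [NormedSpace ℝ E] :
    ContDiff ℝ ∞ (fun φ : C(unitInterval, E) => φ 1) :=
  (ContinuousMap.evalCLM ℝ (1 : unitInterval) : C(unitInterval, E) →L[ℝ] E).contDiff

lemma isInvertible_one_sub {E : Type} [NormedAddCommGroup E] [NormedSpace ℝ E] [CompleteSpace E]
    {A : E →L[ℝ] E} (hA : ‖A‖ < 1) : (1 - A).IsInvertible := by
  have hl := (Units.oneSub A hA).inv_mul
  have hr := (Units.oneSub A hA).mul_inv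
  exact ⟨ContinuousLinearEquiv.equivOfInverse (1 - A) ((Units.oneSub A hA)⁻¹ : (E →L[ℝ] E)ˣ).val
    (fun x => DFunLike.congr_fun hl x) (fun x => DFunLike.congr_fun hr x), rfl⟩

/-! ### The flow of a globally Lipschitz smooth field for short times -/

section Flow

variable {E : Type} [NormedAddCommGroup E] [NormedSpace ℝ E] [CompleteSpace E]
  {F : C(E, E)} {L : ℝ}

/-- The Picard operator on curves, with time rescaled to the unit interval. -/
noncomputable def picard (F : C(E, E)) (p : ℝ × E) (φ : C(unitInterval, E)) : C(unitInterval, E) :=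
  ContinuousMap.const _ p.2 + p.1 • primitive (F.comp φ)

lemma contDiff_picard (hF : ContDiff ℝ ∞ F) :
    ContDiff ℝ ∞ (fun q : (ℝ × E) × C(unitInterval, E) => picard F q.1 q.2) := by
  have h1 : ContDiff ℝ ∞ (fun φ : C(unitInterval, E) => primitive (F.comp φ)) :=
    (primitive (E := E)).contDiff.comp (contDiff_superposition F hF)
  have h2 : ContDiff ℝ ∞ (fun x : E => ContinuousMap.const unitInterval x) :=
    (ContinuousLinearMap.const ℝ unitInterval (M := E)).contDiff
  exact (h2.comp (contDiff_snd.comp contDiff_fst)).add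
    ((contDiff_fst.comp contDiff_fst).smul (h1.comp contDiff_snd))

omit [NormedSpace ℝ E] [CompleteSpace E] in
lemma norm_superposition_sub_le (hL : ∀ x y, ‖F x - F y‖ ≤ L * ‖x - y‖) (hL0 : 0 ≤ L)
    (φ ψ : C(unitInterval, E)) : ‖F.comp φ - F.comp ψ‖ ≤ L * ‖φ - ψ‖ := by
  rw [ContinuousMap.norm_le _ (by positivity)]
  intro s
  refine (hL _ _).trans ?_
  gcongr
  exact (φ - ψ).norm_coe_le_norm s

lemma norm_picard_sub_le (hL : ∀ x y, ‖F x - F y‖ ≤ L * ‖x - y‖) (hL0 : 0 ≤ L) (p : ℝ × E)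
    (φ ψ : C(unitInterval, E)) : ‖picard F p φ - picard F p ψ‖ ≤ |p.1| * L * ‖φ - ψ‖ := by
  rw [picard, picard, add_sub_add_left_eq_sub, ← smul_sub, ← map_sub, norm_smul, Real.norm_eq_abs,
    mul_assoc]
  gcongr
  exact (norm_primitive_le _).trans (norm_superposition_sub_le hL hL0 _ _)

lemma existsUnique_picard_fixedPoint (hL : ∀ x y, ‖F x - F y‖ ≤ L * ‖x - y‖) (hL0 : 0 ≤ L)
    {p : ℝ × E} (hp : |p.1| * L < 1) : ∃! φ, picard F p φ = φ := by
  have hc : ContractingWith ⟨|p.1| * L, by positivity⟩ (picard F p) :=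
    ⟨by exact_mod_cast hp, LipschitzWith.of_dist_le_mul fun φ ψ => by
      rw [dist_eq_norm, dist_eq_norm]
      exact norm_picard_sub_le hL hL0 p φ ψ⟩
  exact ⟨_, hc.fixedPoint_isFixedPt, fun φ hφ => hc.fixedPoint_unique hφ⟩

/-- The integral curve of `F` starting from `p.2`, followed during the time `p.1` and rescaled to
the unit interval. -/
noncomputable def flowCurve (F : C(E, E)) (p : ℝ × E) : C(unitInterval, E) :=
  Classical.epsilon fun φ => picard F p φ = φ

lemma picard_flowCurve (hL : ∀ x y, ‖F x - F y‖ ≤ L * ‖x - y‖) (hL0 : 0 ≤ L)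
    {p : ℝ × E} (hp : |p.1| * L < 1) : picard F p (flowCurve F p) = flowCurve F p :=
  Classical.epsilon_spec (existsUnique_picard_fixedPoint hL hL0 hp).exists

lemma eq_flowCurve (hL : ∀ x y, ‖F x - F y‖ ≤ L * ‖x - y‖) (hL0 : 0 ≤ L)
    {p : ℝ × E} (hp : |p.1| * L < 1) {φ : C(unitInterval, E)} (h : picard F p φ = φ) :
    φ = flowCurve F p :=
  (existsUnique_picard_fixedPoint hL hL0 hp).unique h (picard_flowCurve hL hL0 hp)

/-- Implicit function theorem for `φ - picard F p φ = 0`. The partial derivative in `φ` is `1 - A`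
with `‖A‖ ≤ |p.1| L < 1`, hence invertible by a Neumann series. Uniqueness of the fixed point
identifies the implicit function with `flowCurve`. -/
lemma contDiffAt_flowCurve (hF : ContDiff ℝ ∞ F) (hL : ∀ x y, ‖F x - F y‖ ≤ L * ‖x - y‖)
    (hL0 : 0 ≤ L) {p : ℝ × E} (hp : |p.1| * L < 1) : ContDiffAt ℝ ∞ (flowCurve F) p := by
  set G : (ℝ × E) × C(unitInterval, E) → C(unitInterval, E) := fun q => q.2 - picard F q.1 q.2
    with hG
  have hGs : ContDiff ℝ ∞ G := contDiff_snd.sub (contDiff_picard hF)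
  set u : (ℝ × E) × C(unitInterval, E) := (p, flowCurve F p) with hu
  have hdiff : DifferentiableAt ℝ (picard F p) (flowCurve F p) :=
    ((contDiff_picard hF).comp (contDiff_prodMk_right p)).differentiable (by simp) _
  have hpart : fderiv ℝ G u ∘L .inr ℝ (ℝ × E) C(unitInterval, E) =
      1 - fderiv ℝ (picard F p) (flowCurve F p) := by
    have h1 : HasFDerivAt (fun φ => G (p, φ))
        (fderiv ℝ G u ∘L .inr ℝ (ℝ × E) C(unitInterval, E)) (flowCurve F p) :=
      (hGs.differentiable (by simp) u).hasFDerivAt.comp _ (hasFDerivAt_prodMk_right p _)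
    have h2 : HasFDerivAt (fun φ => G (p, φ))
        (1 - fderiv ℝ (picard F p) (flowCurve F p)) (flowCurve F p) :=
      (hasFDerivAt_id _).sub hdiff.hasFDerivAt
    exact h1.unique h2
  have hnorm : ‖fderiv ℝ (picard F p) (flowCurve F p)‖ < 1 := by
    refine lt_of_le_of_lt ?_ hp
    have hlip : LipschitzWith ⟨|p.1| * L, by positivity⟩ (picard F p) :=
      LipschitzWith.of_dist_le_mul fun φ ψ => by
        rw [dist_eq_norm, dist_eq_norm]
        exact norm_picard_sub_le hL hL0 p φ ψ
    exact norm_fderiv_le_of_lipschitz ℝ hlip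
  have hinv : (fderiv ℝ G u ∘L .inr ℝ (ℝ × E) C(unitInterval, E)).IsInvertible := by
    rw [hpart]
    exact isInvertible_one_sub hnorm
  have himp := hGs.contDiffAt.contDiffAt_implicitFunction (u := u) (by simp) hinv
  have hev := hGs.contDiffAt.eventually_apply_implicitFunction (u := u) (by simp) hinv
  refine himp.congr_of_eventuallyEq ?_
  have hnear : ∀ᶠ q : ℝ × E in 𝓝 p, |q.1| * L < 1 :=
    (isOpen_lt (by fun_prop) continuous_const).mem_nhds hp
  have hGu : G u = 0 := sub_eq_zero.2 (picard_flowCurve hL hL0 hp).symm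
  filter_upwards [hev, hnear] with q hq hq'
  rw [hGu] at hq
  exact (eq_flowCurve hL hL0 hq' (sub_eq_zero.1 hq).symm).symm

/-- The flow of `F`, for short times. -/
noncomputable def flow (F : C(E, E)) (p : ℝ × E) : E := flowCurve F p 1

lemma contDiffAt_flow (hF : ContDiff ℝ ∞ F) (hL : ∀ x y, ‖F x - F y‖ ≤ L * ‖x - y‖)
    (hL0 : 0 ≤ L) {p : ℝ × E} (hp : |p.1| * L < 1) : ContDiffAt ℝ ∞ (flow F) p :=
  contDiff_evalOne.contDiffAt.comp p (contDiffAt_flowCurve hF hL hL0 hp)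

lemma flow_zero (hL : ∀ x y, ‖F x - F y‖ ≤ L * ‖x - y‖) (hL0 : 0 ≤ L) (x : E) :
    flow F (0, x) = x := by
  rw [flow, ← picard_flowCurve hL hL0 (p := (0, x)) (by simp)]
  simp [picard]

/-- The initial portion of an integral curve, rescaled to the unit interval, is a fixed point of the
Picard operator for the shorter time. Uniqueness then relates the interior values of one curve to
endpoints of others, which is how `flow` is defined. -/
lemma flowCurve_eq (hL : ∀ x y, ‖F x - F y‖ ≤ L * ‖x - y‖) (hL0 : 0 ≤ L)
    {t : ℝ} {x : E} (ht : |t| * L < 1) (s : unitInterval) :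
    flowCurve F (t, x) s = flow F (s * t, x) := by
  set φ := flowCurve F (t, x)
  have hs : |(s : ℝ) * t| * L < 1 := by
    refine lt_of_le_of_lt ?_ ht
    rw [abs_mul, abs_of_nonneg s.2.1]
    gcongr
    exact mul_le_of_le_one_left (abs_nonneg _) s.2.2
  let ψ : C(unitInterval, E) := φ.comp ⟨fun r => s * r, by fun_prop⟩
  have hψ : ψ = flowCurve F (s * t, x) := by
    refine eq_flowCurve hL hL0 hs ?_
    ext r
    have h := congrArg (fun χ : C(unitInterval, E) => χ (s * r))
      (picard_flowCurve hL hL0 (p := (t, x)) ht)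
    simp only [picard, ContinuousMap.add_apply, ContinuousMap.const_apply,
      ContinuousMap.smul_apply, primitive_apply] at h ⊢
    have hcv : (s : ℝ) • primitiveFun (F.comp ψ) r = primitiveFun (F.comp φ) ((s * r : unitInterval) : ℝ) := by
      unfold primitiveFun
      have h1 : (∫ q in (0 : ℝ)..r, IccExtend zero_le_one (F.comp ψ) q) =
          ∫ q in (0 : ℝ)..r, IccExtend zero_le_one (F.comp φ) (s * q) := by
        refine intervalIntegral.integral_congr fun q hq => ?_
        rw [uIcc_of_le r.2.1] at hq
        have hq1 : q ∈ Icc (0 : ℝ) 1 := ⟨hq.1, hq.2.trans r.2.2⟩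
        have hq2 : (s : ℝ) * q ∈ Icc (0 : ℝ) 1 := unitInterval.mul_mem s.2 hq1
        simp only [IccExtend_of_mem _ _ hq1, IccExtend_of_mem _ _ hq2]
        rfl
      rw [h1, intervalIntegral.smul_integral_comp_mul_left]
      simp
    rw [mul_comm, mul_smul, hcv]
    exact h
  have := congrArg (fun χ : C(unitInterval, E) => χ 1) hψ
  simpa [ψ, flow] using this

lemma hasDerivAt_flow (hL : ∀ x y, ‖F x - F y‖ ≤ L * ‖x - y‖) (hL0 : 0 ≤ L)
    {t : ℝ} {x : E} (ht0 : 0 < t) (ht : |t| * L < 1) :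
    HasDerivAt (fun s => flow F (s, x)) (F (flow F (t, x))) t := by
  -- A slightly longer curve has `t` in its interior, so that the fundamental theorem of calculus
  -- gives a two-sided derivative.
  obtain ⟨t', ht', htL⟩ : ∃ t', t < t' ∧ |t'| * L < 1 := by
    have : ∀ᶠ s in 𝓝[>] t, |s| * L < 1 :=
      nhdsWithin_le_nhds ((isOpen_lt (by fun_prop) continuous_const).mem_nhds ht)
    obtain ⟨s, hs, hs'⟩ := (this.and self_mem_nhdsWithin).exists
    exact ⟨s, hs', hs⟩
  have ht'0 : 0 < t' := ht0.trans ht'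
  set φ := flowCurve F (t', x) with hφ
  have hval : ∀ s ∈ Icc 0 t', flow F (s, x) = x + t' • primitiveFun (F.comp φ) (s / t') := by
    intro s hs
    have hm : s / t' ∈ unitInterval := ⟨by have := hs.1; positivity, (div_le_one ht'0).2 hs.2⟩
    have h := flowCurve_eq hL hL0 (x := x) htL ⟨_, hm⟩
    rw [← picard_flowCurve hL hL0 (p := (t', x)) htL] at h
    simp only [div_mul_cancel₀ _ ht'0.ne'] at h
    rw [← h]
    rfl
  have hsc : HasDerivAt (fun s => primitiveFun (F.comp φ) (s / t'))
      ((1 / t') • IccExtend zero_le_one (F.comp φ) (t / t')) t := by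
    have h2 : HasDerivAt (fun s => s / t') (1 / t') t := (hasDerivAt_id' t).div_const t'
    exact (hasDerivAt_primitiveFun (F.comp φ) (t / t')).scomp t h2
  have hd : HasDerivAt (fun s => x + t' • primitiveFun (F.comp φ) (s / t'))
      (t' • ((1 / t') • IccExtend zero_le_one (F.comp φ) (t / t'))) t :=
    (hsc.fun_const_smul t').const_add x
  have hm : t / t' ∈ unitInterval := ⟨by positivity, (div_le_one ht'0).2 ht'.le⟩
  have hval' : t' • ((1 / t') • IccExtend zero_le_one (F.comp φ) (t / t')) = F (flow F (t, x)) := by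
    rw [smul_smul, mul_one_div_cancel ht'0.ne', one_smul, IccExtend_of_mem _ _ hm]
    have h := flowCurve_eq hL hL0 (x := x) htL ⟨_, hm⟩
    simp only [div_mul_cancel₀ _ ht'0.ne'] at h
    rw [← h]
    rfl
  rw [hval'] at hd
  refine hd.congr_of_eventuallyEq ?_
  filter_upwards [Icc_mem_nhds ht0 ht'] with s hs using hval s hs

/-- With `|t| L ≤ 1/3` the whole curves differ by at most `3/2 ‖x - y‖`, hence their displacements
by at most `1/3 · 3/2 = 1/2` times `‖x - y‖`. The bound does not involve the slope of the data,
which is large when `ε` is small. -/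
lemma norm_flow_sub_sub_le (hL : ∀ x y, ‖F x - F y‖ ≤ L * ‖x - y‖) (hL0 : 0 ≤ L)
    {t : ℝ} (ht : |t| * L ≤ 1 / 3) (x y : E) :
    ‖flow F (t, x) - flow F (t, y) - (x - y)‖ ≤ 1 / 2 * ‖x - y‖ := by
  set φ := flowCurve F (t, x)
  set ψ := flowCurve F (t, y)
  have hlt : |t| * L < 1 := by linarith
  have hφ : picard F (t, x) φ = φ := picard_flowCurve hL hL0 hlt
  have hψ : picard F (t, y) ψ = ψ := picard_flowCurve hL hL0 hlt
  have hdiff : φ - ψ - ContinuousMap.const _ (x - y) =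
      t • primitive (F.comp φ - F.comp ψ) := by
    conv_lhs => rw [← hφ, ← hψ]
    rw [picard, picard, map_sub, smul_sub]
    ext s
    simp
    abel
  have h1 : ‖φ - ψ - ContinuousMap.const _ (x - y)‖ ≤ |t| * L * ‖φ - ψ‖ := by
    rw [hdiff, norm_smul, Real.norm_eq_abs, mul_assoc]
    gcongr
    exact (norm_primitive_le _).trans (norm_superposition_sub_le hL hL0 _ _)
  have hconst : ‖ContinuousMap.const unitInterval (x - y)‖ ≤ ‖x - y‖ := by
    rw [ContinuousMap.norm_le _ (norm_nonneg _)]; intro _; simp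
  have h2 : ‖φ - ψ‖ ≤ 1 / 3 * ‖φ - ψ‖ + ‖x - y‖ := by
    calc ‖φ - ψ‖ = ‖(φ - ψ - ContinuousMap.const _ (x - y)) + ContinuousMap.const _ (x - y)‖ := by
          rw [sub_add_cancel]
      _ ≤ |t| * L * ‖φ - ψ‖ + ‖x - y‖ := (norm_add_le _ _).trans (add_le_add h1 hconst)
      _ ≤ _ := by gcongr
  have h3 := (φ - ψ - ContinuousMap.const _ (x - y)).norm_coe_le_norm 1
  calc ‖flow F (t, x) - flow F (t, y) - (x - y)‖ ≤ |t| * L * ‖φ - ψ‖ := h3.trans h1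
    _ ≤ 1 / 3 * (3 / 2 * ‖x - y‖) := by gcongr; linarith
    _ = _ := by ring

end Flow

/-- An integral over the unit interval of a smooth function of the parameter is smooth. -/
lemma contDiff_integral_unitInterval {P : Type} [NormedAddCommGroup P] [NormedSpace ℝ P]
    {g : P × ℝ → ℝ} (hg : ContDiff ℝ ∞ g) :
    ContDiff ℝ ∞ fun p => ∫ s in (0 : ℝ)..1, g (p, s) := by
  let G : C(P × ℝ, ℝ) := ⟨g, hg.continuous⟩
  let ι : P → C(unitInterval, P × ℝ) := fun p =>
    ⟨fun s => (p, (s : ℝ)), by fun_prop⟩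
  have hι : ContDiff ℝ ∞ ι := by
    -- `ι` is a bounded linear map plus a constant, hence smooth, and the integral is the
    -- superposition operator followed by `primitive` at `1`.
    have h : ι = fun p => ((ContinuousLinearMap.inl ℝ P ℝ).compLeftContinuous ℝ unitInterval)
        (ContinuousLinearMap.const ℝ unitInterval p) + ι 0 := by
      funext p
      ext s <;> simp [ι]
    rw [h]
    exact (((ContinuousLinearMap.compLeftContinuous ℝ unitInterval
      (ContinuousLinearMap.inl ℝ P ℝ)).contDiff.comp
      (ContinuousLinearMap.const ℝ unitInterval).contDiff)).add contDiff_const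
  have h : (fun p => ∫ s in (0 : ℝ)..1, g (p, s)) = fun p => primitive (G.comp (ι p)) 1 := by
    funext p
    refine intervalIntegral.integral_congr fun s hs => ?_
    rw [uIcc_of_le zero_le_one] at hs
    simp only [IccExtend_of_mem _ _ hs]
    rfl
  rw [h]
  exact contDiff_evalOne.comp
    ((primitive (E := ℝ)).contDiff.comp ((contDiff_superposition G hg).comp hι))

end LogWave

/-! ### The characteristic system -/

namespace LogWave

lemma norm_flow_sub_le {E : Type} [NormedAddCommGroup E] [NormedSpace ℝ E] [CompleteSpace E]
    {F : C(E, E)} {L B : ℝ} (hL : ∀ x y, ‖F x - F y‖ ≤ L * ‖x - y‖) (hL0 : 0 ≤ L) (hB0 : 0 ≤ B)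
    (hB : ∀ x, ‖F x‖ ≤ B) {t : ℝ} (ht : |t| * L < 1) (x : E) :
    ‖flow F (t, x) - x‖ ≤ |t| * B := by
  have h := congrArg (fun χ : C(unitInterval, E) => χ 1)
    (picard_flowCurve hL hL0 (p := (t, x)) ht)
  have h2 : flow F (t, x) - x = t • primitive (F.comp (flowCurve F (t, x))) 1 := by
    rw [flow, ← h]
    simp [picard]
  rw [h2, norm_smul, Real.norm_eq_abs]
  gcongr
  refine ((ContinuousMap.norm_coe_le_norm _ _).trans (norm_primitive_le _)).trans ?_
  rw [ContinuousMap.norm_le _ hB0]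
  exact fun s => hB _

/-- A smooth positive function equal to `1 - v` for `v ≤ 1 / 2`. -/
lemma exists_regularized_one_sub : ∃ h : ℝ → ℝ, ContDiff ℝ ∞ h ∧ (∀ v ≤ 1 / 2, h v = 1 - v) ∧
    (∀ v, 1 / 4 ≤ h v) ∧ ∀ a b, |h a - h b| ≤ |a - b| := by
  -- `ρ` is `-h'`: it equals `1` up to `1/2` and `0` from `3/4` on, so `h` decreases from `h 0 = 1`
  -- to a final value `h (3/4) ≥ 1/4`.
  set ρ : ℝ → ℝ := fun s => 1 - Real.smoothTransition (4 * s - 2) with hρ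
  have hρs : ContDiff ℝ ∞ ρ :=
    contDiff_const.sub (Real.smoothTransition.contDiff.comp (by fun_prop))
  have hρ0 : ∀ s, 0 ≤ ρ s := fun s => sub_nonneg.2 (Real.smoothTransition.le_one _)
  have hρ1 : ∀ s, ρ s ≤ 1 := fun s => sub_le_self _ (Real.smoothTransition.nonneg _)
  have hint : ∀ a b, IntervalIntegrable ρ volume a b := fun a b =>
    hρs.continuous.intervalIntegrable _ _
  set h : ℝ → ℝ := fun v => 1 - ∫ s in (0 : ℝ)..v, ρ s with hh
  have hd : ∀ v, HasDerivAt h (-ρ v) v := fun v => by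
    have := (intervalIntegral.integral_hasDerivAt_right (hint 0 v)
      (hρs.continuous.stronglyMeasurableAtFilter _ _) hρs.continuous.continuousAt).const_sub 1
    exact this
  have hdiff : ∀ a b, h a - h b = ∫ s in a..b, ρ s := fun a b => by
    have := intervalIntegral.integral_add_adjacent_intervals (hint 0 a) (hint a b)
    simp only [hh]; linarith
  have habs : ∀ a b, |h a - h b| ≤ |a - b| := fun a b => by
    rw [hdiff, abs_sub_comm a b]
    have := intervalIntegral.norm_integral_le_of_norm_le_const (a := a) (b := b) (f := ρ) (C := 1)
      (fun s _ => by rw [Real.norm_eq_abs, abs_of_nonneg (hρ0 s)]; exact hρ1 s)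
    simpa using this
  have h0 : h 0 = 1 := by simp [hh]
  have h34 : 1 / 4 ≤ h (3 / 4) := by
    have := habs 0 (3 / 4)
    rw [h0] at this
    have := (abs_le.1 this).2
    rw [show |(0 : ℝ) - 3 / 4| = 3 / 4 by norm_num [abs_of_pos]] at this
    linarith
  refine ⟨h, ?_, ?_, ?_, habs⟩
  · rw [contDiff_infty_iff_deriv]
    refine ⟨fun v => (hd v).differentiableAt, ?_⟩
    rw [show deriv h = fun v => -ρ v from funext fun v => (hd v).deriv]
    exact hρs.neg
  · intro v hv
    simp only [hh, sub_right_inj]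
    have : ∫ s in (0 : ℝ)..v, ρ s = ∫ s in (0 : ℝ)..v, (1 : ℝ) := by
      refine intervalIntegral.integral_congr fun s hs => ?_
      have hs' : s ≤ 1 / 2 := hs.2.trans (by simp; linarith)
      simp only [hρ]
      rw [Real.smoothTransition.zero_of_nonpos (by linarith), sub_zero]
    rw [this]; simp
  · intro v
    rcases le_total v (3 / 4) with hv | hv
    · have := hdiff v (3 / 4)
      have h2 : 0 ≤ ∫ s in v..(3 / 4), ρ s := intervalIntegral.integral_nonneg hv fun s _ => hρ0 s
      linarith
    · have h2 := hdiff (3 / 4) v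
      have h3 : ∫ s in (3 / 4)..v, ρ s = ∫ s in (3 / 4)..v, (0 : ℝ) := by
        refine intervalIntegral.integral_congr fun s hs => ?_
        rw [uIcc_of_le hv] at hs
        simp only [hρ]
        rw [Real.smoothTransition.one_of_one_le (by linarith [hs.1]), sub_self]
      rw [h3, intervalIntegral.integral_zero] at h2
      linarith

lemma IsSource.abs_le {f : ℝ × ℝ × ℝ × ℝ → ℝ} (hf : IsSource f) :
    ∃ C, 0 ≤ C ∧ ∀ p, |f p| ≤ C := by
  obtain ⟨C, hC⟩ := hf.bounded 0
  exact ⟨C, (norm_nonneg _).trans (hC 0), fun p => by simpa using hC p⟩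

lemma IsSource.norm_fderiv_le {f : ℝ × ℝ × ℝ × ℝ → ℝ} (hf : IsSource f) :
    ∃ C, 0 ≤ C ∧ ∀ p, ‖fderiv ℝ f p‖ ≤ C := by
  obtain ⟨C, hC⟩ := hf.bounded 1
  refine ⟨C, (norm_nonneg _).trans (hC 0), fun p => ?_⟩
  rw [← norm_iteratedFDeriv_one]
  exact hC p

lemma IsSource.lipschitz {f : ℝ × ℝ × ℝ × ℝ → ℝ} (hf : IsSource f) :
    ∃ C, 0 ≤ C ∧ ∀ p q, |f p - f q| ≤ C * ‖p - q‖ := by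
  obtain ⟨C, h0, hC⟩ := hf.norm_fderiv_le
  refine ⟨C, h0, fun p q => ?_⟩
  exact convex_univ.norm_image_sub_le_of_norm_fderiv_le (𝕜 := ℝ)
    (fun x _ => hf.smooth.differentiable (by simp) x) (fun x _ => hC x) (mem_univ q) (mem_univ p)

/-- The characteristic flow of `(1 - v) v_t + (1 + v) v_x = -f (t, x, y, v)` for short times;
the time of existence does not depend on the initial value `z = (x, y, v)`. -/
theorem exists_characteristic_flow {f : ℝ × ℝ × ℝ × ℝ → ℝ} (hf : IsSource f) :
    ∃ r > 0, ∃ X V : ℝ × ℝ × ℝ × ℝ → ℝ,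
      ContDiffOn ℝ ∞ X (Ioo (-r) r ×ˢ univ) ∧ ContDiffOn ℝ ∞ V (Ioo (-r) r ×ˢ univ) ∧
      (∀ z, X (0, z) = z.1 ∧ V (0, z) = z.2.2) ∧
      (∀ t ∈ Ioo (-r) r, ∀ z, |X (t, z) - z.1| ≤ 1 / 2 ∧ |V (t, z) - z.2.2| ≤ 1 / 2) ∧
      (∀ t ∈ Ioo (-r) r, ∀ x x' y a a',
        |X (t, x, y, a) - X (t, x', y, a') - (x - x')| ≤ 1 / 2 * max |x - x'| |a - a'| ∧
        |V (t, x, y, a) - V (t, x', y, a') - (a - a')| ≤ 1 / 2 * max |x - x'| |a - a'|) ∧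
      ∀ t ∈ Ioo 0 r, ∀ z : ℝ × ℝ × ℝ, z.2.2 ≤ 0 →
        HasDerivAt (fun s => X (s, z)) ((1 + V (t, z)) / (1 - V (t, z))) t ∧
        HasDerivAt (fun s => V (s, z))
          (-f (t, X (t, z), z.2.1, V (t, z)) / (1 - V (t, z))) t := by
  obtain ⟨C₀, hC₀, hf0⟩ := hf.abs_le
  obtain ⟨C₁, hC₁, hf1⟩ := hf.lipschitz
  obtain ⟨h, hs, h1, h4, hlip⟩ := exists_regularized_one_sub
  have hpos : ∀ v, 0 < h v := fun v => lt_of_lt_of_le (by norm_num) (h4 v)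
  have hinv : ∀ v, 1 / h v ≤ 4 := fun v => by
    rw [div_le_iff₀ (hpos v)]; linarith [h4 v]
  have hinv0 : ∀ v, 0 < 1 / h v := fun v => one_div_pos.2 (hpos v)
  have hinvlip : ∀ a b, |1 / h a - 1 / h b| ≤ 16 * |a - b| := fun a b => by
    have : 1 / h a - 1 / h b = (1 / h a) * (1 / h b) * (h b - h a) := by
      have := (hpos a).ne'; have := (hpos b).ne'; field_simp
    rw [this, abs_mul, abs_of_pos (mul_pos (hinv0 a) (hinv0 b)), abs_sub_comm]
    calc _ ≤ 4 * 4 * |a - b| :=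
          mul_le_mul (mul_le_mul (hinv a) (hinv b) (hinv0 b).le (by norm_num)) (hlip a b)
            (abs_nonneg _) (by norm_num)
      _ = _ := by norm_num
  -- Time is added as a coordinate and `y` is frozen, which makes the system autonomous. Writing `(1
  -- + v) / (1 - v) = 2 / (1 - v) - 1` and replacing `1 - v` by `h v` makes the field globally
  -- bounded and Lipschitz.
  let W : ℝ × ℝ × ℝ × ℝ → ℝ × ℝ × ℝ × ℝ := fun p =>
    (1, 2 * (1 / h p.2.2.2) - 1, 0, -(f p * (1 / h p.2.2.2)))
  have hhs : ContDiff ℝ ∞ (fun p : ℝ × ℝ × ℝ × ℝ => 1 / h p.2.2.2) :=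
    contDiff_const.div (hs.comp (by fun_prop)) fun p => (hpos _).ne'
  have hWs : ContDiff ℝ ∞ W :=
    contDiff_const.prodMk (((contDiff_const.mul hhs).sub contDiff_const).prodMk
      (contDiff_const.prodMk (hf.smooth.mul hhs).neg))
  let F : C(ℝ × ℝ × ℝ × ℝ, ℝ × ℝ × ℝ × ℝ) := ⟨W, hWs.continuous⟩
  -- These constants come from `1 / h ≤ 4`, from `1 / h` being `16`-Lipschitz, and from the bounds
  -- `C₀` of `f` and `C₁` of its derivative.
  set L : ℝ := 32 + 4 * C₁ + 16 * C₀ with hLdef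
  set B : ℝ := 8 + 4 * C₀ with hBdef
  have hL0 : 0 < L := by positivity
  have hB0 : 0 < B := by positivity
  have hL : ∀ p q, ‖F p - F q‖ ≤ L * ‖p - q‖ := by
    intro p q
    have hv : |p.2.2.2 - q.2.2.2| ≤ ‖p - q‖ :=
      (norm_snd_le (p - q).2.2).trans ((norm_snd_le (p - q).2).trans (norm_snd_le (p - q)))
    have hi := (hinvlip p.2.2.2 q.2.2.2).trans (mul_le_mul_of_nonneg_left hv (by norm_num))
    have hn := norm_nonneg (p - q)
    have e1 : |2 * (1 / h p.2.2.2) - 1 - (2 * (1 / h q.2.2.2) - 1)| ≤ L * ‖p - q‖ := by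
      rw [show 2 * (1 / h p.2.2.2) - 1 - (2 * (1 / h q.2.2.2) - 1) =
        2 * (1 / h p.2.2.2 - 1 / h q.2.2.2) by ring, abs_mul, abs_two]
      have : 0 ≤ (4 * C₁ + 16 * C₀) * ‖p - q‖ := by positivity
      rw [hLdef]; linarith
    have e2 : |-(f p * (1 / h p.2.2.2)) - -(f q * (1 / h q.2.2.2))| ≤ L * ‖p - q‖ := by
      rw [show -(f p * (1 / h p.2.2.2)) - -(f q * (1 / h q.2.2.2)) =
        -((f p - f q) * (1 / h p.2.2.2) + f q * (1 / h p.2.2.2 - 1 / h q.2.2.2)) by ring, abs_neg]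
      refine (abs_add_le _ _).trans ?_
      rw [abs_mul, abs_mul, abs_of_pos (hinv0 _)]
      have a1 : |f p - f q| * (1 / h p.2.2.2) ≤ C₁ * ‖p - q‖ * 4 :=
        mul_le_mul (hf1 p q) (hinv _) (hinv0 _).le (by positivity)
      have a2 := mul_le_mul (hf0 q) hi (abs_nonneg _) hC₀
      rw [hLdef]; linarith
    have e0 : 0 ≤ L * ‖p - q‖ := by positivity
    have : F p - F q = (0, 2 * (1 / h p.2.2.2) - 1 - (2 * (1 / h q.2.2.2) - 1), 0,
        -(f p * (1 / h p.2.2.2)) - -(f q * (1 / h q.2.2.2))) := by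
      simp [F, W]
    rw [this]
    simp only [Prod.norm_def, Real.norm_eq_abs, abs_zero]
    exact max_le e0 (max_le e1 (max_le e0 e2))
  have hB : ∀ p, ‖F p‖ ≤ B := by
    intro p
    have e1 : |2 * (1 / h p.2.2.2) - 1| ≤ B := by
      rw [abs_le]
      constructor <;> linarith [hinv p.2.2.2, hinv0 p.2.2.2]
    have e2 : |-(f p * (1 / h p.2.2.2))| ≤ B := by
      rw [abs_neg, abs_mul, abs_of_pos (hinv0 _)]
      have := mul_le_mul (hf0 p) (hinv p.2.2.2) (hinv0 _).le hC₀
      linarith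
    change ‖W p‖ ≤ B
    simp only [W, Prod.norm_def, Real.norm_eq_abs, abs_zero, abs_one]
    exact max_le (by linarith) (max_le e1 (max_le hB0.le e2))
  -- `|t| L ≤ 1/3` is the smallness needed for the Lipschitz bounds, and `|t| B ≤ 1/2` keeps the
  -- displacement below `1/2`.
  set r : ℝ := min (1 / (3 * L)) (1 / (2 * B)) with hr
  have hr0 : 0 < r := by positivity
  have hrL : ∀ t ∈ Ioo (-r) r, |t| * L ≤ 1 / 3 := fun t ht => by
    have h2 : |t| ≤ 1 / (3 * L) := (abs_lt.2 ht).le.trans (min_le_left _ _)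
    calc |t| * L ≤ 1 / (3 * L) * L := by gcongr
      _ = 1 / 3 := by field_simp
  have hrL1 : ∀ t ∈ Ioo (-r) r, |t| * L < 1 := fun t ht => (hrL t ht).trans_lt (by norm_num)
  have hrB : ∀ t ∈ Ioo (-r) r, |t| * B ≤ 1 / 2 := fun t ht => by
    have h2 : |t| ≤ 1 / (2 * B) := (abs_lt.2 ht).le.trans (min_le_right _ _)
    calc |t| * B ≤ 1 / (2 * B) * B := by gcongr
      _ = 1 / 2 := by field_simp
  let Z : ℝ × ℝ × ℝ × ℝ → ℝ × ℝ × ℝ × ℝ := fun p => flow F (p.1, 0, p.2)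
  have hZs : ContDiffOn ℝ ∞ Z (Ioo (-r) r ×ˢ univ) := fun p hp => by
    have h1 : ContDiffAt ℝ ∞ (flow F) (p.1, (0 : ℝ), p.2) :=
      contDiffAt_flow hWs hL hL0.le (hrL1 _ hp.1)
    have h2 : ContDiff ℝ ∞ (fun p : ℝ × ℝ × ℝ × ℝ => (p.1, (0 : ℝ), p.2)) := by fun_prop
    exact (h1.comp p h2.contDiffAt).contDiffWithinAt
  have hZ0 : ∀ z, Z (0, z) = (0, z) := fun z => flow_zero hL hL0.le _
  have hdz : ∀ t ∈ Ioo 0 r, ∀ z, HasDerivAt (fun s => Z (s, z)) (W (Z (t, z))) t :=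
    fun t ht z => hasDerivAt_flow (x := ((0 : ℝ), z)) hL hL0.le ht.1 (hrL1 t ⟨(neg_lt_zero.2 hr0).trans ht.1, ht.2⟩)
  have hcont : ∀ t ∈ Ioo 0 r, ∀ z, ContinuousOn (fun s => Z (s, z)) (Icc 0 t) := fun t ht z s hs =>
    ((hZs.continuousOn.continuousAt ((isOpen_Ioo.prod isOpen_univ).mem_nhds
      ⟨⟨by linarith [hs.1], hs.2.trans_lt ht.2⟩, mem_univ _⟩)).comp
        (by fun_prop : ContinuousAt (fun s => (s, z)) s)).continuousWithinAt
  have htime : ∀ t ∈ Ioo 0 r, ∀ z, (Z (t, z)).1 = t := by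
    intro t ht z
    obtain ⟨c, _, hc⟩ := exists_hasDerivAt_eq_slope (fun s => (Z (s, z)).1) (fun _ => 1) ht.1
      (continuous_fst.comp_continuousOn (hcont t ht z))
      (fun s hs => (hdz s ⟨hs.1, hs.2.trans ht.2⟩ z).fst)
    simp only [hZ0, sub_zero] at hc
    rw [eq_div_iff ht.1.ne'] at hc
    linarith
  have hy : ∀ t ∈ Ioo 0 r, ∀ z, (Z (t, z)).2.2.1 = z.2.1 := by
    intro t ht z
    obtain ⟨c, _, hc⟩ := exists_hasDerivAt_eq_slope (fun s => (Z (s, z)).2.2.1) (fun _ => 0) ht.1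
      (hcont t ht z).snd.snd.fst
      (fun s hs => (hdz s ⟨hs.1, hs.2.trans ht.2⟩ z).snd.snd.fst)
    simp only [hZ0, sub_zero] at hc
    rw [eq_div_iff ht.1.ne'] at hc
    linarith
  have hdist : ∀ t ∈ Ioo (-r) r, ∀ z, ‖Z (t, z) - (0, z)‖ ≤ 1 / 2 := fun t ht z =>
    (norm_flow_sub_le hL hL0.le hB0.le hB (hrL1 t ht) _).trans (hrB t ht)
  refine ⟨r, hr0, fun p => (Z p).2.1, fun p => (Z p).2.2.2, ?_, ?_, ?_, ?_, ?_, ?_⟩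
  · exact hZs.snd.fst
  · exact hZs.snd.snd.snd
  · intro z; simp [hZ0]
  · intro t ht z
    have h := hdist t ht z
    exact ⟨((norm_fst_le (Z (t, z) - (0, z)).2).trans (norm_snd_le _)).trans h,
      ((norm_snd_le (Z (t, z) - (0, z)).2.2).trans ((norm_snd_le (Z (t, z) - (0, z)).2).trans
        (norm_snd_le _))).trans h⟩
  · intro t ht x x' y a a'
    have h := norm_flow_sub_sub_le hL hL0.le (hrL t ht) ((0, x, y, a) : ℝ × ℝ × ℝ × ℝ) (0, x', y, a')
    have hn : ‖((0, x, y, a) : ℝ × ℝ × ℝ × ℝ) - (0, x', y, a')‖ = max |x - x'| |a - a'| := by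
      simp [Prod.norm_def]
    rw [hn] at h
    set q := flow F (t, 0, x, y, a) - flow F (t, 0, x', y, a') -
      (((0, x, y, a) : ℝ × ℝ × ℝ × ℝ) - (0, x', y, a')) with hq
    exact ⟨((norm_fst_le q.2).trans (norm_snd_le q)).trans h,
      ((norm_snd_le q.2.2).trans ((norm_snd_le q.2).trans (norm_snd_le q))).trans h⟩
  · intro t ht z hz
    -- Starting from `v ≤ 0`, the curve remains where `h v = 1 - v`, so it solves the original
    -- system.
    have hV : (Z (t, z)).2.2.2 ≤ 1 / 2 := by
      have h := hdist t ⟨by linarith [ht.1], ht.2⟩ z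
      have h2 : |(Z (t, z)).2.2.2 - z.2.2| ≤ 1 / 2 :=
        ((norm_snd_le (Z (t, z) - (0, z)).2.2).trans ((norm_snd_le (Z (t, z) - (0, z)).2).trans
        (norm_snd_le _))).trans h
      linarith [(abs_le.1 h2).2]
    have hne : (1 : ℝ) - (Z (t, z)).2.2.2 ≠ 0 := by linarith
    have hd := hdz t ht z
    have hp : Z (t, z) = (t, (Z (t, z)).2.1, z.2.1, (Z (t, z)).2.2.2) := by
      conv_lhs => rw [← Prod.mk.eta (p := Z (t, z)), htime t ht z,
        ← Prod.mk.eta (p := (Z (t, z)).2), ← Prod.mk.eta (p := (Z (t, z)).2.2), hy t ht z]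
    constructor
    · have h2 : HasDerivAt (fun s => (Z (s, z)).2.1) (W (Z (t, z))).2.1 t := hd.snd.fst
      convert! h2 using 1
      simp only [W, h1 _ hV]
      field_simp
      ring
    · have h2 : HasDerivAt (fun s => (Z (s, z)).2.2.2) (W (Z (t, z))).2.2.2 t := hd.snd.snd.snd
      convert! h2 using 1
      simp only [W, h1 _ hV]
      rw [← hp]
      ring

end LogWave

/-! ### Characteristics issued from the data and their first focal time -/

namespace LogWave

section Calculus

lemma two_le_infty : (2 : WithTop ℕ∞) ≤ (∞ : WithTop ℕ∞) := WithTop.coe_le_coe.2 (le_top : (2 : ℕ∞) ≤ ⊤)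

/-- A function of `(t, x₁, x₂)` seen as a function on the product. -/
def unc (u : ℝ → ℝ → ℝ → ℝ) : ℝ × ℝ × ℝ → ℝ := fun p => u p.1 p.2.1 p.2.2

variable {u : ℝ → ℝ → ℝ → ℝ} {t x y : ℝ} {S : Set (ℝ × ℝ × ℝ)}

lemma hasDerivAt_curve (hu : DifferentiableAt ℝ (unc u) (t, x, y)) {a b s : ℝ} {γ₁ γ₂ : ℝ → ℝ}
    (h₁ : HasDerivAt γ₁ a s) (h₂ : HasDerivAt γ₂ b s) (e₁ : γ₁ s = t) (e₂ : γ₂ s = x) :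
    HasDerivAt (fun s => u (γ₁ s) (γ₂ s) y)
      (fderiv ℝ (unc u) (t, x, y) (1, 0, 0) * a + fderiv ℝ (unc u) (t, x, y) (0, 1, 0) * b) s := by
  subst e₁ e₂
  have h := hu.hasFDerivAt.comp_hasDerivAt s (h₁.prodMk (h₂.prodMk (hasDerivAt_const s y)))
  have e : ((a, b, 0) : ℝ × ℝ × ℝ) = a • (1, 0, 0) + b • (0, 1, 0) := by simp
  rw [e, map_add, map_smul, map_smul, smul_eq_mul, smul_eq_mul, mul_comm a, mul_comm b] at h
  exact h

lemma dt_eq_fderiv (hu : DifferentiableAt ℝ (unc u) (t, x, y)) :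
    dt u t x y = fderiv ℝ (unc u) (t, x, y) (1, 0, 0) := by
  have h := (hasDerivAt_curve hu (hasDerivAt_id' t) (hasDerivAt_const t x) rfl rfl).deriv
  simpa [dt, dx₁] using h

lemma dx₁_eq_fderiv (hu : DifferentiableAt ℝ (unc u) (t, x, y)) :
    dx₁ u t x y = fderiv ℝ (unc u) (t, x, y) (0, 1, 0) := by
  have h := (hasDerivAt_curve hu (hasDerivAt_const x t) (hasDerivAt_id' x) rfl rfl).deriv
  simpa [dt, dx₁] using h

lemma hasDerivAt_comp_curve (hu : DifferentiableAt ℝ (unc u) (t, x, y)) {a b s : ℝ} {γ₁ γ₂ : ℝ → ℝ}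
    (h₁ : HasDerivAt γ₁ a s) (h₂ : HasDerivAt γ₂ b s) (e₁ : γ₁ s = t) (e₂ : γ₂ s = x) :
    HasDerivAt (fun s => u (γ₁ s) (γ₂ s) y) (dt u t x y * a + dx₁ u t x y * b) s := by
  rw [dt_eq_fderiv hu, dx₁_eq_fderiv hu]
  exact hasDerivAt_curve hu h₁ h₂ e₁ e₂

lemma hasDerivAt_dt (hu : DifferentiableAt ℝ (unc u) (t, x, y)) :
    HasDerivAt (fun s => u s x y) (dt u t x y) t := by
  simpa using hasDerivAt_comp_curve hu (hasDerivAt_id' t) (hasDerivAt_const t x) rfl rfl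

lemma hasDerivAt_dx₁ (hu : DifferentiableAt ℝ (unc u) (t, x, y)) :
    HasDerivAt (fun x => u t x y) (dx₁ u t x y) x := by
  simpa using hasDerivAt_comp_curve hu (hasDerivAt_const x t) (hasDerivAt_id' x) rfl rfl

lemma ContDiffOn.differentiableAt_unc (hu : ContDiffOn ℝ ∞ (unc u) S) (hS : IsOpen S)
    (h : (t, x, y) ∈ S) : DifferentiableAt ℝ (unc u) (t, x, y) :=
  (hu.contDiffAt (hS.mem_nhds h)).differentiableAt (by simp)

lemma contDiffOn_fderiv_apply (hu : ContDiffOn ℝ ∞ (unc u) S) (hS : IsOpen S) (w : ℝ × ℝ × ℝ) :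
    ContDiffOn ℝ ∞ (fun p => fderiv ℝ (unc u) p w) S :=
  (hu.fderiv_of_isOpen hS (by simp)).clm_apply contDiffOn_const

lemma contDiffOn_dt (hu : ContDiffOn ℝ ∞ (unc u) S) (hS : IsOpen S) :
    ContDiffOn ℝ ∞ (unc (dt u)) S :=
  (contDiffOn_fderiv_apply hu hS (1, 0, 0)).congr fun _ hp =>
    dt_eq_fderiv (ContDiffOn.differentiableAt_unc hu hS hp)

lemma contDiffOn_dx₁ (hu : ContDiffOn ℝ ∞ (unc u) S) (hS : IsOpen S) :
    ContDiffOn ℝ ∞ (unc (dx₁ u)) S :=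
  (contDiffOn_fderiv_apply hu hS (0, 1, 0)).congr fun _ hp =>
    dx₁_eq_fderiv (ContDiffOn.differentiableAt_unc hu hS hp)

lemma dt_dx₁_comm (hu : ContDiffOn ℝ ∞ (unc u) S) (hS : IsOpen S) (h : (t, x, y) ∈ S) :
    dt (dx₁ u) t x y = dx₁ (dt u) t x y := by
  have hd : ∀ p ∈ S, DifferentiableAt ℝ (unc u) p := fun p hp =>
    ContDiffOn.differentiableAt_unc hu hS hp
  have hc := hu.contDiffAt (hS.mem_nhds h)
  have hf : DifferentiableAt ℝ (fderiv ℝ (unc u)) (t, x, y) :=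
    (hc.fderiv_right (m := 1) (by simpa [one_add_one_eq_two] using two_le_infty)).differentiableAt (by simp)
  have key : ∀ w : ℝ × ℝ × ℝ, ∀ q : ℝ → ℝ → ℝ → ℝ, (∀ p ∈ S, unc q p = fderiv ℝ (unc u) p w) →
      ∀ z, fderiv ℝ (unc q) (t, x, y) z = fderiv ℝ (fderiv ℝ (unc u)) (t, x, y) z w := by
    intro w q hq z
    have e : unc q =ᶠ[𝓝 (t, x, y)] fun p => fderiv ℝ (unc u) p w := by
      filter_upwards [hS.mem_nhds h] with p hp using hq p hp
    rw [e.fderiv_eq, fderiv_clm_apply hf (differentiableAt_const w)]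
    simp
  rw [dt_eq_fderiv (ContDiffOn.differentiableAt_unc (contDiffOn_dx₁ hu hS) hS h),
    dx₁_eq_fderiv (ContDiffOn.differentiableAt_unc (contDiffOn_dt hu hS) hS h),
    key (0, 1, 0) (dx₁ u) fun p hp => dx₁_eq_fderiv (hd p hp),
    key (1, 0, 0) (dt u) fun p hp => dt_eq_fderiv (hd p hp)]
  exact (hc.isSymmSndFDerivAt (by simpa using two_le_infty)).eq _ _

end Calculus

/-- `X, V` are the characteristics of `(1 - v) v_t + (1 + v) v_x = -f (t, x, y, v)` with `v = χ` at
`t = 0`, together with Lipschitz bounds in the initial point which are uniform up to time `r`. -/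
structure IsCharacteristics (f : ℝ × ℝ × ℝ × ℝ → ℝ) (χ : ℝ → ℝ → ℝ) (r : ℝ)
    (X V : ℝ → ℝ → ℝ → ℝ) : Prop where
  smooth_X : ContDiffOn ℝ ∞ (unc X) (Ioo (-r) r ×ˢ univ)
  smooth_V : ContDiffOn ℝ ∞ (unc V) (Ioo (-r) r ×ˢ univ)
  X_zero : ∀ x y, X 0 x y = x
  V_zero : ∀ x y, V 0 x y = χ x y
  X_near : ∀ t ∈ Ioo (-r) r, ∀ x y, |X t x y - x| ≤ 1 / 2
  V_near : ∀ t ∈ Ioo (-r) r, ∀ x y, |V t x y - χ x y| ≤ 1 / 2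
  X_lip : ∀ t ∈ Ioo (-r) r, ∀ x x' y,
    |X t x y - X t x' y - (x - x')| ≤ 1 / 2 * max |x - x'| |χ x y - χ x' y|
  V_lip : ∀ t ∈ Ioo (-r) r, ∀ x x' y,
    |V t x y - V t x' y - (χ x y - χ x' y)| ≤ 1 / 2 * max |x - x'| |χ x y - χ x' y|
  deriv_X : ∀ t ∈ Ioo 0 r, ∀ x y,
    HasDerivAt (fun s => X s x y) ((1 + V t x y) / (1 - V t x y)) t
  deriv_V : ∀ t ∈ Ioo 0 r, ∀ x y,
    HasDerivAt (fun s => V s x y) (-f (t, X t x y, y, V t x y) / (1 - V t x y)) t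

theorem exists_isCharacteristics {f : ℝ × ℝ × ℝ × ℝ → ℝ} (hf : IsSource f) :
    ∃ r > 0, ∀ χ : ℝ → ℝ → ℝ, ContDiff ℝ ∞ (fun x : ℝ × ℝ => χ x.1 x.2) → (∀ x y, χ x y ≤ 0) →
      ∃ X V, IsCharacteristics f χ r X V := by
  obtain ⟨r, hr, X, V, hX, hV, h0, hnear, hlip, hd⟩ := exists_characteristic_flow hf
  refine ⟨r, hr, fun χ hχ hneg => ⟨fun t x y => X (t, x, y, χ x y), fun t x y => V (t, x, y, χ x y),
    ?_⟩⟩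
  have hι : ContDiff ℝ ∞ (fun p : ℝ × ℝ × ℝ => (p.1, p.2.1, p.2.2, χ p.2.1 p.2.2)) := by
    have : ContDiff ℝ ∞ (fun p : ℝ × ℝ × ℝ => χ p.2.1 p.2.2) := hχ.comp contDiff_snd
    fun_prop
  have hm : MapsTo (fun p : ℝ × ℝ × ℝ => (p.1, p.2.1, p.2.2, χ p.2.1 p.2.2))
      (Ioo (-r) r ×ˢ univ) (Ioo (-r) r ×ˢ univ) := fun p hp => ⟨hp.1, mem_univ _⟩
  exact {
    smooth_X := hX.comp hι.contDiffOn hm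
    smooth_V := hV.comp hι.contDiffOn hm
    X_zero := fun x y => (h0 _).1
    V_zero := fun x y => (h0 _).2
    X_near := fun t ht x y => (hnear t ht _).1
    V_near := fun t ht x y => (hnear t ht _).2
    X_lip := fun t ht x x' y => (hlip t ht x x' y _ _).1
    V_lip := fun t ht x x' y => (hlip t ht x x' y _ _).2
    deriv_X := fun t ht x y => (hd t ht (x, y, χ x y) (hneg x y)).1
    deriv_V := fun t ht x y => (hd t ht (x, y, χ x y) (hneg x y)).2 }

lemma isOpen_slab (a b : ℝ) : IsOpen (Ioo a b ×ˢ (univ : Set (ℝ × ℝ))) :=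
  isOpen_Ioo.prod isOpen_univ

namespace IsCharacteristics

variable {f : ℝ × ℝ × ℝ × ℝ → ℝ} {χ : ℝ → ℝ → ℝ} {r : ℝ} {X V : ℝ → ℝ → ℝ → ℝ}

lemma V_le (h : IsCharacteristics f χ r X V) (hneg : ∀ x y, χ x y ≤ 0) {t : ℝ}
    (ht : t ∈ Ioo (-r) r) (x y : ℝ) : V t x y ≤ 1 / 2 := by
  linarith [(abs_le.1 (h.V_near t ht x y)).2, hneg x y]

lemma differentiableAt_X (h : IsCharacteristics f χ r X V) {t : ℝ} (ht : t ∈ Ioo (-r) r) (x y : ℝ) :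
    DifferentiableAt ℝ (unc X) (t, x, y) :=
  ContDiffOn.differentiableAt_unc h.smooth_X (isOpen_slab _ _) ⟨ht, mem_univ _⟩

lemma differentiableAt_V (h : IsCharacteristics f χ r X V) {t : ℝ} (ht : t ∈ Ioo (-r) r) (x y : ℝ) :
    DifferentiableAt ℝ (unc V) (t, x, y) :=
  ContDiffOn.differentiableAt_unc h.smooth_V (isOpen_slab _ _) ⟨ht, mem_univ _⟩

/-- Limit of difference quotients in `X_lip` and `V_lip`. A consequence used at the focal point:
where `X_x = 0`, necessarily `|c| ≥ 2`, and then `V_x` cannot vanish. -/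
lemma abs_dx₁_sub_le (h : IsCharacteristics f χ r X V) {t : ℝ} (ht : t ∈ Ioo (-r) r) {x y c : ℝ}
    (hc : HasDerivAt (fun x => χ x y) c x) :
    |dx₁ X t x y - 1| ≤ 1 / 2 * max 1 |c| ∧ |dx₁ V t x y - c| ≤ 1 / 2 * max 1 |c| := by
  have hX := hasDerivAt_iff_tendsto_slope.1 (hasDerivAt_dx₁ (h.differentiableAt_X ht x y))
  have hV := hasDerivAt_iff_tendsto_slope.1 (hasDerivAt_dx₁ (h.differentiableAt_V ht x y))
  have hχ := hasDerivAt_iff_tendsto_slope.1 hc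
  have hscale : ∀ x' : ℝ, x' ≠ x → |x' - x| ≠ 0 := fun x' hx' => abs_ne_zero.2 (sub_ne_zero.2 hx')
  have hmax : ∀ x' : ℝ, x' ≠ x → max |x' - x| |χ x' y - χ x y| =
      |x' - x| * max 1 |slope (fun x => χ x y) x x'| := by
    intro x' hx'
    rw [mul_max_of_nonneg _ _ (abs_nonneg _), mul_one, ← abs_mul]
    congr 2
    rw [slope_def_field]
    field_simp [sub_ne_zero.2 hx']
  constructor
  · refine le_of_tendsto_of_tendsto ((hX.sub_const 1).abs)
      ((tendsto_const_nhds.max hχ.abs).const_mul (1 / 2)) ?_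
    filter_upwards [self_mem_nhdsWithin] with x' hx'
    have h1 := h.X_lip t ht x' x y
    rw [hmax x' hx'] at h1
    refine le_of_mul_le_mul_left ?_ (abs_pos.2 (sub_ne_zero.2 hx'))
    rw [← abs_mul, slope_def_field]
    have : (x' - x) * ((X t x' y - X t x y) / (x' - x) - 1) = X t x' y - X t x y - (x' - x) := by
      field_simp [sub_ne_zero.2 hx']
    rw [this]
    linarith
  · refine le_of_tendsto_of_tendsto ((hV.sub hχ).abs)
      ((tendsto_const_nhds.max hχ.abs).const_mul (1 / 2)) ?_
    filter_upwards [self_mem_nhdsWithin] with x' hx'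
    have h1 := h.V_lip t ht x' x y
    rw [hmax x' hx'] at h1
    refine le_of_mul_le_mul_left ?_ (abs_pos.2 (sub_ne_zero.2 hx'))
    have : (x' - x) * (slope (fun x => V t x y) x x' - slope (fun x => χ x y) x x') =
        V t x' y - V t x y - (χ x' y - χ x y) := by
      rw [slope_def_field, slope_def_field]
      field_simp [sub_ne_zero.2 hx']
    rw [← abs_mul, this]
    linarith

/-- Where `χ` vanishes locally its slope is `0` and `X_x` stays within `1/2` of `1`. This confines
the zeros of `X_x` to a compact set of labels. -/
lemma dx₁_X_ge_of_notMem_tsupport (h : IsCharacteristics f χ r X V) {t : ℝ} (ht : t ∈ Ioo (-r) r)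
    {x y : ℝ} (hx : (x, y) ∉ tsupport fun x : ℝ × ℝ => χ x.1 x.2) : 1 / 2 ≤ dx₁ X t x y := by
  have h0 : ∀ᶠ x' in 𝓝 x, χ x' y = 0 := by
    have := (notMem_tsupport_iff_eventuallyEq.1 hx)
    exact (by fun_prop : ContinuousAt (fun x' => (x', y)) x) this
  have hd : HasDerivAt (fun x => χ x y) 0 x :=
    (hasDerivAt_const x (0 : ℝ)).congr_of_eventuallyEq h0
  have := (abs_le.1 (h.abs_dx₁_sub_le ht hd).1).1
  simp at this
  linarith

lemma dx₁_X_zero (h : IsCharacteristics f χ r X V) (x y : ℝ) : dx₁ X 0 x y = 1 := by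
  have : (fun x => X 0 x y) = fun x => x := funext fun x => h.X_zero x y
  simp [dx₁, this]

lemma continuousOn_dx₁_X (h : IsCharacteristics f χ r X V) :
    ContinuousOn (unc (dx₁ X)) (Ioo (-r) r ×ˢ univ) :=
  (contDiffOn_dx₁ h.smooth_X (isOpen_slab _ _)).continuousOn

/-- If two characteristics have crossed at time `t₁`, then there is a first time `T` at which
`∂ₓX` vanishes. -/
theorem exists_first_vanishing (h : IsCharacteristics f χ r X V)
    (hc : HasCompactSupport fun x : ℝ × ℝ => χ x.1 x.2) {t₁ a b y : ℝ} (ht₁ : t₁ ∈ Ioo 0 r)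
    (hab : a < b) (hX : X t₁ b y ≤ X t₁ a y) :
    ∃ T ∈ Ioc 0 t₁, ∃ r' ∈ Ioo 0 r, (∀ t ∈ Ioo (-r') T, ∀ x y, 0 < dx₁ X t x y) ∧
      (∀ x y, 0 ≤ dx₁ X T x y) ∧ ∃ x₀ y₀, dx₁ X T x₀ y₀ = 0 := by
  set K := tsupport fun x : ℝ × ℝ => χ x.1 x.2
  have hr : 0 < r := ht₁.1.trans ht₁.2
  have hslab : ∀ t ∈ Icc 0 t₁, t ∈ Ioo (-r) r := fun t ht =>
    ⟨by linarith [ht.1], ht.2.trans_lt ht₁.2⟩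
  have hcont := h.continuousOn_dx₁_X
  -- The times and labels with `X_x ≤ 0`. This set is compact, so its projection to the time axis
  -- has a least element, which is the focal time.
  set Z := (Icc 0 t₁ ×ˢ K) ∩ {q | unc (dx₁ X) q ∈ Iic 0}
  have hZ : IsCompact Z := by
    have hZ' : IsCompact (Icc 0 t₁ ×ˢ K) := isCompact_Icc.prod hc
    refine hZ'.of_isClosed_subset ?_ inter_subset_left
    exact ContinuousOn.preimage_isClosed_of_isClosed
      (hcont.mono fun q hq => ⟨hslab _ hq.1, mem_univ _⟩) hZ'.isClosed isClosed_Iic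
  have hmem : ∀ t ∈ Icc 0 t₁, ∀ x y, dx₁ X t x y ≤ 0 → (t, x, y) ∈ Z := by
    intro t ht x y hle
    refine ⟨⟨ht, ?_⟩, hle⟩
    by_contra hK
    linarith [h.dx₁_X_ge_of_notMem_tsupport (hslab t ht) hK]
  -- Two labels in the wrong order at time `t₁` force a nonpositive slope between them, by the mean
  -- value theorem.
  have hne : Z.Nonempty := by
    have hd : ∀ x, HasDerivAt (fun x => X t₁ x y) (dx₁ X t₁ x y) x := fun x =>
      hasDerivAt_dx₁ (h.differentiableAt_X (hslab _ ⟨ht₁.1.le, le_rfl⟩) x y)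
    obtain ⟨c, _, hc⟩ := exists_hasDerivAt_eq_slope (fun x => X t₁ x y) (fun x => dx₁ X t₁ x y) hab
      (fun x _ => (hd x).continuousAt.continuousWithinAt) (fun x _ => hd x)
    exact ⟨_, hmem t₁ ⟨ht₁.1.le, le_rfl⟩ c y
      (hc ▸ div_nonpos_of_nonpos_of_nonneg (by simpa using hX) (by linarith))⟩
  obtain ⟨T, ⟨⟨T', x₀, y₀⟩, hT, rfl⟩, hleast⟩ := (hZ.image continuous_fst).exists_isLeast (hne.image _)
  simp only at hleast ⊢
  have hT0 : 0 < T' := by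
    refine lt_of_le_of_ne hT.1.1.1 fun h0 => ?_
    have h1 : dx₁ X T' x₀ y₀ ≤ 0 := hT.2
    rw [← h0, h.dx₁_X_zero] at h1
    linarith
  have hpos : ∀ t ∈ Ico 0 T', ∀ x y, 0 < dx₁ X t x y := by
    intro t ht x y
    by_contra! hle
    exact absurd (hleast ⟨_, hmem t ⟨ht.1, ht.2.le.trans hT.1.1.2⟩ x y hle, rfl⟩) (not_le.2 ht.2)
  -- Positivity is also needed for slightly negative times, so that `t = 0` is interior to the slab
  -- on which the solution is constructed.
  have hneg : ∀ᶠ t in 𝓝 (0 : ℝ), ∀ p ∈ K, 0 < unc (dx₁ X) (t, p) := by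
    refine hc.eventually_forall_of_forall_eventually fun p _ => ?_
    have hz : (0 : ℝ) ∈ Ioo (-r) r := ⟨by linarith, hr⟩
    have hca : ContinuousAt (unc (dx₁ X)) (0, p) :=
      hcont.continuousAt ((isOpen_slab _ _).mem_nhds ⟨hz, mem_univ _⟩)
    refine hca.eventually (lt_mem_nhds ?_)
    change 0 < dx₁ X 0 p.1 p.2
    rw [h.dx₁_X_zero]
    exact one_pos
  obtain ⟨ρ, hρ, hρ'⟩ := Metric.eventually_nhds_iff.1 hneg
  refine ⟨T', ⟨hT0, hT.1.1.2⟩, min ρ (r / 2), ⟨by positivity, (min_le_right _ _).trans_lt (by linarith)⟩,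
    ?_, ?_, x₀, y₀, ?_⟩
  · intro t ht x y
    rcases le_or_gt 0 t with h0 | h0
    · exact hpos t ⟨h0, ht.2⟩ x y
    · have h1 := ht.1
      have htr : t ∈ Ioo (-r) r := ⟨by linarith [min_le_right ρ (r / 2)], by linarith⟩
      by_cases hK : (x, y) ∈ K
      · exact hρ' (by rw [Real.dist_eq, sub_zero, abs_of_neg h0]; linarith [min_le_left ρ (r / 2)])
          (x, y) hK
      · linarith [h.dx₁_X_ge_of_notMem_tsupport htr hK]
  · intro x y
    have hca : ContinuousAt (fun t => dx₁ X t x y) T' :=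
      ContinuousAt.comp (g := unc (dx₁ X))
        (hcont.continuousAt ((isOpen_slab _ _).mem_nhds ⟨hslab T' hT.1.1, mem_univ _⟩))
        (f := fun t => (t, x, y)) (x := T') (by fun_prop)
    refine ge_of_tendsto (hca.tendsto.mono_left nhdsWithin_le_nhds : Tendsto _ (𝓝[<] T') _) ?_
    filter_upwards [Ioo_mem_nhdsLT hT0] with t ht using (hpos t ⟨ht.1.le, ht.2⟩ x y).le
  · refine le_antisymm hT.2 ?_
    have hca : ContinuousAt (fun t => dx₁ X t x₀ y₀) T' :=
      (hcont.continuousAt ((isOpen_slab _ _).mem_nhds ⟨hslab _ hT.1.1, mem_univ _⟩)).comp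
        (f := fun t => (t, x₀, y₀)) (x := T') (by fun_prop)
    refine ge_of_tendsto (hca.tendsto.mono_left nhdsWithin_le_nhds : Tendsto _ (𝓝[<] T') _) ?_
    filter_upwards [Ioo_mem_nhdsLT hT0] with t ht using (hpos t ⟨ht.1.le, ht.2⟩ x₀ y₀).le

end IsCharacteristics

end LogWave

/-! ### Construction of the solution up to the focal time -/

namespace LogWave

/-- A smooth cutoff function of an interval. -/
lemma exists_cutoff {a a' b' b : ℝ} (h₁ : a < a') (h₂ : b' < b) :
    ∃ η : ℝ → ℝ, ContDiff ℝ ∞ η ∧ (∀ t ∈ Icc a' b', η t = 1) ∧ (∀ t, t ≤ a → η t = 0) ∧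
      (∀ t, b ≤ t → η t = 0) ∧ ∀ t, η t ∈ Icc (0 : ℝ) 1 := by
  refine ⟨fun t => Real.smoothTransition ((t - a) / (a' - a)) *
    Real.smoothTransition ((b - t) / (b - b')), ?_, ?_, ?_, ?_, ?_⟩
  · exact (Real.smoothTransition.contDiff.comp (by fun_prop)).mul
      (Real.smoothTransition.contDiff.comp (by fun_prop))
  · intro t ht
    dsimp only
    rw [Real.smoothTransition.one_of_one_le, Real.smoothTransition.one_of_one_le, one_mul]
    · rw [le_div_iff₀ (by linarith)]; linarith [ht.2]
    · rw [le_div_iff₀ (by linarith)]; linarith [ht.1]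
  · intro t ht
    dsimp only
    rw [Real.smoothTransition.zero_of_nonpos, zero_mul]
    exact div_nonpos_of_nonpos_of_nonneg (by linarith) (by linarith)
  · intro t ht
    dsimp only
    rw [mul_comm, Real.smoothTransition.zero_of_nonpos, zero_mul]
    exact div_nonpos_of_nonpos_of_nonneg (by linarith) (by linarith)
  · exact fun t => ⟨mul_nonneg (Real.smoothTransition.nonneg _) (Real.smoothTransition.nonneg _),
      mul_le_one₀ (Real.smoothTransition.le_one _) (Real.smoothTransition.nonneg _)
        (Real.smoothTransition.le_one _)⟩

/-- Every smooth function on a slab around `{t = 0}` is `D u` with `u` smooth and vanishing for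
`t = 0`. -/
theorem exists_D_eq {v : ℝ → ℝ → ℝ → ℝ} {A B : ℝ} (hA : A < 0) (hB : 0 < B)
    (hv : ContDiffOn ℝ ∞ (unc v) (Ioo A B ×ˢ univ)) :
    ∃ u : ℝ → ℝ → ℝ → ℝ, ContDiffOn ℝ ∞ (unc u) (Ioo A B ×ˢ univ) ∧ (∀ x y, u 0 x y = 0) ∧
      ∀ t ∈ Ioo A B, ∀ x y, D u t x y = v t x y := by
  -- Along a line `x + t = const` the derivative of `u` is `u_t - u_x = -D u`, so `u` is found by
  -- integrating `-v` from `t = 0`.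
  set u : ℝ → ℝ → ℝ → ℝ := fun t x y => -∫ s in (0 : ℝ)..t, v s (x + t - s) y with hu
  have hsmooth : ContDiffOn ℝ ∞ (unc u) (Ioo A B ×ˢ univ) := by
    rintro ⟨t₀, x₀, y₀⟩ ⟨ht₀, -⟩
    simp only at ht₀
    obtain ⟨a, ha, ha'⟩ := exists_between (show A < min t₀ 0 from lt_min ht₀.1 hA)
    obtain ⟨a₁, ha₁, ha₁'⟩ := exists_between ha
    obtain ⟨b, hb, hb'⟩ := exists_between (show max t₀ 0 < B from max_lt ht₀.2 hB)
    obtain ⟨b₁, hb₁, hb₁'⟩ := exists_between hb'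
    obtain ⟨η, hη, hη1, hηa, hηb, -⟩ := exists_cutoff ha₁' hb₁
    -- For smoothness near `t₀`, `v` is multiplied by a time cutoff equal to `1` on `[a, b]`, which
    -- contains `0` and `t₀`. The product extends by zero to a smooth function on the whole space,
    -- to which smooth dependence of integrals over the unit interval applies after rescaling.
    have hvη : ContDiff ℝ ∞ (fun p : ℝ × ℝ × ℝ => η p.1 * unc v p) := by
      rw [contDiff_iff_contDiffAt]
      intro p
      by_cases hp : p.1 ∈ Ioo A B
      · exact (hη.contDiffAt.comp p contDiffAt_fst).mul
          (hv.contDiffAt ((isOpen_slab A B).mem_nhds ⟨hp, mem_univ _⟩))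
      · have : ∀ᶠ q : ℝ × ℝ × ℝ in 𝓝 p, q.1 ≤ a₁ ∨ b₁ ≤ q.1 := by
          rw [mem_Ioo, not_and_or, not_lt, not_lt] at hp
          rcases hp with hp | hp
          · filter_upwards [(isOpen_Iio.preimage continuous_fst).mem_nhds
              (show p ∈ Prod.fst ⁻¹' Iio a₁ from hp.trans_lt ha₁)] with q hq using Or.inl (le_of_lt hq)
          · filter_upwards [(isOpen_Ioi.preimage continuous_fst).mem_nhds
              (show p ∈ Prod.fst ⁻¹' Ioi b₁ from hb₁'.trans_le hp)] with q hq using Or.inr (le_of_lt hq)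
        refine (contDiffAt_const (c := (0 : ℝ))).congr_of_eventuallyEq ?_
        filter_upwards [this] with q hq
        rcases hq with hq | hq
        · simp [hηa _ hq]
        · simp [hηb _ hq]
    let g : (ℝ × ℝ × ℝ) × ℝ → ℝ := fun q =>
      (fun p : ℝ × ℝ × ℝ => η p.1 * unc v p)
        (q.1.1 * q.2, q.1.2.1 + q.1.1 * (1 - q.2), q.1.2.2)
    have hg : ContDiff ℝ ∞ g := hvη.comp (by fun_prop)
    have hint := (contDiff_fst.mul (contDiff_integral_unitInterval hg)).neg
    refine (hint.contDiffAt.congr_of_eventuallyEq ?_).contDiffWithinAt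
    have hnear : Ioo a b ×ˢ univ ∈ 𝓝 (t₀, x₀, y₀) := (isOpen_slab a b).mem_nhds
      ⟨⟨ha'.trans_le (min_le_left _ _), (le_max_left _ _).trans_lt hb⟩, mem_univ _⟩
    filter_upwards [hnear] with p hp
    obtain ⟨t, x, y⟩ := p
    have ht : t ∈ Ioo a b := hp.1
    have h0 : (0 : ℝ) ∈ Ioo a b := ⟨ha'.trans_le (min_le_right _ _), (le_max_right _ _).trans_lt hb⟩
    simp only [unc, hu]
    congr 1
    have e1 : ∫ s in (0 : ℝ)..1, g ((t, x, y), s) =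
        ∫ s in (0 : ℝ)..1, (fun s => v s (x + t - s) y) (t * s) := by
      refine intervalIntegral.integral_congr fun s hs => ?_
      rw [uIcc_of_le zero_le_one] at hs
      have hts : t * s ∈ Icc a b := by
        have := (convex_Icc a b) (Ioo_subset_Icc_self h0) (Ioo_subset_Icc_self ht)
          (sub_nonneg.2 hs.2) hs.1 (by ring)
        simpa [mul_comm] using this
      simp only [g, hη1 _ hts, one_mul, unc]
      congr 1
      ring
    rw [e1, ← smul_eq_mul, intervalIntegral.smul_integral_comp_mul_left (fun s => v s (x + t - s) y)]
    simp
  refine ⟨u, hsmooth, fun x y => by simp [hu], fun t ht x y => ?_⟩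
  have hdiff := ContDiffOn.differentiableAt_unc (t := t) (x := x) (y := y) hsmooth (isOpen_slab A B)
    ⟨ht, mem_univ _⟩
  have h1 := hasDerivAt_comp_curve hdiff (hasDerivAt_id' t) ((hasDerivAt_id' t).const_sub (x + t)) rfl
    (by simp)
  have hline : ContinuousOn (fun s => v s (x + t - s) y) (Ioo A B) :=
    hv.continuousOn.comp (f := fun s => (s, x + t - s, y)) (by fun_prop) fun s hs => ⟨hs, mem_univ _⟩
  have h2 : HasDerivAt (fun s => u s (x + t - s) y) (-v t x y) t := by
    have e : (fun s => u s (x + t - s) y) = fun s => -∫ s' in (0 : ℝ)..s, v s' (x + t - s') y := by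
      funext s; simp [hu]
    rw [e]
    have hsub : uIcc 0 t ⊆ Ioo A B := ordConnected_Ioo.uIcc_subset ⟨hA, hB⟩ ht
    have h3 := intervalIntegral.integral_hasDerivAt_right (a := 0) (b := t)
      (f := fun s => v s (x + t - s) y) ((hline.mono hsub).intervalIntegrable)
      (hline.stronglyMeasurableAtFilter isOpen_Ioo t ht) (hline.continuousAt (isOpen_Ioo.mem_nhds ht))
    convert! h3.neg using 2
    rw [add_sub_cancel_right]
  have := h1.unique h2
  simp only [D]
  linarith

/-- The smooth solution obtained by following the characteristics `X, V` as long as they do not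
cross; `l` is the label of the characteristic through a given point. -/
structure IsDevelopment (f : ℝ × ℝ × ℝ × ℝ → ℝ) (χ : ℝ → ℝ → ℝ) (r ρ T : ℝ)
    (X V u l : ℝ → ℝ → ℝ → ℝ) : Prop where
  chars : IsCharacteristics f χ r X V
  nonpos : ∀ x y, χ x y ≤ 0
  ρ_pos : 0 < ρ
  T_pos : 0 < T
  ρ_lt : ρ < r
  T_lt : T < r
  pos : ∀ t ∈ Ioo (-ρ) T, ∀ x y, 0 < dx₁ X t x y
  smooth_u : ContDiffOn ℝ ∞ (unc u) (Ioo (-ρ) T ×ˢ univ)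
  smooth_l : ContDiffOn ℝ ∞ (unc l) (Ioo (-ρ) T ×ˢ univ)
  u_zero : ∀ x y, u 0 x y = 0
  X_l : ∀ t ∈ Ioo (-ρ) T, ∀ x y, X t (l t x y) y = x
  l_X : ∀ t ∈ Ioo (-ρ) T, ∀ x y, l t (X t x y) y = x
  D_u : ∀ t ∈ Ioo (-ρ) T, ∀ x y, D u t (X t x y) y = V t x y

namespace IsCharacteristics

variable {f : ℝ × ℝ × ℝ × ℝ → ℝ} {χ : ℝ → ℝ → ℝ} {r ρ T : ℝ} {X V : ℝ → ℝ → ℝ → ℝ}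

lemma exists_label (h : IsCharacteristics f χ r X V) (hρ : ρ < r) (hT : T < r)
    (hpos : ∀ t ∈ Ioo (-ρ) T, ∀ x y, 0 < dx₁ X t x y) :
    ∃ l : ℝ → ℝ → ℝ → ℝ, ContDiffOn ℝ ∞ (unc l) (Ioo (-ρ) T ×ˢ univ) ∧
      (∀ t ∈ Ioo (-ρ) T, ∀ x y, X t (l t x y) y = x) ∧
      ∀ t ∈ Ioo (-ρ) T, ∀ x y, l t (X t x y) y = x := by
  have hslab : ∀ t ∈ Ioo (-ρ) T, t ∈ Ioo (-r) r := fun t ht =>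
    ⟨by linarith [ht.1], ht.2.trans hT⟩
  have hd : ∀ t ∈ Ioo (-ρ) T, ∀ x y, HasDerivAt (fun x => X t x y) (dx₁ X t x y) x :=
    fun t ht x y => hasDerivAt_dx₁ (h.differentiableAt_X (hslab t ht) x y)
  have hinj : ∀ t ∈ Ioo (-ρ) T, ∀ y, Function.Injective fun x => X t x y := fun t ht y =>
    (strictMono_of_deriv_pos fun x => by rw [(hd t ht x y).deriv]; exact hpos t ht x y).injective
  have hsurj : ∀ t ∈ Ioo (-ρ) T, ∀ y, Function.Surjective fun x => X t x y := by
    intro t ht y x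
    have hc : Continuous fun x => X t x y := continuous_iff_continuousAt.2 fun x =>
      (hd t ht x y).continuousAt
    -- Since `|X - x| ≤ 1/2`, the values at `x - 1` and `x + 1` lie on either side of `x`.
    have h1 := (abs_le.1 (h.X_near t (hslab t ht) (x - 1) y)).2
    have h2 := (abs_le.1 (h.X_near t (hslab t ht) (x + 1) y)).1
    obtain ⟨z, _, hz⟩ := intermediate_value_Icc (show x - 1 ≤ x + 1 by linarith) hc.continuousOn
      (show x ∈ Icc (X t (x - 1) y) (X t (x + 1) y) from ⟨by linarith, by linarith⟩)
    exact ⟨z, hz⟩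
  set l : ℝ → ℝ → ℝ → ℝ := fun t x y => Function.invFun (fun x => X t x y) x with hl
  have hXl : ∀ t ∈ Ioo (-ρ) T, ∀ x y, X t (l t x y) y = x := fun t ht x y =>
    Function.invFun_eq (hsurj t ht y x)
  have hlX : ∀ t ∈ Ioo (-ρ) T, ∀ x y, l t (X t x y) y = x := fun t ht x y =>
    Function.leftInverse_invFun (hinj t ht y) x
  refine ⟨l, ?_, hXl, hlX⟩
  rintro ⟨t₀, x₀, y₀⟩ ⟨ht₀, -⟩
  simp only at ht₀
  -- Smoothness of the label comes from the implicit function theorem for `X(t, z, y) - x = 0`,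
  -- whose derivative in `z` is `X_x > 0`. Injectivity identifies the local solution with `l`.
  set G : (ℝ × ℝ × ℝ) × ℝ → ℝ := fun q => unc X (q.1.1, q.2, q.1.2.2) - q.1.2.1 with hG
  set w : (ℝ × ℝ × ℝ) × ℝ := ((t₀, x₀, y₀), l t₀ x₀ y₀) with hw
  have hGs : ContDiffAt ℝ ∞ G w := by
    have hX : ContDiffAt ℝ ∞ (unc X) (w.1.1, w.2, w.1.2.2) :=
      h.smooth_X.contDiffAt ((isOpen_slab _ _).mem_nhds ⟨hslab t₀ ht₀, mem_univ _⟩)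
    have hι : ContDiff ℝ ∞ fun q : (ℝ × ℝ × ℝ) × ℝ => (q.1.1, q.2, q.1.2.2) := by fun_prop
    exact (hX.comp w hι.contDiffAt).sub contDiffAt_fst.snd.fst
  have hpart : fderiv ℝ G w ∘L .inr ℝ (ℝ × ℝ × ℝ) ℝ =
      ContinuousLinearMap.toSpanSingleton ℝ (dx₁ X t₀ (l t₀ x₀ y₀) y₀) := by
    have h1 : HasFDerivAt (fun z => G ((t₀, x₀, y₀), z))
        (fderiv ℝ G w ∘L .inr ℝ (ℝ × ℝ × ℝ) ℝ) (l t₀ x₀ y₀) :=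
      (hGs.differentiableAt (by simp)).hasFDerivAt.comp _ (hasFDerivAt_prodMk_right _ _)
    exact h1.unique ((hd t₀ ht₀ (l t₀ x₀ y₀) y₀).sub_const x₀).hasFDerivAt
  have hinv : (fderiv ℝ G w ∘L .inr ℝ (ℝ × ℝ × ℝ) ℝ).IsInvertible := by
    rw [hpart]
    refine ⟨ContinuousLinearEquiv.unitsEquivAut ℝ (Units.mk0 _ (hpos t₀ ht₀ (l t₀ x₀ y₀) y₀).ne'), ?_⟩
    ext
    simp
  have himp := hGs.contDiffAt_implicitFunction (by simp) hinv
  have hev := hGs.eventually_apply_implicitFunction (by simp) hinv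
  refine (himp.congr_of_eventuallyEq ?_).contDiffWithinAt
  have hGw : G w = 0 := sub_eq_zero.2 (hXl t₀ ht₀ x₀ y₀)
  have hnear : Ioo (-ρ) T ×ˢ univ ∈ 𝓝 (t₀, x₀, y₀) :=
    (isOpen_slab _ _).mem_nhds ⟨ht₀, mem_univ _⟩
  filter_upwards [hev, hnear] with p hp hp'
  rw [hGw] at hp
  refine hinj p.1 hp'.1 p.2.2 ?_
  change X p.1 (l p.1 p.2.1 p.2.2) p.2.2 = _
  rw [hXl p.1 hp'.1]
  exact (sub_eq_zero.1 hp).symm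

theorem exists_isDevelopment (h : IsCharacteristics f χ r X V) (hneg : ∀ x y, χ x y ≤ 0)
    (hρ : ρ ∈ Ioo 0 r) (hT : T ∈ Ioo 0 r)
    (hpos : ∀ t ∈ Ioo (-ρ) T, ∀ x y, 0 < dx₁ X t x y) :
    ∃ u l, IsDevelopment f χ r ρ T X V u l := by
  obtain ⟨l, hl, hXl, hlX⟩ := h.exists_label hρ.2 hT.2 hpos
  have hv : ContDiffOn ℝ ∞ (unc fun t x y => V t (l t x y) y) (Ioo (-ρ) T ×ˢ univ) := by
    refine h.smooth_V.comp (f := fun p : ℝ × ℝ × ℝ => (p.1, unc l p, p.2.2)) ?_ ?_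
    · exact contDiffOn_fst.prodMk (hl.prodMk (by fun_prop))
    · exact fun p hp => ⟨⟨by linarith [hp.1.1, hρ.2], hp.1.2.trans hT.2⟩, mem_univ _⟩
  obtain ⟨u, hu, hu0, hDu⟩ := exists_D_eq (neg_lt_zero.2 hρ.1) hT.1 hv
  exact ⟨u, l, {
    chars := h
    nonpos := hneg
    ρ_pos := hρ.1
    T_pos := hT.1
    ρ_lt := hρ.2
    T_lt := hT.2
    pos := hpos
    smooth_u := hu
    smooth_l := hl
    u_zero := hu0
    X_l := hXl
    l_X := hlX
    D_u := fun t ht x y => by rw [hDu t ht, hlX t ht] }⟩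

end IsCharacteristics

lemma contDiffOn_D {u : ℝ → ℝ → ℝ → ℝ} {S : Set (ℝ × ℝ × ℝ)} (hu : ContDiffOn ℝ ∞ (unc u) S)
    (hS : IsOpen S) : ContDiffOn ℝ ∞ (unc (D u)) S :=
  (contDiffOn_dx₁ hu hS).sub (contDiffOn_dt hu hS)

/-- The factorization `∂_t² - ∂_x² = -(∂_t + ∂_x)(∂_x - ∂_t)`, with mixed derivatives commuting. It
turns the wave equation into a transport equation for `D u`. -/
lemma box₁_eq {u : ℝ → ℝ → ℝ → ℝ} {S : Set (ℝ × ℝ × ℝ)} {t x y : ℝ}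
    (hu : ContDiffOn ℝ ∞ (unc u) S) (hS : IsOpen S) (h : (t, x, y) ∈ S) :
    box₁ u t x y = -(dt (D u) t x y + dx₁ (D u) t x y) := by
  have h1 := ContDiffOn.differentiableAt_unc (contDiffOn_dt hu hS) hS h
  have h2 := ContDiffOn.differentiableAt_unc (contDiffOn_dx₁ hu hS) hS h
  have e1 : dt (D u) t x y = dt (dx₁ u) t x y - dt (dt u) t x y :=
    ((hasDerivAt_dt h2).sub (hasDerivAt_dt h1)).deriv
  have e2 : dx₁ (D u) t x y = dx₁ (dx₁ u) t x y - dx₁ (dt u) t x y :=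
    ((hasDerivAt_dx₁ h2).sub (hasDerivAt_dx₁ h1)).deriv
  rw [e1, e2, dt_dx₁_comm hu hS h, box₁]
  ring

/-- For smooth `u` the equation is a first order equation for `D u`. -/
lemma equation_iff {f : ℝ × ℝ × ℝ × ℝ → ℝ} {u : ℝ → ℝ → ℝ → ℝ} {S : Set (ℝ × ℝ × ℝ)} {t x y : ℝ}
    (hu : ContDiffOn ℝ ∞ (unc u) S) (hS : IsOpen S) (h : (t, x, y) ∈ S) :
    box₁ u t x y = D u t x y * D (D u) t x y + f (t, x, y, D u t x y) ↔
      (1 - D u t x y) * dt (D u) t x y + (1 + D u t x y) * dx₁ (D u) t x y =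
        -f (t, x, y, D u t x y) := by
  rw [box₁_eq hu hS h]
  have : D (D u) t x y = dx₁ (D u) t x y - dt (D u) t x y := rfl
  rw [this]
  constructor <;> intro h <;> linarith

/-- A Gronwall lemma for functions which are differentiable in the interior. -/
lemma eq_zero_of_abs_deriv_le {q q' : ℝ → ℝ} {a b K : ℝ} (hq : ContinuousOn q (Icc a b))
    (hd : ∀ t ∈ Ioo a b, HasDerivAt q (q' t) t) (hK : ∀ t ∈ Ioo a b, |q' t| ≤ K * |q t|)
    (ha : q a = 0) : ∀ t ∈ Icc a b, q t = 0 := by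
  -- `(q²)' ≤ 2 K q²`, so `q² exp(-2 K t)` is nonincreasing, nonnegative and zero at `a`.
  have hanti : AntitoneOn (fun t => q t ^ 2 * Real.exp (-(2 * K) * t)) (Icc a b) := by
    have hder : ∀ t ∈ Ioo a b, HasDerivAt (fun t => q t ^ 2 * Real.exp (-(2 * K) * t))
        ((2 * (q t * q' t) - 2 * K * q t ^ 2) * Real.exp (-(2 * K) * t)) t := by
      intro t ht
      have h1 := ((hd t ht).fun_pow 2).mul (((hasDerivAt_id' t).const_mul (-(2 * K))).exp)
      convert! h1 using 1
      simp
      ring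
    refine antitoneOn_of_deriv_nonpos (convex_Icc a b) (by fun_prop) ?_ ?_
    · rw [interior_Icc]
      exact fun t ht => (hder t ht).differentiableAt.differentiableWithinAt
    · rw [interior_Icc]
      intro t ht
      rw [(hder t ht).deriv]
      refine mul_nonpos_of_nonpos_of_nonneg ?_ (Real.exp_pos _).le
      have h2 : q t * q' t ≤ K * q t ^ 2 := by
        calc q t * q' t ≤ |q t| * |q' t| := by rw [← abs_mul]; exact le_abs_self _
          _ ≤ |q t| * (K * |q t|) := by gcongr; exact hK t ht
          _ = K * q t ^ 2 := by rw [← sq_abs]; ring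
      linarith
  intro t ht
  have h := hanti ⟨le_rfl, ht.1.trans ht.2⟩ ht ht.1
  simp only [ha] at h
  have h2 : q t ^ 2 * Real.exp (-(2 * K) * t) ≤ 0 := by simpa using h
  have h3 : q t ^ 2 ≤ 0 := nonpos_of_mul_nonpos_left h2 (Real.exp_pos _)
  exact pow_eq_zero_iff (two_ne_zero) |>.1 (le_antisymm h3 (sq_nonneg _))

namespace IsDevelopment

variable {f : ℝ × ℝ × ℝ × ℝ → ℝ} {χ : ℝ → ℝ → ℝ} {r ρ T : ℝ} {X V u l : ℝ → ℝ → ℝ → ℝ}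

lemma mem_slab (h : IsDevelopment f χ r ρ T X V u l) {t : ℝ} (ht : t ∈ Ioo (-ρ) T) :
    t ∈ Ioo (-r) r := ⟨by linarith [ht.1, h.ρ_lt], ht.2.trans h.T_lt⟩

lemma mem_of_Ico (h : IsDevelopment f χ r ρ T X V u l) {t : ℝ} (ht : t ∈ Ico 0 T) :
    t ∈ Ioo (-ρ) T := ⟨by linarith [ht.1, h.ρ_pos], ht.2⟩

lemma D_u_eq (h : IsDevelopment f χ r ρ T X V u l) {t : ℝ} (ht : t ∈ Ioo (-ρ) T) (x y : ℝ) :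
    D u t x y = V t (l t x y) y := by
  rw [← h.D_u t ht, h.X_l t ht]

lemma V_le (h : IsDevelopment f χ r ρ T X V u l) {t : ℝ} (ht : t ∈ Ioo (-ρ) T) (x y : ℝ) :
    V t x y ≤ 1 / 2 := h.chars.V_le h.nonpos (h.mem_slab ht) x y

lemma D_u_le (h : IsDevelopment f χ r ρ T X V u l) {t : ℝ} (ht : t ∈ Ioo (-ρ) T) (x y : ℝ) :
    D u t x y ≤ 1 / 2 := by
  rw [h.D_u_eq ht]
  exact h.V_le ht _ _

lemma differentiableAt_D_u (h : IsDevelopment f χ r ρ T X V u l) {t : ℝ} (ht : t ∈ Ioo (-ρ) T)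
    (x y : ℝ) : DifferentiableAt ℝ (unc (D u)) (t, x, y) :=
  ContDiffOn.differentiableAt_unc (contDiffOn_D h.smooth_u (isOpen_slab _ _)) (isOpen_slab _ _)
    ⟨ht, mem_univ _⟩

lemma dx₁_D_u_mul (h : IsDevelopment f χ r ρ T X V u l) {t : ℝ} (ht : t ∈ Ioo (-ρ) T) (x y : ℝ) :
    dx₁ (D u) t (X t x y) y * dx₁ X t x y = dx₁ V t x y := by
  have h1 := hasDerivAt_comp_curve (h.differentiableAt_D_u ht (X t x y) y) (hasDerivAt_const x t)
    (hasDerivAt_dx₁ (h.chars.differentiableAt_X (h.mem_slab ht) x y)) rfl rfl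
  have h2 := hasDerivAt_dx₁ (h.chars.differentiableAt_V (h.mem_slab ht) x y)
  have e : (fun x => D u t (X t x y) y) = fun x => V t x y := funext fun x => h.D_u t ht x y
  rw [e] at h1
  simpa using h1.unique h2

/-- Every point lies on a characteristic. Differentiating `D u = V` along it gives the equation
divided by `1 - V`, which is at least `1/2`. -/
lemma first_order_equation (h : IsDevelopment f χ r ρ T X V u l) {t : ℝ} (ht : t ∈ Ioo 0 T)
    (x y : ℝ) : (1 - D u t x y) * dt (D u) t x y + (1 + D u t x y) * dx₁ (D u) t x y =
      -f (t, x, y, D u t x y) := by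
  have htJ : t ∈ Ioo (-ρ) T := h.mem_of_Ico ⟨ht.1.le, ht.2⟩
  have htr : t ∈ Ioo 0 r := ⟨ht.1, ht.2.trans h.T_lt⟩
  obtain ⟨z, rfl⟩ : ∃ z, X t z y = x := ⟨_, h.X_l t htJ x y⟩
  have h1 := hasDerivAt_comp_curve (h.differentiableAt_D_u htJ (X t z y) y) (hasDerivAt_id' t)
    (h.chars.deriv_X t htr z y) rfl rfl
  have e : (fun s => D u s (X s z y) y) =ᶠ[𝓝 t] fun s => V s z y := by
    filter_upwards [isOpen_Ioo.mem_nhds htJ] with s hs using h.D_u s hs z y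
  have h2 := (h1.congr_of_eventuallyEq e.symm).unique (h.chars.deriv_V t htr z y)
  have hV := h.V_le htJ z y
  have hne : (1 : ℝ) - V t z y ≠ 0 := by linarith
  rw [h.D_u t htJ]
  field_simp at h2
  linarith

theorem isSolution (h : IsDevelopment f χ r ρ T X V u l) : IsSolution f χ T u where
  smooth := h.smooth_u.mono fun p hp => ⟨h.mem_of_Ico hp.1, hp.2⟩
  equation := fun t ht x y => (equation_iff h.smooth_u (isOpen_slab _ _)
    ⟨h.mem_of_Ico ⟨ht.1.le, ht.2⟩, mem_univ _⟩).2 (h.first_order_equation ht x y)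
  ne_one := fun t ht x y => by
    have := h.D_u_le (h.mem_of_Ico ⟨ht.1.le, ht.2⟩) x y
    linarith
  initial := h.u_zero
  initial_dt := fun x y => by
    have h0 : (0 : ℝ) ∈ Ioo (-ρ) T := h.mem_of_Ico ⟨le_rfl, h.T_pos⟩
    have hd := hasDerivAt_dt (u := u) (t := 0) (x := x) (y := y)
      (ContDiffOn.differentiableAt_unc h.smooth_u (isOpen_slab _ _) ⟨h0, mem_univ _⟩)
    have h1 := h.D_u 0 h0 x y
    rw [h.chars.X_zero, h.chars.V_zero, D] at h1
    have h2 : dx₁ u 0 x y = 0 := by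
      have : (fun x => u 0 x y) = fun _ => 0 := funext fun x => h.u_zero x y
      simp [dx₁, this]
    rw [h2] at h1
    have h3 : dt u 0 x y = -χ x y := by linarith
    rw [h3] at hd
    exact hd.hasDerivWithinAt

end IsDevelopment

/-! ### Uniqueness of smooth solutions -/

section Uniqueness

variable {f : ℝ × ℝ × ℝ × ℝ → ℝ} {χ : ℝ → ℝ → ℝ} {T : ℝ} {w : ℝ → ℝ → ℝ → ℝ}

lemma uniqueDiffOn_slab (T : ℝ) : UniqueDiffOn ℝ (Ico 0 T ×ˢ (univ : Set (ℝ × ℝ))) :=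
  (uniqueDiffOn_Ico 0 T).prod uniqueDiffOn_univ

lemma slab_mem_nhds {t : ℝ} (ht : t ∈ Ioo 0 T) (p : ℝ × ℝ) :
    Ico 0 T ×ˢ (univ : Set (ℝ × ℝ)) ∈ 𝓝 (t, p) :=
  mem_of_superset ((isOpen_slab 0 T).mem_nhds ⟨ht, mem_univ _⟩)
    (prod_mono Ioo_subset_Ico_self subset_rfl)

/-- `D w` extends smoothly up to `t = 0`, with the value `χ` there. -/
lemma IsSolution.exists_extension (h : IsSolution f χ T w) (hT : 0 < T) :
    ∃ g : ℝ × ℝ × ℝ → ℝ, ContDiffOn ℝ ∞ g (Ico 0 T ×ˢ univ) ∧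
      (∀ t ∈ Ioo 0 T, ∀ x y, g (t, x, y) = D w t x y) ∧ ∀ x y, g (0, x, y) = χ x y := by
  have hs : ContDiffOn ℝ ∞ (unc w) (Ico 0 T ×ˢ univ) := h.smooth
  -- At `t = 0` the two-sided derivative in `D w` would depend on values of `w` at negative times,
  -- where nothing is known. Derivatives within the slab are used instead.
  refine ⟨fun p => fderivWithin ℝ (unc w) (Ico 0 T ×ˢ univ) p (0, 1, 0) -
    fderivWithin ℝ (unc w) (Ico 0 T ×ˢ univ) p (1, 0, 0), ?_, ?_, ?_⟩
  · have := hs.fderivWithin (m := ∞) (uniqueDiffOn_slab T) (by simp)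
    exact (this.clm_apply contDiffOn_const).sub (this.clm_apply contDiffOn_const)
  · intro t ht x y
    have hn := slab_mem_nhds ht (x, y)
    have hd : DifferentiableAt ℝ (unc w) (t, x, y) := (hs.contDiffAt hn).differentiableAt (by simp)
    simp only [fderivWithin_of_mem_nhds hn, D, dx₁_eq_fderiv hd, dt_eq_fderiv hd]
  · intro x y
    have hd : HasFDerivWithinAt (unc w) _ _ (0, x, y) :=
      (hs.differentiableOn (by simp) (0, x, y) ⟨⟨le_rfl, hT⟩, mem_univ _⟩).hasFDerivWithinAt
    have h1 : HasDerivAt (fun x' => w 0 x' y)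
        (fderivWithin ℝ (unc w) (Ico 0 T ×ˢ univ) (0, x, y) (0, 1, 0)) x := by
      rw [← hasDerivWithinAt_univ]
      exact hd.comp_hasDerivWithinAt (f := fun x' => (0, x', y)) x
        ((hasDerivAt_const x (0 : ℝ)).prodMk ((hasDerivAt_id' x).prodMk
          (hasDerivAt_const x y))).hasDerivWithinAt fun x' _ => ⟨⟨le_rfl, hT⟩, mem_univ _⟩
    have h1' : HasDerivAt (fun x' => w 0 x' y) 0 x := by
      have : (fun x => w 0 x y) = fun _ => 0 := funext fun x => h.initial x y
      rw [this]
      exact hasDerivAt_const x 0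
    have h2 : HasDerivWithinAt (fun t => w t x y)
        (fderivWithin ℝ (unc w) (Ico 0 T ×ˢ univ) (0, x, y) (1, 0, 0)) (Ico 0 T) 0 :=
      hd.comp_hasDerivWithinAt (f := fun t => (t, x, y)) 0
        ((hasDerivAt_id' (0 : ℝ)).prodMk ((hasDerivAt_const _ x).prodMk
          (hasDerivAt_const _ y))).hasDerivWithinAt fun t ht => ⟨ht, mem_univ _⟩
    have h2' := (h.initial_dt x y).mono (fun s (hs : s ∈ Ico 0 T) => hs.1)
    have e2 := (uniqueDiffOn_Ico 0 T 0 ⟨le_rfl, hT⟩).eq_deriv _ h2 h2'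
    simp only [h1.unique h1', e2]
    ring

/-- `D w` is compared with `V` along the characteristics of the constructed solution, not along
those of `w`. Only bounds on a compact arc of one characteristic enter, so no growth condition on
`w` at infinity is needed. Once `D w = D u`, the difference `w - u` is constant along the lines `x +
t = const`. -/
theorem IsDevelopment.eq_of_isSolution {r ρ : ℝ} {X V u l : ℝ → ℝ → ℝ → ℝ} (hf : IsSource f)
    (h : IsDevelopment f χ r ρ T X V u l) (hw : IsSolution f χ T w) :
    ∀ t ∈ Ico 0 T, w t = u t := by
  obtain ⟨g, hg, hgD, hg0⟩ := hw.exists_extension h.T_pos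
  obtain ⟨C₀, hC₀, hf0⟩ := hf.abs_le
  obtain ⟨C₁, hC₁, hf1⟩ := hf.lipschitz
  have hwint : ContDiffOn ℝ ∞ (unc w) (Ioo 0 T ×ˢ univ) :=
    hw.smooth.mono (prod_mono Ioo_subset_Ico_self subset_rfl)
  have hDint : ContDiffOn ℝ ∞ (unc (D w)) (Ioo 0 T ×ˢ univ) := contDiffOn_D hwint (isOpen_slab _ _)
  have hXc : ∀ x y, ContinuousOn (fun t => X t x y) (Ico 0 T) := fun x y t ht =>
    (hasDerivAt_dt (h.chars.differentiableAt_X (h.mem_slab (h.mem_of_Ico ht)) x y)).continuousAt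
      |>.continuousWithinAt
  have hVc : ∀ x y, ContinuousOn (fun t => V t x y) (Ico 0 T) := fun x y t ht =>
    (hasDerivAt_dt (h.chars.differentiableAt_V (h.mem_slab (h.mem_of_Ico ht)) x y)).continuousAt
      |>.continuousWithinAt
  have hcurve : ∀ x y, ∀ G : ℝ × ℝ × ℝ → ℝ, ContinuousOn G (Ico 0 T ×ˢ univ) →
      ContinuousOn (fun t => G (t, X t x y, y)) (Ico 0 T) := fun x y G hG =>
    hG.comp (f := fun t => (t, X t x y, y))
      (continuousOn_id.prodMk ((hXc x y).prodMk continuousOn_const)) fun t ht => ⟨ht, mem_univ _⟩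
  have hDV : ∀ t ∈ Ico 0 T, ∀ x y, g (t, X t x y, y) = V t x y := by
    intro t₁ ht₁ x y
    have hsub : Icc 0 t₁ ⊆ Ico 0 T := fun s hs => ⟨hs.1, hs.2.trans_lt ht₁.2⟩
    have hgx : ContinuousOn (fun p => fderivWithin ℝ g (Ico 0 T ×ˢ univ) p (0, 1, 0))
        (Ico 0 T ×ˢ univ) :=
      ((hg.fderivWithin (m := ∞) (uniqueDiffOn_slab T) (by simp)).clm_apply
        contDiffOn_const).continuousOn
    obtain ⟨M, hM⟩ := isCompact_Icc.exists_bound_of_continuousOn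
      ((hcurve x y _ hgx).mono hsub)
    have hgc := (hcurve x y g hg.continuousOn).mono hsub
    obtain ⟨s₀, hs₀, hmin⟩ := isCompact_Icc.exists_isMinOn (nonempty_Icc.2 ht₁.1)
      ((continuousOn_const.sub hgc).abs : ContinuousOn (fun t => |1 - g (t, X t x y, y)|) _)
    -- At time `0` the value of `g` is `χ ≤ 0`, and later it differs from `1` by the requirement `D
    -- w ≠ 1`. By compactness `1 - D w` stays away from zero on the arc.
    have hδ : 0 < |1 - g (s₀, X s₀ x y, y)| := by
      rw [abs_pos, sub_ne_zero]
      rcases eq_or_lt_of_le hs₀.1 with h0 | h0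
      · rw [← h0, hg0]
        linarith [h.nonpos (X 0 x y) y]
      · have hs : s₀ ∈ Ioo 0 T := ⟨h0, (hsub hs₀).2⟩
        rw [hgD s₀ hs]
        exact (hw.ne_one s₀ hs _ _).symm
    set δ := |1 - g (s₀, X s₀ x y, y)|
    have hq := eq_zero_of_abs_deriv_le (q := fun t => g (t, X t x y, y) - V t x y)
      (q' := fun t => dt (D w) t (X t x y) y * 1 +
        dx₁ (D w) t (X t x y) y * ((1 + V t x y) / (1 - V t x y)) -
        -f (t, X t x y, y, V t x y) / (1 - V t x y)) (a := 0) (b := t₁)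
      (K := (2 * (2 * M + C₀) + C₁) / δ) (hgc.sub ((hVc x y).mono hsub)) ?_ ?_ ?_
    · exact sub_eq_zero.1 (hq t₁ ⟨ht₁.1, le_rfl⟩)
    · intro t ht
      have htT : t ∈ Ioo 0 T := ⟨ht.1, ht.2.trans ht₁.2⟩
      have htr : t ∈ Ioo 0 r := ⟨ht.1, htT.2.trans h.T_lt⟩
      have h1 := (hasDerivAt_comp_curve (y := y) (ContDiffOn.differentiableAt_unc hDint (isOpen_slab 0 T)
        ⟨htT, mem_univ _⟩) (hasDerivAt_id' t) (h.chars.deriv_X t htr x y) rfl rfl).sub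
        (h.chars.deriv_V t htr x y)
      refine h1.congr_of_eventuallyEq ?_
      filter_upwards [isOpen_Ioo.mem_nhds htT] with s hs
      simp [hgD s hs]
    · intro t ht
      have htT : t ∈ Ioo 0 T := ⟨ht.1, ht.2.trans ht₁.2⟩
      have htI : t ∈ Icc 0 t₁ := ⟨ht.1.le, ht.2.le⟩
      have hV := h.V_le (h.mem_of_Ico (hsub htI)) x y
      have hpde := (equation_iff hwint (isOpen_slab 0 T) (t := t) (x := X t x y) (y := y)
        ⟨htT, mem_univ _⟩).1 (hw.equation t htT _ _)
      have hδt : δ ≤ |1 - D w t (X t x y) y| := by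
        rw [← hgD t htT]; exact hmin htI
      have hMt : |dx₁ (D w) t (X t x y) y| ≤ M := by
        have h1 := hM t htI
        have hn := slab_mem_nhds htT (X t x y, y)
        have e : unc (D w) =ᶠ[𝓝 (t, X t x y, y)] g := by
          filter_upwards [(isOpen_slab 0 T).mem_nhds
            (show (t, X t x y, y) ∈ _ from ⟨htT, mem_univ _⟩)] with p hp
            using (hgD p.1 hp.1 p.2.1 p.2.2).symm
        rw [dx₁_eq_fderiv (ContDiffOn.differentiableAt_unc hDint (isOpen_slab 0 T)
          ⟨htT, mem_univ _⟩), e.fderiv_eq]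
        rwa [fderivWithin_of_mem_nhds hn] at h1
      rw [hgD t htT]
      set v := D w t (X t x y) y
      set vx := dx₁ (D w) t (X t x y) y
      set vt := dt (D w) t (X t x y) y
      set W := V t x y
      have hW : 0 < 1 - W := by linarith
      have hW2 : 1 / (1 - W) ≤ 2 := by rw [div_le_iff₀ hW]; linarith
      have hfd : |f (t, X t x y, y, W) - f (t, X t x y, y, v)| ≤ C₁ * |v - W| := by
        have := hf1 (t, X t x y, y, W) (t, X t x y, y, v)
        simpa [Prod.norm_def, abs_sub_comm] using this
      -- Using the equation for `w` to eliminate `v_t`, every remaining term contains `v - W` or an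
      -- increment of `f` from `v` to `W`. With `|v_x| ≤ M`, `|f| ≤ C₀` and `1 / (1 - W) ≤ 2` this
      -- gives the Gronwall constant `(2 (2 M + C₀) + C₁) / δ`.
      have key : (1 - v) * (vt * 1 + vx * ((1 + W) / (1 - W)) - -f (t, X t x y, y, W) / (1 - W)) =
          -((v - W) * (2 * vx + f (t, X t x y, y, W))) * (1 / (1 - W)) +
            (f (t, X t x y, y, W) - f (t, X t x y, y, v)) := by
        have hne := hW.ne'
        field_simp
        linear_combination (1 - W) * hpde
      rw [div_mul_eq_mul_div, le_div_iff₀ hδ]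
      calc _ ≤ |vt * 1 + vx * ((1 + W) / (1 - W)) - -f (t, X t x y, y, W) / (1 - W)| * |1 - v| := by
            gcongr
        _ = |-((v - W) * (2 * vx + f (t, X t x y, y, W))) * (1 / (1 - W)) +
            (f (t, X t x y, y, W) - f (t, X t x y, y, v))| := by rw [mul_comm, ← abs_mul, key]
        _ ≤ |v - W| * (2 * M + C₀) * 2 + C₁ * |v - W| := by
            refine (abs_add_le _ _).trans (add_le_add ?_ hfd)
            rw [abs_mul, abs_neg, abs_mul, abs_of_pos (one_div_pos.2 hW)]
            have hb : |2 * vx + f (t, X t x y, y, W)| ≤ 2 * M + C₀ := by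
              refine (abs_add_le _ _).trans (add_le_add ?_ (hf0 _))
              rw [abs_mul, abs_two]
              gcongr
            exact mul_le_mul (mul_le_mul_of_nonneg_left hb (abs_nonneg _)) hW2
              (one_div_pos.2 hW).le (mul_nonneg (abs_nonneg _) ((abs_nonneg _).trans hb))
        _ = _ := by ring
    · simp [h.chars.X_zero, h.chars.V_zero, hg0]
  have hDeq : ∀ t ∈ Ioo 0 T, ∀ x y, D w t x y = D u t x y := by
    intro t ht x y
    have htJ := h.mem_of_Ico ⟨ht.1.le, ht.2⟩
    rw [h.D_u_eq htJ, ← hDV t ⟨ht.1.le, ht.2⟩, h.X_l t htJ, hgD t ht]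
  intro t ht
  funext x y
  have hline : ∀ s ∈ Icc 0 t, s ∈ Ico 0 T := fun s hs => ⟨hs.1, hs.2.trans_lt ht.2⟩
  have hcont : ∀ q : ℝ → ℝ → ℝ → ℝ, ContinuousOn (unc q) (Ico 0 T ×ˢ univ) →
      ContinuousOn (fun s => q s (x + t - s) y) (Icc 0 t) := fun q hq =>
    hq.comp (f := fun s => (s, x + t - s, y)) (by fun_prop) fun s hs => ⟨hline s hs, mem_univ _⟩
  have hz := eq_zero_of_abs_deriv_le (q := fun s => w s (x + t - s) y - u s (x + t - s) y)
    (q' := fun _ => 0) (a := 0) (b := t) (K := 0)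
    ((hcont w hw.smooth.continuousOn).sub (hcont u h.isSolution.smooth.continuousOn)) ?_ (by simp)
    (by simp [hw.initial, h.u_zero]) t ⟨ht.1, le_rfl⟩
  · simpa [sub_eq_zero] using hz
  · intro s hs
    have hsT : s ∈ Ioo 0 T := ⟨hs.1, hs.2.trans ht.2⟩
    have h1 := hasDerivAt_comp_curve (y := y) (ContDiffOn.differentiableAt_unc hwint (isOpen_slab 0 T)
      ⟨hsT, mem_univ _⟩) (hasDerivAt_id' s) ((hasDerivAt_id' s).const_sub (x + t)) rfl rfl
    have h2 := hasDerivAt_comp_curve (y := y) (ContDiffOn.differentiableAt_unc h.smooth_u (isOpen_slab _ _)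
      ⟨h.mem_of_Ico ⟨hsT.1.le, hsT.2⟩, mem_univ _⟩) (hasDerivAt_id' s)
      ((hasDerivAt_id' s).const_sub (x + t)) rfl rfl
    have h3 := h1.sub h2
    have h4 := hDeq s hsT (x + t - s) y
    simp only [D] at h4
    convert! h3 using 1
    linarith

end Uniqueness

end LogWave

/-! ### The Riemann invariant and the bounded part of the second derivative -/

namespace LogWave

/-- Meant for a `g'` with no useful pointwise bound: it is dominated by `-m'` for a quantity `m`
whose total variation along the path is known. The proof is monotonicity of `±g - a s + b m`. -/
lemma abs_sub_le_of_abs_deriv_le {g g' m m' : ℝ → ℝ} {t a b : ℝ} (ht : 0 ≤ t)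
    (hg : ContinuousOn g (Icc 0 t)) (hm : ContinuousOn m (Icc 0 t))
    (hdg : ∀ s ∈ Ioo 0 t, HasDerivAt g (g' s) s) (hdm : ∀ s ∈ Ioo 0 t, HasDerivAt m (m' s) s)
    (hle : ∀ s ∈ Ioo 0 t, |g' s| ≤ a - b * m' s) :
    |g t - g 0| ≤ a * t + b * (m 0 - m t) := by
  have key : ∀ σ : ℝ, |σ| = 1 → σ * (g t - g 0) ≤ a * t + b * (m 0 - m t) := by
    intro σ hσ
    have hd : ∀ s ∈ Ioo 0 t, HasDerivAt (fun s => σ * g s - a * s + b * m s)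
        (σ * g' s - a * 1 + b * m' s) s := fun s hs =>
      (((hdg s hs).const_mul σ).sub ((hasDerivAt_id' s).const_mul a)).add ((hdm s hs).const_mul b)
    have hanti : AntitoneOn (fun s => σ * g s - a * s + b * m s) (Icc 0 t) := by
      refine antitoneOn_of_deriv_nonpos (convex_Icc 0 t) (by fun_prop) ?_ ?_ <;> rw [interior_Icc]
      · exact fun s hs => (hd s hs).differentiableAt.differentiableWithinAt
      · intro s hs
        rw [(hd s hs).deriv]
        have h1 : σ * g' s ≤ |g' s| := (le_abs_self _).trans (by rw [abs_mul, hσ, one_mul])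
        linarith [hle s hs]
    have := hanti ⟨le_rfl, ht⟩ ⟨ht, le_rfl⟩ ht
    simp only at this
    linarith
  rw [abs_le]
  constructor
  · linarith [key (-1) (by simp)]
  · linarith [key 1 (by simp)]

namespace IsDevelopment

variable {f : ℝ × ℝ × ℝ × ℝ → ℝ} {χ : ℝ → ℝ → ℝ} {r ρ T : ℝ} {X V u l : ℝ → ℝ → ℝ → ℝ}

/-- The Riemann invariant `u_t + u_x + (D u)² / 2`, which is transported by `D` up to the source. -/
noncomputable def invariant (u : ℝ → ℝ → ℝ → ℝ) : ℝ → ℝ → ℝ → ℝ :=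
  fun t x y => dt u t x y + dx₁ u t x y + D u t x y ^ 2 / 2

lemma contDiffOn_invariant (h : IsDevelopment f χ r ρ T X V u l) :
    ContDiffOn ℝ ∞ (unc (invariant u)) (Ioo (-ρ) T ×ˢ univ) :=
  ((contDiffOn_dt h.smooth_u (isOpen_slab _ _)).add
    (contDiffOn_dx₁ h.smooth_u (isOpen_slab _ _))).add
      (((contDiffOn_D h.smooth_u (isOpen_slab _ _)).pow 2).div_const 2)

/-- `(∂_t - ∂_x)(u_t + u_x) = □u`, while `(∂_t - ∂_x)(v² / 2) = -v D v` for `v = D u`. The quadratic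
term of the invariant is there to cancel the nonlinearity. -/
lemma dt_sub_dx₁_invariant (h : IsDevelopment f χ r ρ T X V u l) {t : ℝ} (ht : t ∈ Ioo 0 T)
    (x y : ℝ) : dt (invariant u) t x y - dx₁ (invariant u) t x y = f (t, x, y, D u t x y) := by
  have htJ := h.mem_of_Ico ⟨ht.1.le, ht.2⟩
  have hS := isOpen_slab (-ρ) T
  have hm : (t, x, y) ∈ Ioo (-ρ) T ×ˢ (univ : Set (ℝ × ℝ)) := ⟨htJ, mem_univ _⟩
  have d1 := ContDiffOn.differentiableAt_unc (contDiffOn_dt h.smooth_u hS) hS hm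
  have d2 := ContDiffOn.differentiableAt_unc (contDiffOn_dx₁ h.smooth_u hS) hS hm
  have d3 := ContDiffOn.differentiableAt_unc (contDiffOn_D h.smooth_u hS) hS hm
  have e1 : dt (invariant u) t x y = dt (dt u) t x y + dt (dx₁ u) t x y +
      2 * D u t x y * dt (D u) t x y / 2 := by
    have := (((hasDerivAt_dt d1).add (hasDerivAt_dt d2)).add
      (((hasDerivAt_dt d3).fun_pow 2).div_const 2)).deriv
    refine (Eq.trans rfl this).trans ?_
    simp
  have e2 : dx₁ (invariant u) t x y = dx₁ (dt u) t x y + dx₁ (dx₁ u) t x y +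
      2 * D u t x y * dx₁ (D u) t x y / 2 := by
    have := (((hasDerivAt_dx₁ d1).add (hasDerivAt_dx₁ d2)).add
      (((hasDerivAt_dx₁ d3).fun_pow 2).div_const 2)).deriv
    refine (Eq.trans rfl this).trans ?_
    simp
  have e3 := h.isSolution.equation t ht x y
  have e4 : D (D u) t x y = dx₁ (D u) t x y - dt (D u) t x y := rfl
  rw [e4, box₁] at e3
  rw [e1, e2, dt_dx₁_comm h.smooth_u hS hm]
  linarith

/-- From `2 u_x = v + w - v² / 2` with `v = D u` and `w` the invariant. It splits `u_xx` into the
part that concentrates at the focal point and a part that stays bounded. -/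
lemma two_mul_dx₁_dx₁ (h : IsDevelopment f χ r ρ T X V u l) {t : ℝ} (ht : t ∈ Ioo (-ρ) T)
    (x y : ℝ) : 2 * dx₁ (dx₁ u) t x y =
      (1 - D u t x y) * dx₁ (D u) t x y + dx₁ (invariant u) t x y := by
  have hS := isOpen_slab (-ρ) T
  have hm : (t, x, y) ∈ Ioo (-ρ) T ×ˢ (univ : Set (ℝ × ℝ)) := ⟨ht, mem_univ _⟩
  have d2 := hasDerivAt_dx₁ (ContDiffOn.differentiableAt_unc (contDiffOn_dx₁ h.smooth_u hS) hS hm)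
  have d3 := hasDerivAt_dx₁ (ContDiffOn.differentiableAt_unc (contDiffOn_D h.smooth_u hS) hS hm)
  have d4 := hasDerivAt_dx₁ (ContDiffOn.differentiableAt_unc h.contDiffOn_invariant hS hm)
  have h1 := d2.const_mul 2
  have h2 := (d3.add d4).sub ((d3.fun_pow 2).div_const 2)
  have e : (fun x => 2 * dx₁ u t x y) = fun x => D u t x y + invariant u t x y - D u t x y ^ 2 / 2 := by
    funext x
    simp only [invariant, D]
    ring
  rw [e] at h1
  rw [h1.unique h2]
  simp
  ring

lemma dx₁_invariant_zero (h : IsDevelopment f χ r ρ T X V u l) {x y c : ℝ}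
    (hc : HasDerivAt (fun x => χ x y) c x) : dx₁ (invariant u) 0 x y = -c + χ x y * c := by
  have h0 : (0 : ℝ) ∈ Ioo (-ρ) T := h.mem_of_Ico ⟨le_rfl, h.T_pos⟩
  have e : (fun x => invariant u 0 x y) = fun x => -χ x y + χ x y ^ 2 / 2 := by
    funext x
    have h1 := h.D_u 0 h0 x y
    rw [h.chars.X_zero, h.chars.V_zero] at h1
    have h2 : dx₁ u 0 x y = 0 := by
      have : (fun x => u 0 x y) = fun _ => 0 := funext fun x => h.u_zero x y
      simp [dx₁, this]
    have h3 := h1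
    rw [D, h2] at h3
    simp only [invariant, h1, h2]
    linarith
  rw [dx₁, e]
  have := (hc.neg.add ((hc.fun_pow 2).div_const 2)).deriv
  refine (Eq.trans ?_ this).trans ?_
  · rfl
  · simp
    ring

/-- The derivative of the Riemann invariant stays bounded up to the crossing time. -/
theorem abs_dx₁_invariant_le (hf : IsSource f) (h : IsDevelopment f χ r ρ T X V u l)
    {χ' : ℝ → ℝ → ℝ} (hχ' : ∀ x y, HasDerivAt (fun x => χ x y) (χ' x y) x) {B : ℝ}
    (hB : ∀ x y, |χ x y| ≤ B) (hB' : ∀ x y, |χ' x y| ≤ B) :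
    ∃ M, ∀ t ∈ Ico 0 T, ∀ x y, |dx₁ (invariant u) t x y| ≤ M := by
  obtain ⟨C, hC, hfC⟩ := hf.norm_fderiv_le
  have hB0 : 0 ≤ B := (abs_nonneg _).trans (hB 0 0)
  -- The first factor bounds `|V_x|`. The second bounds `1 - V ≤ 1 + B + 1/2`.
  set N : ℝ := (B + 1 / 2 * (1 + B)) * (2 + B) with hN
  have hN0 : 0 ≤ N := by positivity
  have hVN : ∀ t ∈ Ioo (-ρ) T, ∀ x y, |dx₁ V t x y| * (1 - V t x y) ≤ N := by
    intro t ht x y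
    have h1 := (h.chars.abs_dx₁_sub_le (h.mem_slab ht) (hχ' x y)).2
    have h2 : max 1 |χ' x y| ≤ 1 + B := max_le (by linarith) (by linarith [hB' x y])
    have h3 : |dx₁ V t x y| ≤ B + 1 / 2 * (1 + B) := by
      have := abs_sub_abs_le_abs_sub (dx₁ V t x y) (χ' x y)
      linarith [hB' x y]
    have h4 := (abs_le.1 (h.chars.V_near t (h.mem_slab ht) x y)).1
    have h5 := (abs_le.1 (hB x y)).1
    exact mul_le_mul h3 (by linarith) (by linarith [h.V_le ht x y]) (by positivity)
  refine ⟨B + B * B + (C * T + C * N * (T + 1 / 2)), fun t ht x y => ?_⟩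
  have hline : ∀ s ∈ Icc 0 t, s ∈ Ioo (-ρ) T := fun s hs => h.mem_of_Ico ⟨hs.1, hs.2.trans_lt ht.2⟩
  have hS := isOpen_slab (-ρ) T
  have hw := h.contDiffOn_invariant
  have hwx := contDiffOn_dx₁ hw hS
  have hpath : ∀ q : ℝ → ℝ → ℝ → ℝ, ContDiffOn ℝ ∞ (unc q) (Ioo (-ρ) T ×ˢ univ) →
      ∀ s ∈ Icc 0 t, HasDerivAt (fun s => q s (x + t - s) y)
        (dt q s (x + t - s) y * 1 + dx₁ q s (x + t - s) y * (-1)) s := fun q hq s hs =>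
    hasDerivAt_comp_curve (y := y) (ContDiffOn.differentiableAt_unc hq hS ⟨hline s hs, mem_univ _⟩)
      (hasDerivAt_id' s) ((hasDerivAt_id' s).const_sub (x + t)) rfl rfl
  -- Along `x + t = const`, `w_x` has derivative `f_x + f_v v_x`, where `v_x` may be as large as `1
  -- / X_x`. The line crosses the characteristics transversally, so its label also moves at a rate
  -- proportional to `1 / X_x`. As `|X - x| ≤ 1/2`, the label moves by at most `T + 1/2` in total,
  -- which bounds the integral of `|v_x|`.
  have hbound := abs_sub_le_of_abs_deriv_le (g := fun s => dx₁ (invariant u) s (x + t - s) y)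
    (m := fun s => l s (x + t - s) y) (a := C) (b := C * N) ht.1
    (fun s hs => (hpath _ hwx s hs).continuousAt.continuousWithinAt)
    (fun s hs => (hpath _ h.smooth_l s hs).continuousAt.continuousWithinAt)
    (fun s hs => hpath _ hwx s (Ioo_subset_Icc_self hs))
    (fun s hs => hpath _ h.smooth_l s (Ioo_subset_Icc_self hs)) ?_
  · have h0 : (0 : ℝ) ∈ Ioo (-ρ) T := h.mem_of_Ico ⟨le_rfl, h.T_pos⟩
    have htJ := h.mem_of_Ico ht
    simp only [sub_zero, add_sub_cancel_right] at hbound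
    have e0 : l 0 (x + t) y = x + t := by
      have := h.l_X 0 h0 (x + t) y
      rwa [h.chars.X_zero] at this
    have e1 := (abs_le.1 (h.chars.X_near t (h.mem_slab htJ) (l t x y) y))
    rw [h.X_l t htJ] at e1
    rw [e0, h.dx₁_invariant_zero (hχ' (x + t) y)] at hbound
    have e2 : |-χ' (x + t) y + χ (x + t) y * χ' (x + t) y| ≤ B + B * B := by
      refine (abs_add_le _ _).trans (add_le_add (by rw [abs_neg]; exact hB' _ _) ?_)
      rw [abs_mul]
      exact mul_le_mul (hB _ _) (hB' _ _) (abs_nonneg _) hB0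
    have e3 : C * t + C * N * (x + t - l t x y) ≤ C * T + C * N * (T + 1 / 2) := by
      have := ht.2
      gcongr
      linarith
    have := abs_sub_abs_le_abs_sub (dx₁ (invariant u) t x y)
      (-χ' (x + t) y + χ (x + t) y * χ' (x + t) y)
    linarith
  · intro s hs
    have hsT : s ∈ Ioo 0 T := ⟨hs.1, hs.2.trans ht.2⟩
    have hsJ := hline s (Ioo_subset_Icc_self hs)
    set ξ := x + t - s with hξ
    set z := l s ξ y with hz
    have hXz : X s z y = ξ := h.X_l s hsJ ξ y
    have hm : (s, ξ, y) ∈ Ioo (-ρ) T ×ˢ (univ : Set (ℝ × ℝ)) := ⟨hsJ, mem_univ _⟩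
    have hvx := h.dx₁_D_u_mul hsJ z y
    rw [hXz] at hvx
    have hXx := h.pos s hsJ z y
    have hV := h.V_le hsJ z y
    have hNs := hVN s hsJ z y
    -- Differentiate `X(s, l(s, x + t - s, y), y) = x + t - s` in `s`. The speeds `(1 + V) / (1 -
    -- V)` and `-1` differ by `2 / (1 - V)`.
    have hlab : dx₁ X s z y * (dt l s ξ y * 1 + dx₁ l s ξ y * (-1)) = -(2 / (1 - V s z y)) := by
      have h1 := hasDerivAt_comp_curve (h.chars.differentiableAt_X (h.mem_slab hsJ) z y)
        (hasDerivAt_id' s) (hpath l h.smooth_l s (Ioo_subset_Icc_self hs)) rfl rfl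
      have h2 : HasDerivAt (fun s => X s (l s (x + t - s) y) y) (-1) s := by
        refine ((hasDerivAt_id' s).const_sub (x + t)).congr_of_eventuallyEq ?_
        filter_upwards [isOpen_Ioo.mem_nhds hsJ] with q hq using h.X_l q hq _ _
      have h3 := h1.unique h2
      have h4 : dt X s z y = (1 + V s z y) / (1 - V s z y) :=
        (h.chars.deriv_X s ⟨hsT.1, hsT.2.trans h.T_lt⟩ z y).deriv
      rw [h4] at h3
      have hne : (1 : ℝ) - V s z y ≠ 0 := by linarith
      have h5 : (1 + V s z y) / (1 - V s z y) = 2 / (1 - V s z y) - 1 := by field_simp; ring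
      rw [h5] at h3
      linarith
    have hder : dt (dx₁ (invariant u)) s ξ y * 1 + dx₁ (dx₁ (invariant u)) s ξ y * (-1) =
        fderiv ℝ f (s, ξ, y, D u s ξ y) (0, 1, 0, dx₁ (D u) s ξ y) := by
      rw [dt_dx₁_comm hw hS hm]
      have d1 := hasDerivAt_dx₁ (ContDiffOn.differentiableAt_unc (contDiffOn_dt hw hS) hS hm)
      have d2 := hasDerivAt_dx₁ (ContDiffOn.differentiableAt_unc hwx hS hm)
      have d3 := hasDerivAt_dx₁ (h.differentiableAt_D_u hsJ ξ y)
      have d4 := (hf.smooth.differentiable (by simp) (s, ξ, y, D u s ξ y)).hasFDerivAt.comp_hasDerivAt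
        (f := fun ξ => (s, ξ, y, D u s ξ y)) ξ ((hasDerivAt_const ξ s).prodMk
          ((hasDerivAt_id' ξ).prodMk ((hasDerivAt_const ξ y).prodMk d3)))
      have e : (fun ξ => dt (invariant u) s ξ y - dx₁ (invariant u) s ξ y) =
          f ∘ fun ξ => (s, ξ, y, D u s ξ y) := funext fun ξ => h.dt_sub_dx₁_invariant hsT ξ y
      have h1 := d1.sub d2
      have h2 := h1.unique (f := fun ξ => dt (invariant u) s ξ y - dx₁ (invariant u) s ξ y)
        (by rw [e]; exact d4)
      rw [← h2]
      ring
    rw [hder]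
    have hn : ‖((0, 1, 0, dx₁ (D u) s ξ y) : ℝ × ℝ × ℝ × ℝ)‖ ≤ 1 + |dx₁ (D u) s ξ y| := by
      simp only [Prod.norm_def, Real.norm_eq_abs, abs_zero, abs_one]
      have := abs_nonneg (dx₁ (D u) s ξ y)
      refine max_le (by linarith) (max_le (by linarith) (max_le (by linarith) (by linarith)))
    have h1 : |fderiv ℝ f (s, ξ, y, D u s ξ y) (0, 1, 0, dx₁ (D u) s ξ y)| ≤
        C * (1 + |dx₁ (D u) s ξ y|) := by
      refine ((fderiv ℝ f _).le_opNorm _).trans ?_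
      exact mul_le_mul (hfC _) hn (norm_nonneg _) hC
    have h2 : |dx₁ (D u) s ξ y| ≤ -(N * (dt l s ξ y * 1 + dx₁ l s ξ y * (-1))) := by
      set σ := dt l s ξ y * 1 + dx₁ l s ξ y * (-1)
      have hpos : 0 < 1 - V s z y := by linarith
      have h3 : |dx₁ (D u) s ξ y| * dx₁ X s z y = |dx₁ V s z y| := by
        rw [← hvx, abs_mul, abs_of_pos hXx]
      refine le_of_mul_le_mul_right ?_ (mul_pos hXx hpos)
      have h4 : dx₁ X s z y * σ * (1 - V s z y) = -2 := by
        rw [hlab]; field_simp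
      calc |dx₁ (D u) s ξ y| * (dx₁ X s z y * (1 - V s z y)) = |dx₁ V s z y| * (1 - V s z y) := by
            rw [← h3]; ring
        _ ≤ N * 2 := by linarith
        _ = -N * (dx₁ X s z y * σ * (1 - V s z y)) := by rw [h4]; ring
        _ = _ := by ring
    have h3 := mul_le_mul_of_nonneg_left h2 hC
    linarith

end IsDevelopment

end LogWave

/-! ### Divergence of the local `L²` norm of the second derivative -/

namespace LogWave

/-- A smooth function grows at most quadratically at a point where it has a vanishing minimum. -/
lemma exists_le_mul_sq_of_isLocalMin {E : Type} [NormedAddCommGroup E] [NormedSpace ℝ E] {φ : E → ℝ}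
    {a : E} (hφ : ContDiffAt ℝ ∞ φ a) (hmin : IsLocalMin φ a) (h0 : φ a = 0) :
    ∃ K > 0, ∀ᶠ q in 𝓝 a, φ q ≤ K * ‖q - a‖ ^ 2 := by
  -- The gradient vanishes at `a` and is locally Lipschitz, so it is at most a multiple of `‖q - a‖`
  -- on the ball of that radius. The mean value inequality gives the second factor.
  have hd : fderiv ℝ φ a = 0 := hmin.fderiv_eq_zero
  have h1 : ContDiffAt ℝ 1 (fderiv ℝ φ) a :=
    hφ.fderiv_right (by simpa [one_add_one_eq_two] using two_le_infty)
  obtain ⟨K, s, hs, hlip⟩ := h1.exists_lipschitzOnWith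
  have hdiff : ∀ᶠ q in 𝓝 a, DifferentiableAt ℝ φ q :=
    ((hφ.of_le (m := 1) (by exact_mod_cast one_le_two.trans two_le_infty)).eventually (by simp)).mono
      fun q hq => hq.differentiableAt (by simp)
  obtain ⟨δ, hδ, hball⟩ := Metric.mem_nhds_iff.1 (inter_mem hs hdiff)
  refine ⟨K + 1, by positivity, ?_⟩
  filter_upwards [Metric.ball_mem_nhds a hδ] with q hq
  have hsub : Metric.closedBall a ‖q - a‖ ⊆ Metric.ball a δ :=
    Metric.closedBall_subset_ball (mem_ball_iff_norm.1 hq)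
  have h2 := (convex_closedBall a ‖q - a‖).norm_image_sub_le_of_norm_fderiv_le (𝕜 := ℝ) (f := φ)
    (C := K * ‖q - a‖) (fun z hz => (hball (hsub hz)).2) (fun z hz => ?_)
    (Metric.mem_closedBall_self (norm_nonneg _)) (mem_closedBall_iff_norm.2 le_rfl)
  · rw [h0, sub_zero] at h2
    calc φ q ≤ ‖φ q‖ := Real.le_norm_self _
      _ ≤ K * ‖q - a‖ * ‖q - a‖ := h2
      _ ≤ (K + 1) * ‖q - a‖ ^ 2 := by nlinarith [sq_nonneg ‖q - a‖]
  · have h3 := hlip.norm_sub_le (hball (hsub hz)).1 (hball (Metric.mem_ball_self hδ)).1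
    rw [hd, sub_zero] at h3
    refine h3.trans ?_
    gcongr
    exact mem_closedBall_iff_norm.1 hz

/-- In polar coordinates for the norm of `ℝ × ℝ` the integral becomes that of `r · r⁻² = r⁻¹` near
`0`. The exponent is exactly critical in dimension two. -/
lemma lintegral_ball_inv_sq_eq_top (a : ℝ × ℝ) {c ε : ℝ} (hc : 0 < c) (hε : 0 < ε) :
    ∫⁻ q in Metric.ball a ε, ENNReal.ofReal (c / ‖q - a‖ ^ 2) = ⊤ := by
  by_contra hne
  set g : ℝ → ℝ := (Iio ε).indicator fun y => c / y ^ 2 with hg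
  have hgm : Measurable g := Measurable.indicator (by fun_prop) measurableSet_Iio
  have hg0 : ∀ y, 0 ≤ g y := fun y => indicator_nonneg (fun z _ => by positivity) y
  have e : ∫⁻ q in Metric.ball a ε, ENNReal.ofReal (c / ‖q - a‖ ^ 2) =
      ∫⁻ q : ℝ × ℝ, ENNReal.ofReal (g ‖q‖) := by
    rw [← lintegral_sub_right_eq_self (fun q : ℝ × ℝ => ENNReal.ofReal (g ‖q‖)) a,
      ← lintegral_indicator Metric.isOpen_ball.measurableSet]
    congr 1
    funext q
    by_cases hq : ‖q - a‖ < ε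
    · rw [indicator_of_mem (mem_ball_iff_norm.2 hq), hg, indicator_of_mem (show ‖q - a‖ ∈ Iio ε from hq)]
    · rw [indicator_of_notMem (fun h => hq (mem_ball_iff_norm.1 h)), hg,
        indicator_of_notMem (show ‖q - a‖ ∉ Iio ε from hq), ENNReal.ofReal_zero]
  rw [e] at hne
  have hint : Integrable (fun q : ℝ × ℝ => g ‖q‖) := by
    refine ⟨(hgm.comp measurable_norm).aestronglyMeasurable, ?_⟩
    rw [hasFiniteIntegral_iff_ofReal (Eventually.of_forall fun q => hg0 _)]
    exact lt_top_iff_ne_top.2 hne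
  rw [integrable_fun_norm_addHaar] at hint
  have hdim : Module.finrank ℝ (ℝ × ℝ) = 2 := by simp
  rw [hdim] at hint
  have h1 : IntegrableOn (fun y : ℝ => c * y⁻¹) (Ioc 0 (ε / 2)) := by
    refine (hint.mono_set (Ioc_subset_Ioi_self)).congr_fun (fun y hy => ?_) measurableSet_Ioc
    have hyε : y ∈ Iio ε := by have := hy.2; simp only [mem_Iio]; linarith
    have hy0 := hy.1.ne'
    simp only [hg, indicator_of_mem hyε, smul_eq_mul]
    field_simp
    simp
  have h2 : IntervalIntegrable (fun y : ℝ => y⁻¹) volume 0 (ε / 2) := by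
    rw [intervalIntegrable_iff_integrableOn_Ioc_of_le (by positivity)]
    have h3 := h1.const_mul c⁻¹
    refine h3.congr (Eventually.of_forall fun y => ?_)
    field_simp
  rw [intervalIntegrable_inv_iff] at h2
  rcases h2 with h2 | h2
  · linarith
  · exact h2 left_mem_uIcc

/-- Fatou's lemma along sequences of times, since the pointwise limit has infinite integral. -/
lemma tendsto_lintegral_regularized_inv_sq (a : ℝ × ℝ) {c ε T : ℝ} (hc : 0 < c) (hε : 0 < ε) :
    Tendsto (fun t => ∫⁻ q in Metric.ball a ε, ENNReal.ofReal (c / (‖q - a‖ ^ 2 + (T - t))))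
      (𝓝[<] T) (𝓝 ⊤) := by
  refine tendsto_of_seq_tendsto fun t ht => ?_
  have ht' : Tendsto t atTop (𝓝 T) := ht.mono_right nhdsWithin_le_nhds
  refine tendsto_of_le_liminf_of_limsup_le ?_ le_top
  calc ⊤ = ∫⁻ q in Metric.ball a ε, ENNReal.ofReal (c / ‖q - a‖ ^ 2) :=
        (lintegral_ball_inv_sq_eq_top a hc hε).symm
    _ ≤ ∫⁻ q in Metric.ball a ε,
        liminf (fun n => ENNReal.ofReal (c / (‖q - a‖ ^ 2 + (T - t n)))) atTop := by
        refine lintegral_mono fun q => ?_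
        rcases eq_or_ne q a with rfl | hq
        · simp
        · have hq0 : ‖q - a‖ ^ 2 + (T - T) ≠ 0 := by
            have := norm_pos_iff.2 (sub_ne_zero.2 hq)
            rw [sub_self, add_zero]; positivity
          have h1 : Tendsto (fun n => ENNReal.ofReal (c / (‖q - a‖ ^ 2 + (T - t n)))) atTop
              (𝓝 (ENNReal.ofReal (c / (‖q - a‖ ^ 2 + (T - T))))) :=
            ENNReal.tendsto_ofReal (tendsto_const_nhds.div
              (tendsto_const_nhds.add (tendsto_const_nhds.sub ht')) hq0)
          rw [h1.liminf_eq, sub_self, add_zero]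
    _ ≤ _ := lintegral_liminf_le fun n => by fun_prop

lemma setLIntegral_ball_prod (a : ℝ × ℝ) (ε : ℝ) {G : ℝ × ℝ → ℝ≥0∞} (hG : Measurable G) :
    ∫⁻ q in Metric.ball a ε, G q =
      ∫⁻ y in Metric.ball a.2 ε, ∫⁻ x in Metric.ball a.1 ε, G (x, y) := by
  rw [← ball_prod_same, Measure.volume_eq_prod, ← Measure.prod_restrict,
    lintegral_prod_symm _ hG.aemeasurable]

namespace IsDevelopment

variable {f : ℝ × ℝ × ℝ × ℝ → ℝ} {χ : ℝ → ℝ → ℝ} {r ρ T : ℝ} {X V u l : ℝ → ℝ → ℝ → ℝ}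

lemma continuous_slice {w : ℝ → ℝ → ℝ → ℝ} {A B t : ℝ}
    (hw : ContinuousOn (unc w) (Ioo A B ×ˢ univ)) (ht : t ∈ Ioo A B) :
    Continuous fun q : ℝ × ℝ => w t q.1 q.2 :=
  hw.comp_continuous (f := fun q : ℝ × ℝ => (t, q)) (by fun_prop) fun q => ⟨ht, mem_univ _⟩

/-- For each fixed `y` the map `x ↦ X(t, x, y)` is increasing with Jacobian `X_x`. Change variables
on each line and integrate in `y`. -/
lemma lintegral_lagrangian_le (h : IsDevelopment f χ r ρ T X V u l) {t : ℝ} (ht : t ∈ Ioo (-ρ) T)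
    {a p : ℝ × ℝ} {ε δ : ℝ} {g : ℝ × ℝ → ℝ} (hg : Continuous g)
    (hsub : ∀ q ∈ Metric.ball a ε, (X t q.1 q.2, q.2) ∈ Metric.ball p δ) :
    ∫⁻ q in Metric.ball a ε, ENNReal.ofReal (dx₁ X t q.1 q.2 * g (X t q.1 q.2, q.2)) ≤
      ∫⁻ q in Metric.ball p δ, ENNReal.ofReal (g q) := by
  have hsl := h.mem_slab ht
  have hXc := continuous_slice h.chars.smooth_X.continuousOn hsl
  have hXxc := continuous_slice h.chars.continuousOn_dx₁_X hsl
  rw [setLIntegral_ball_prod p δ (by fun_prop), setLIntegral_ball_prod a ε (by fun_prop)]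
  rcases (Metric.ball a ε).eq_empty_or_nonempty with he | ⟨a', ha'⟩
  · have hε : ε ≤ 0 := Metric.ball_eq_empty.1 he
    rw [Metric.ball_eq_empty.2 hε, Measure.restrict_empty, lintegral_zero_measure]
    exact zero_le
  have hmem : ∀ x ∈ Metric.ball a.1 ε, ∀ y ∈ Metric.ball a.2 ε, (x, y) ∈ Metric.ball a ε :=
    fun x hx y hy => by rw [← ball_prod_same]; exact ⟨hx, hy⟩
  have hsub' : ∀ x ∈ Metric.ball a.1 ε, ∀ y ∈ Metric.ball a.2 ε,
      X t x y ∈ Metric.ball p.1 δ ∧ y ∈ Metric.ball p.2 δ := fun x hx y hy => by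
    have := hsub _ (hmem x hx y hy)
    rwa [← ball_prod_same] at this
  rw [← ball_prod_same] at ha'
  refine (lintegral_mono_ae (g := fun y => ∫⁻ x in Metric.ball p.1 δ, ENNReal.ofReal (g (x, y)))
    ((ae_restrict_mem Metric.isOpen_ball.measurableSet).mono fun y hy => ?_)).trans
    (lintegral_mono_set fun y hy => (hsub' a'.1 ha'.1 y hy).2)
  have hd : ∀ x, HasDerivAt (fun x => X t x y) (dx₁ X t x y) x := fun x =>
    hasDerivAt_dx₁ (h.chars.differentiableAt_X hsl x y)
  have hmono : StrictMono fun x => X t x y :=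
    strictMono_of_deriv_pos fun x => by rw [(hd x).deriv]; exact h.pos t ht x y
  calc _ = ∫⁻ x in Metric.ball a.1 ε,
        ENNReal.ofReal (dx₁ X t x y) * ENNReal.ofReal (g (X t x y, y)) := by
        refine lintegral_congr fun x => ?_
        rw [ENNReal.ofReal_mul (h.pos t ht x y).le]
    _ = ∫⁻ x in (fun x => X t x y) '' Metric.ball a.1 ε, ENNReal.ofReal (g (x, y)) :=
        (lintegral_image_eq_lintegral_deriv_mul_of_monotoneOn Metric.isOpen_ball.measurableSet
          (fun x _ => (hd x).hasDerivWithinAt) (hmono.monotone.monotoneOn _)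
          fun x => ENNReal.ofReal (g (x, y))).symm
    _ ≤ _ := lintegral_mono_set (by rintro _ ⟨x, hx, rfl⟩; exact (hsub' x hx y hy).1)

/-- The second derivative of `u` blows up in `L²` near the point where the characteristics cross. -/
theorem tendsto_lintegral_sq (hf : IsSource f) (h : IsDevelopment f χ r ρ T X V u l)
    {χ' : ℝ → ℝ → ℝ} (hχ' : ∀ x y, HasDerivAt (fun x => χ x y) (χ' x y) x) {B : ℝ}
    (hB : ∀ x y, |χ x y| ≤ B) (hB' : ∀ x y, |χ' x y| ≤ B) {x₀ y₀ : ℝ}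
    (h0 : dx₁ X T x₀ y₀ = 0) (hnn : ∀ x y, 0 ≤ dx₁ X T x y) {N : Set (ℝ × ℝ)}
    (hN : N ∈ 𝓝 (X T x₀ y₀, y₀)) :
    Tendsto (fun t => ∫⁻ q in N, ENNReal.ofReal (dx₁ (dx₁ u) t q.1 q.2 ^ 2)) (𝓝[<] T) (𝓝 ⊤) := by
  obtain ⟨M, hM⟩ := h.abs_dx₁_invariant_le hf hχ' hB hB'
  have hTr : T ∈ Ioo (-r) r := ⟨by linarith [h.T_pos, h.T_lt], h.T_lt⟩
  have hslab : Ioo (-r) r ×ˢ (univ : Set (ℝ × ℝ)) ∈ 𝓝 (T, x₀, y₀) :=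
    (isOpen_slab _ _).mem_nhds ⟨hTr, mem_univ _⟩
  have hXx : ContDiffAt ℝ ∞ (unc (dx₁ X)) (T, x₀, y₀) :=
    (contDiffOn_dx₁ h.chars.smooth_X (isOpen_slab _ _)).contDiffAt hslab
  have hVx : ContinuousAt (unc (dx₁ V)) (T, x₀, y₀) :=
    (contDiffOn_dx₁ h.chars.smooth_V (isOpen_slab _ _)).continuousOn.continuousAt hslab
  -- `X_x = 0` gives `1 ≤ 1/2 · max(1, |χ'|)`, hence `|χ'| ≥ 2` and `|V_x| ≥ |χ'| - |χ'| / 2 ≥ 1`.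
  have hVx0 : 1 / 2 < |dx₁ V T x₀ y₀| := by
    have h1 := h.chars.abs_dx₁_sub_le hTr (hχ' x₀ y₀)
    rw [h0] at h1
    have h2 : 1 ≤ 1 / 2 * max 1 |χ' x₀ y₀| := by simpa using h1.1
    have h3 : max 1 |χ' x₀ y₀| = |χ' x₀ y₀| := by
      rcases max_cases 1 |χ' x₀ y₀| with h | h
      · rw [h.1] at h2; linarith
      · exact h.1
    rw [h3] at h1 h2
    have h4 := abs_sub_abs_le_abs_sub (χ' x₀ y₀) (dx₁ V T x₀ y₀)
    rw [abs_sub_comm] at h4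
    linarith [h1.2]
  obtain ⟨δ, hδ, hδN⟩ := Metric.mem_nhds_iff.1 hN
  have ev1 : ∀ᶠ p : ℝ × ℝ × ℝ in 𝓝 (T, x₀, y₀),
      (X p.1 p.2.1 p.2.2, p.2.2) ∈ Metric.ball (X T x₀ y₀, y₀) δ := by
    have hc : ContinuousAt (fun p : ℝ × ℝ × ℝ => (unc X p, p.2.2)) (T, x₀, y₀) :=
      (h.chars.smooth_X.continuousOn.continuousAt hslab).prodMk (by fun_prop)
    exact hc.eventually (Metric.ball_mem_nhds _ hδ)
  have ev2 : ∀ᶠ p : ℝ × ℝ × ℝ in 𝓝 (T, x₀, y₀), 1 / 2 < |dx₁ V p.1 p.2.1 p.2.2| :=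
    hVx.abs.eventually (lt_mem_nhds hVx0)
  have ev3 : ∀ᶠ p : ℝ × ℝ × ℝ in 𝓝 (T, x₀, y₀), dx₁ X p.1 p.2.1 p.2.2 < 1 :=
    hXx.continuousAt.eventually (gt_mem_nhds (by change dx₁ X T x₀ y₀ < 1; rw [h0]; exact one_pos))
  have hXT : ContDiffAt ℝ ∞ (fun q : ℝ × ℝ => unc (dx₁ X) (T, q)) (x₀, y₀) :=
    hXx.comp (x₀, y₀) (f := fun q : ℝ × ℝ => (T, q)) (by fun_prop)
  obtain ⟨K₁, hK₁, ev4⟩ := exists_le_mul_sq_of_isLocalMin hXT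
    (Eventually.of_forall fun q => by
      change dx₁ X T x₀ y₀ ≤ dx₁ X T q.1 q.2
      rw [h0]; exact hnn _ _) h0
  have ev4' : ∀ᶠ p : ℝ × ℝ × ℝ in 𝓝 (T, x₀, y₀),
      dx₁ X T p.2.1 p.2.2 ≤ K₁ * ‖p.2 - (x₀, y₀)‖ ^ 2 :=
    (continuous_snd.tendsto (T, x₀, y₀)).eventually ev4
  obtain ⟨K₂, s, hs, hlip⟩ :=
    (hXx.of_le (m := 1) (by exact_mod_cast one_le_two.trans two_le_infty)).exists_lipschitzOnWith
  obtain ⟨ε, hε, hball⟩ := Metric.mem_nhds_iff.1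
    (inter_mem (inter_mem (inter_mem ev1 ev2) (inter_mem ev3 ev4')) hs)
  set K : ℝ := max K₁ K₂ with hK
  have hK0 : 0 < K := hK₁.trans_le (le_max_left _ _)
  set a : ℝ × ℝ := (x₀, y₀) with ha
  set J : ℝ → ℝ≥0∞ := fun t => ∫⁻ q in N, ENNReal.ofReal (dx₁ (dx₁ u) t q.1 q.2 ^ 2) with hJ
  -- The constant comes from the pointwise bound `X_x u_xx² + M² / 4 ≥ 1 / (128 X_x)` near the focal
  -- label, combined with `X_x ≤ K (|q - a|² + T - t)`.
  set A : ℝ → ℝ≥0∞ := fun t =>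
    ∫⁻ q in Metric.ball a ε, ENNReal.ofReal (1 / (128 * K) / (‖q - a‖ ^ 2 + (T - t))) with hA
  have hAtop : Tendsto A (𝓝[<] T) (𝓝 ⊤) :=
    tendsto_lintegral_regularized_inv_sq a (by positivity) hε
  set c : ℝ≥0∞ := ENNReal.ofReal (M ^ 2 / 4) * volume (Metric.ball a ε) with hc
  have hctop : c ≠ ⊤ := ENNReal.mul_ne_top ENNReal.ofReal_ne_top measure_ball_lt_top.ne
  have hle : ∀ᶠ t in 𝓝[<] T, A t - c ≤ J t := by
    filter_upwards [Ioo_mem_nhdsLT (show max 0 (T - ε) < T from max_lt h.T_pos (by linarith))]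
      with t ht
    have ht0 : t ∈ Ico 0 T := ⟨(le_max_left _ _).trans ht.1.le, ht.2⟩
    have htJ := h.mem_of_Ico ht0
    have hmem : ∀ q ∈ Metric.ball a ε, ∀ s, |s - T| < ε → (s, q) ∈ Metric.ball (T, x₀, y₀) ε := by
      intro q hq s hs
      rw [← ball_prod_same]
      exact ⟨by rwa [Metric.mem_ball, Real.dist_eq], hq⟩
    have htε : |t - T| < ε := by
      rw [abs_sub_comm, abs_of_pos (by linarith [ht.2])]
      linarith [le_max_right 0 (T - ε), ht.1]
    have hdd : ContDiffOn ℝ ∞ (unc (dx₁ (dx₁ u))) (Ioo (-ρ) T ×ˢ univ) :=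
      contDiffOn_dx₁ (contDiffOn_dx₁ h.smooth_u (isOpen_slab _ _)) (isOpen_slab _ _)
    have hcont : Continuous fun q : ℝ × ℝ => dx₁ (dx₁ u) t q.1 q.2 ^ 2 :=
      (continuous_slice hdd.continuousOn htJ).pow 2
    rw [tsub_le_iff_right]
    calc A t ≤ ∫⁻ q in Metric.ball a ε,
          (ENNReal.ofReal (dx₁ X t q.1 q.2 * dx₁ (dx₁ u) t (X t q.1 q.2) q.2 ^ 2) +
            ENNReal.ofReal (M ^ 2 / 4)) := by
          refine lintegral_mono_ae ((ae_restrict_mem Metric.isOpen_ball.measurableSet).mono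
            fun q hq => ?_)
          have hXpos := h.pos t htJ q.1 q.2
          rw [← ENNReal.ofReal_add (by positivity) (by positivity)]
          refine ENNReal.ofReal_le_ofReal ?_
          obtain ⟨⟨⟨_, hV2⟩, ⟨hX1, hquad⟩⟩, hst⟩ := hball (hmem q hq t htε)
          have hsT := (hball (hmem q hq T (by simpa using hε))).2
          simp only [mem_ofPred_eq] at hV2 hX1 hquad
          -- Quadratic growth at time `T`, plus the Lipschitz dependence of `X_x` on time.
          have htime : dx₁ X t q.1 q.2 ≤ K * (‖q - a‖ ^ 2 + (T - t)) := by
            have h1 := hlip.dist_le_mul _ hst _ hsT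
            rw [dist_prod_same_right, Real.dist_eq, Real.dist_eq] at h1
            have h2 : dx₁ X t q.1 q.2 - dx₁ X T q.1 q.2 ≤ K₂ * (T - t) := by
              rw [abs_sub_comm t T, abs_of_pos (show 0 < T - t by linarith [ht.2])] at h1
              exact (le_abs_self _).trans h1
            have h3 : K₂ * (T - t) ≤ K * (T - t) :=
              mul_le_mul_of_nonneg_right (le_max_right _ _) (by linarith [ht.2])
            have h4 : K₁ * ‖q - a‖ ^ 2 ≤ K * ‖q - a‖ ^ 2 :=
              mul_le_mul_of_nonneg_right (le_max_left _ _) (sq_nonneg _)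
            linarith
          have hstep : 1 / (128 * K) / (‖q - a‖ ^ 2 + (T - t)) ≤ 1 / (128 * dx₁ X t q.1 q.2) := by
            rw [div_div]
            refine one_div_le_one_div_of_le (by positivity) ?_
            linarith
          refine hstep.trans ?_
          have hx2 := h.two_mul_dx₁_dx₁ htJ (X t q.1 q.2) q.2
          have hvx := h.dx₁_D_u_mul htJ q.1 q.2
          rw [h.D_u t htJ] at hx2
          have hw := hM t ht0 (X t q.1 q.2) q.2
          have hV := h.V_le htJ q.1 q.2
          set ux := dx₁ (dx₁ u) t (X t q.1 q.2) q.2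
          set vx := dx₁ (D u) t (X t q.1 q.2) q.2
          set wx := dx₁ (invariant u) t (X t q.1 q.2) q.2
          set Xx := dx₁ X t q.1 q.2
          set W := dx₁ V t q.1 q.2
          set v := V t q.1 q.2
          have hb : 1 / 16 ≤ ((1 - v) * W) ^ 2 := by
            have : 1 / 4 ≤ |(1 - v) * W| := by
              rw [abs_mul, abs_of_pos (show 0 < 1 - v by linarith)]
              nlinarith
            rw [← sq_abs]
            nlinarith
          have hw2 : wx ^ 2 ≤ M ^ 2 := sq_le_sq' (abs_le.1 hw).1 (abs_le.1 hw).2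
          -- The inequality `(p + w)² ≥ p² / 2 - w²`. Multiplied by `X_x²` it gives `4 X_x² u_xx² ≥
          -- 1/32 - X_x M²`, using `X_x v_x = V_x`, `((1 - v) V_x)² ≥ 1/16` and `X_x < 1`.
          have hsq : (2 * ux) ^ 2 ≥ ((1 - v) * vx) ^ 2 / 2 - wx ^ 2 := by
            rw [hx2]
            nlinarith [sq_nonneg ((1 - v) * vx + 2 * wx)]
          have e1 : Xx ^ 2 * ((1 - v) * vx) ^ 2 = ((1 - v) * W) ^ 2 := by rw [← hvx]; ring
          rw [div_le_iff₀ (by positivity)]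
          have h5 : Xx ^ 2 * ((2 * ux) ^ 2) ≥ Xx ^ 2 * (((1 - v) * vx) ^ 2 / 2 - wx ^ 2) :=
            mul_le_mul_of_nonneg_left hsq (sq_nonneg _)
          have h6 : Xx ^ 2 * wx ^ 2 ≤ Xx * M ^ 2 := by
            have : Xx ^ 2 ≤ Xx := by nlinarith
            exact mul_le_mul this hw2 (sq_nonneg _) hXpos.le
          nlinarith
      _ = (∫⁻ q in Metric.ball a ε,
          ENNReal.ofReal (dx₁ X t q.1 q.2 * dx₁ (dx₁ u) t (X t q.1 q.2) q.2 ^ 2)) + c := by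
          rw [lintegral_add_right _ measurable_const, setLIntegral_const]
      _ ≤ J t + c := by
          gcongr
          exact (h.lintegral_lagrangian_le htJ hcont fun q hq =>
            (hball (hmem q hq t htε)).1.1.1).trans (lintegral_mono_set hδN)
  have hsubtop : Tendsto (fun t => A t - c) (𝓝[<] T) (𝓝 ⊤) := by
    have := ENNReal.Tendsto.sub hAtop tendsto_const_nhds (Or.inr hctop)
    rwa [ENNReal.top_sub hctop] at this
  exact tendsto_nhds_top_mono hsubtop hle

end IsDevelopment

end LogWave

/-! ### A dual estimate with the logarithmic weight -/

namespace LogWave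

open LineDeriv

/-- The logarithm loses less than any power: `a + 1 ≤ exp a` with `a = |ln r| / (8β)` costs exactly
`r^{±1/8}` after raising to the power `β`. -/
theorem one_add_abs_log_rpow_le {β r : ℝ} (hβ : 1 / 2 < β) (hr : 0 < r) :
    (1 + |Real.log r|) ^ β ≤ (8 * β) ^ β * max (r ^ (1 / 8 : ℝ)) (r ^ (-(1 / 8) : ℝ)) := by
  have h8 : 0 < 8 * β := by linarith
  have h1 : 1 + |Real.log r| ≤ 8 * β * Real.exp (|Real.log r| / (8 * β)) := by
    have := Real.add_one_le_exp (|Real.log r| / (8 * β))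
    calc 1 + |Real.log r| ≤ 8 * β * (|Real.log r| / (8 * β) + 1) := by
          field_simp
          linarith
      _ ≤ _ := by gcongr
  calc (1 + |Real.log r|) ^ β ≤ (8 * β * Real.exp (|Real.log r| / (8 * β))) ^ β :=
        Real.rpow_le_rpow (by positivity) h1 (by linarith)
    _ = (8 * β) ^ β * Real.exp (|Real.log r| / 8) := by
        rw [Real.mul_rpow h8.le (Real.exp_pos _).le, ← Real.exp_mul]
        congr 2
        have : β ≠ 0 := by linarith
        field_simp
    _ ≤ _ := by
        gcongr
        rcases abs_cases (Real.log r) with ⟨h, _⟩ | ⟨h, _⟩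
        · refine le_max_of_le_left (le_of_eq ?_)
          rw [h, Real.rpow_def_of_pos hr]
          ring_nf
        · refine le_max_of_le_right (le_of_eq ?_)
          rw [h, Real.rpow_def_of_pos hr]
          ring_nf

/-- A bound for the quotient of `|ξ| ^ 2` and the weight of order `11 / 4`. -/
noncomputable def dualWeight (β : ℝ) (ξ : Plane) : ℝ :=
  (8 * β) ^ β * max 1 (‖ξ‖ ^ (-(7 / 8) : ℝ))

theorem dualWeight_nonneg {β : ℝ} (hβ : 1 / 2 < β) (ξ : Plane) : 0 ≤ dualWeight β ξ := by
  have : 0 < 8 * β := by linarith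
  unfold dualWeight
  positivity

/-- The quotient of `|ξ|²` by the weight is `(1 + |ln |ξ||)^β |ξ|^{-3/4}`. At high frequency the
exponent is at most `-3/4 + 1/8 < 0`, so it is bounded. At low frequency it is at worst
`|ξ|^{-7/8}`, whose square is integrable near the origin of the plane. -/
theorem sq_norm_le_logWeight_mul {β : ℝ} (hβ : 1 / 2 < β) (ξ : Plane) :
    ‖ξ‖ ^ 2 ≤ logWeight (11 / 4) β ξ * dualWeight β ξ := by
  rcases (norm_nonneg ξ).eq_or_lt with h0 | hr
  · rw [← h0]
    have : 0 ≤ logWeight (11 / 4) β ξ := by unfold logWeight; positivity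
    have := mul_nonneg this (dualWeight_nonneg hβ ξ)
    simpa using this
  set r := ‖ξ‖
  have hL : 0 < 1 + |Real.log r| := by positivity
  have h := one_add_abs_log_rpow_le hβ hr
  have h2 : (1 + |Real.log r|) ^ β * r ^ (-(3 / 4) : ℝ) ≤ dualWeight β ξ := by
    calc _ ≤ (8 * β) ^ β * max (r ^ (1 / 8 : ℝ)) (r ^ (-(1 / 8) : ℝ)) * r ^ (-(3 / 4) : ℝ) := by
          gcongr
      _ = (8 * β) ^ β * max (r ^ (-(5 / 8) : ℝ)) (r ^ (-(7 / 8) : ℝ)) := by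
          rw [mul_assoc, max_mul_of_nonneg _ _ (by positivity), ← Real.rpow_add hr,
            ← Real.rpow_add hr]
          norm_num
      _ ≤ _ := by
          have : 0 < 8 * β := by linarith
          unfold dualWeight
          gcongr (8 * β) ^ β * ?_
          refine max_le ?_ (le_max_right _ _)
          rcases le_total 1 r with h1 | h1
          · exact le_max_of_le_left (Real.rpow_le_one_of_one_le_of_nonpos h1 (by norm_num))
          · exact le_max_of_le_right (Real.rpow_le_rpow_of_exponent_ge hr h1 (by norm_num))
  calc r ^ 2 = logWeight (11 / 4) β ξ * ((1 + |Real.log r|) ^ β * r ^ (-(3 / 4) : ℝ)) := by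
        unfold logWeight
        rw [Real.rpow_neg hL.le]
        have : (1 + |Real.log r|) ^ β ≠ 0 := by positivity
        have h4 : r ^ (11 / 4 : ℝ) * r ^ (-(3 / 4) : ℝ) = r ^ 2 := by
          rw [← Real.rpow_add hr]
          norm_num
        rw [← h4]
        change _ = r ^ (11 / 4 : ℝ) * ((1 + |Real.log r|) ^ β)⁻¹ * _
        field_simp
    _ ≤ _ := by
        have : 0 ≤ logWeight (11 / 4) β ξ := by unfold logWeight; positivity
        gcongr

theorem sq_dualWeight_le {β : ℝ} (hβ : 1 / 2 < β) (ξ : Plane) :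
    dualWeight β ξ ^ 2 ≤ ((8 * β) ^ β) ^ 2 *
      (1 + (Metric.ball (0 : Plane) 1).indicator (fun ξ => ‖ξ‖ ^ (-(7 / 4) : ℝ)) ξ) := by
  unfold dualWeight
  rw [mul_pow]
  gcongr
  have hnn : 0 ≤ (Metric.ball (0 : Plane) 1).indicator (fun ξ => ‖ξ‖ ^ (-(7 / 4) : ℝ)) ξ :=
    indicator_nonneg (fun _ _ => by positivity) _
  have hsq : (‖ξ‖ ^ (-(7 / 8) : ℝ)) ^ 2 = ‖ξ‖ ^ (-(7 / 4) : ℝ) := by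
    rw [← Real.rpow_mul_natCast (norm_nonneg _)]
    norm_num
  by_cases h : ‖ξ‖ < 1
  · rw [indicator_of_mem (by simpa using h), ← hsq]
    rcases max_cases (1 : ℝ) (‖ξ‖ ^ (-(7 / 8) : ℝ)) with ⟨h, _⟩ | ⟨h, _⟩ <;> rw [h] <;>
      nlinarith [sq_nonneg (‖ξ‖ ^ (-(7 / 8) : ℝ))]
  · have : ‖ξ‖ ^ (-(7 / 8) : ℝ) ≤ 1 :=
      Real.rpow_le_one_of_one_le_of_nonpos (not_lt.1 h) (by norm_num)
    rw [max_eq_left this]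
    linarith

theorem lintegral_ball_norm_rpow_lt_top :
    ∫⁻ ξ in Metric.ball (0 : Plane) 1, ENNReal.ofReal (‖ξ‖ ^ (-(7 / 4) : ℝ)) < ⊤ := by
  have : IntegrableOn (fun ξ : Plane => ‖ξ‖ ^ (-(7 / 4) : ℝ)) (Metric.ball 0 1) := by
    refine integrableOn_ball_of_norm_le_rpow (C := 1) (α := 7 / 4) (by simp) (by simp; norm_num)
      (.of_forall fun x => ?_) (Measurable.aestronglyMeasurable (by fun_prop))
    rw [Real.norm_of_nonneg (by positivity), one_mul]
  exact (hasFiniteIntegral_iff_ofReal (.of_forall fun _ => by positivity)).1 this.2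

theorem lintegral_enorm_sq_fourier (φ : 𝓢(Plane, ℂ)) :
    ∫⁻ ξ, ‖(𝓕 φ) ξ‖ₑ ^ 2 = ∫⁻ x, ‖φ x‖ₑ ^ 2 := by
  have key : ∀ φ : 𝓢(Plane, ℂ), ∫⁻ x, ‖φ x‖ₑ ^ 2 = ENNReal.ofReal (∫ x, ‖φ x‖ ^ 2) := by
    intro φ
    rw [ofReal_integral_eq_lintegral_ofReal
      ((φ.memLp 2 (μ := volume)).integrable_norm_pow (by norm_num)) (.of_forall fun _ => by positivity)]
    simp [← ofReal_norm, ENNReal.ofReal_pow]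
  rw [key, key, SchwartzMap.integral_norm_sq_fourier]

theorem lintegral_enorm_sq_fourierInv (φ : 𝓢(Plane, ℂ)) :
    ∫⁻ ξ, ‖(𝓕⁻ φ) ξ‖ₑ ^ 2 = ∫⁻ x, ‖φ x‖ₑ ^ 2 := by
  rw [← lintegral_enorm_sq_fourier, FourierTransform.fourier_fourierInv_eq]

theorem enorm_fourierInv_le (φ : 𝓢(Plane, ℂ)) (ξ : Plane) :
    ‖(𝓕⁻ φ) ξ‖ₑ ≤ ∫⁻ x, ‖φ x‖ₑ := by
  rw [SchwartzMap.fourierInv_coe, Real.fourierInv_eq]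
  refine (enorm_integral_le_lintegral_enorm _).trans (le_of_eq ?_)
  refine lintegral_congr fun x => ?_
  rw [← ofReal_norm, ← ofReal_norm, Circle.norm_smul]

theorem sq_lintegral_enorm_le {K : Set Plane} (hK : MeasurableSet K) {φ : 𝓢(Plane, ℂ)}
    (hφ : ∀ x ∉ K, φ x = 0) :
    (∫⁻ x, ‖φ x‖ₑ) ^ 2 ≤ volume K * ∫⁻ x, ‖φ x‖ₑ ^ 2 := by
  have h1 : ∫⁻ x, ‖φ x‖ₑ =
      ∫⁻ x, (K.indicator (1 : Plane → ℝ≥0∞) * fun x => ‖φ x‖ₑ : Plane → ℝ≥0∞) x := by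
    refine lintegral_congr fun x => ?_
    by_cases hx : x ∈ K <;> simp [hx, hφ]
  have h2 := ENNReal.lintegral_mul_le_Lp_mul_Lq volume Real.HolderConjugate.two_two
    (f := K.indicator 1) (g := fun x => ‖φ x‖ₑ)
    ((measurable_one.indicator hK).aemeasurable) (by fun_prop)
  rw [← h1] at h2
  calc (∫⁻ x, ‖φ x‖ₑ) ^ 2 ≤ _ := pow_le_pow_left' h2 2
    _ = _ := by
      rw [mul_pow, ← ENNReal.rpow_mul_natCast, ← ENNReal.rpow_mul_natCast]
      norm_num
      congr 1
      rw [← lintegral_indicator_one hK]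
      refine lintegral_congr fun x => ?_
      by_cases hx : x ∈ K <;> simp [hx]

/-- The unit vector in the direction of `x₁`. -/
noncomputable def e₁ : Plane := EuclideanSpace.single 0 1

theorem norm_fourierInv_lineDeriv_lineDeriv_le (φ : 𝓢(Plane, ℂ)) (ξ : Plane) :
    ‖(𝓕⁻ (∂_{e₁} (∂_{e₁} φ))) ξ‖ ≤ 4 * Real.pi ^ 2 * ‖ξ‖ ^ 2 * ‖(𝓕⁻ φ) ξ‖ := by
  have ht : (inner ℝ · e₁ : Plane → ℝ).HasTemperateGrowth := by fun_prop
  rw [SchwartzMap.fourierInv_lineDerivOp_eq, SchwartzMap.fourierInv_lineDerivOp_eq]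
  simp only [smul_apply, SchwartzMap.smulLeftCLM_apply_apply ht, norm_smul]
  have h1 : ‖inner ℝ ξ e₁‖ ≤ ‖ξ‖ := by
    refine (norm_inner_le_norm _ _).trans (le_of_eq ?_)
    simp [e₁]
  have h2 : ‖-(2 * (Real.pi : ℂ) * Complex.I)‖ = 2 * Real.pi := by
    simp [abs_of_pos Real.pi_pos]
  rw [h2]
  calc _ ≤ 2 * Real.pi * (‖ξ‖ * (2 * Real.pi * (‖ξ‖ * ‖(𝓕⁻ φ) ξ‖))) := by gcongr
    _ = _ := by ring

/-- The constant in the duality estimate for functions supported in `K`. -/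
noncomputable def dualConst (β : ℝ) (K : Set Plane) : ℝ≥0∞ :=
  ENNReal.ofReal ((4 * Real.pi ^ 2) ^ 2 * ((8 * β) ^ β) ^ 2) *
    (1 + (∫⁻ ξ in Metric.ball (0 : Plane) 1, ENNReal.ofReal (‖ξ‖ ^ (-(7 / 4) : ℝ))) * volume K)

theorem dualConst_ne_top {β : ℝ} {K : Set Plane} (hK : volume K ≠ ⊤) : dualConst β K ≠ ⊤ :=
  ENNReal.mul_ne_top ENNReal.ofReal_ne_top
    (ENNReal.add_ne_top.2 ⟨ENNReal.one_ne_top,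
      ENNReal.mul_ne_top lintegral_ball_norm_rpow_lt_top.ne hK⟩)

/-- The bounded part of the weight is handled by Plancherel. On the unit ball the singular part
`|ξ|^{-7/4}` is integrable, while `𝓕⁻ φ` is bounded by the `L¹` norm of `φ`, hence by its `L²` norm
since `φ` lives on `K`. -/
theorem lintegral_dualWeight_sq_le {β : ℝ} (hβ : 1 / 2 < β) {K : Set Plane} (hK : MeasurableSet K)
    {φ : 𝓢(Plane, ℂ)} (hφ : ∀ x ∉ K, φ x = 0) :
    ∫⁻ ξ, (ENNReal.ofReal (4 * Real.pi ^ 2 * dualWeight β ξ) * ‖(𝓕⁻ φ) ξ‖ₑ) ^ 2 ≤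
      dualConst β K * ∫⁻ x, ‖φ x‖ₑ ^ 2 := by
  set A : ℝ := (4 * Real.pi ^ 2) ^ 2 * ((8 * β) ^ β) ^ 2
  set S := ∫⁻ x, ‖φ x‖ₑ ^ 2
  set J : Plane → ℝ≥0∞ := (Metric.ball (0 : Plane) 1).indicator
    (fun ξ => ENNReal.ofReal (‖ξ‖ ^ (-(7 / 4) : ℝ))) with hJ
  have hJm : Measurable J := Measurable.indicator (by fun_prop) measurableSet_ball
  calc _ ≤ ∫⁻ ξ, ENNReal.ofReal A * (‖(𝓕⁻ φ) ξ‖ₑ ^ 2 + J ξ * (volume K * S)) := by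
        refine lintegral_mono fun ξ => ?_
        have h1 : ENNReal.ofReal (4 * Real.pi ^ 2 * dualWeight β ξ) ^ 2 ≤
            ENNReal.ofReal A * (1 + J ξ) := by
          have hind : J ξ = ENNReal.ofReal
              ((Metric.ball (0 : Plane) 1).indicator (fun ξ => ‖ξ‖ ^ (-(7 / 4) : ℝ)) ξ) := by
            by_cases h : ξ ∈ Metric.ball (0 : Plane) 1
            · rw [hJ, indicator_of_mem h, indicator_of_mem h]
            · rw [hJ, indicator_of_notMem h, indicator_of_notMem h, ENNReal.ofReal_zero]
          rw [hind, ← ENNReal.ofReal_one, ← ENNReal.ofReal_add zero_le_one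
            (indicator_nonneg (fun _ _ => by positivity) _),
            ← ENNReal.ofReal_mul (by positivity),
            ← ENNReal.ofReal_pow (mul_nonneg (by positivity) (dualWeight_nonneg hβ ξ))]
          refine ENNReal.ofReal_le_ofReal ?_
          rw [mul_pow, mul_assoc]
          gcongr
          exact sq_dualWeight_le hβ ξ
        calc _ ≤ ENNReal.ofReal A * (1 + J ξ) * ‖(𝓕⁻ φ) ξ‖ₑ ^ 2 := by
              rw [mul_pow]
              gcongr
          _ = ENNReal.ofReal A * (‖(𝓕⁻ φ) ξ‖ₑ ^ 2 + J ξ * ‖(𝓕⁻ φ) ξ‖ₑ ^ 2) := by ring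
          _ ≤ _ := by
              gcongr
              exact (pow_le_pow_left' (enorm_fourierInv_le φ ξ) 2).trans
                (sq_lintegral_enorm_le hK hφ)
    _ = ENNReal.ofReal A * (S + (∫⁻ ξ, J ξ) * (volume K * S)) := by
        rw [lintegral_const_mul _ (by fun_prop), lintegral_add_left (by fun_prop),
          lintegral_enorm_sq_fourierInv, lintegral_mul_const _ hJm]
    _ = _ := by
        rw [hJ, lintegral_indicator measurableSet_ball, dualConst]
        ring

/-- Second derivatives in the direction of `x₁` are controlled, in a dual sense, by the
`H^{11/4} (ln H)^{-β}` norm. -/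
theorem enorm_integral_mul_lineDeriv_lineDeriv_le {β : ℝ} (hβ : 1 / 2 < β) {K : Set Plane}
    (hK : MeasurableSet K) {φ : 𝓢(Plane, ℂ)} (hφ : ∀ x ∉ K, φ x = 0) {U : Plane → ℝ}
    {g : Plane → ℂ} (hg : HasFourierTransform U g) :
    ‖∫ x, (U x : ℂ) * (∂_{e₁} (∂_{e₁} φ)) x‖ₑ ≤
      (∫⁻ ξ, (ENNReal.ofReal (logWeight (11 / 4) β ξ) * ‖g ξ‖ₑ) ^ 2) ^ (1 / 2 : ℝ) *
        (dualConst β K * ∫⁻ x, ‖φ x‖ₑ ^ 2) ^ (1 / 2 : ℝ) := by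
  -- The Fourier transform of this test function is `∂∂φ`, so the definition of
  -- `HasFourierTransform` transfers the pairing to the frequency side.
  set Φ : 𝓢(Plane, ℂ) := 𝓕⁻ (∂_{e₁} (∂_{e₁} φ)) with hΦ
  obtain ⟨-, hint, heq⟩ := hg Φ
  rw [hΦ, FourierTransform.fourier_fourierInv_eq, ← hΦ] at heq
  rw [heq]
  set w := fun ξ => ENNReal.ofReal (logWeight (11 / 4) β ξ)
  set M := fun ξ => ENNReal.ofReal (4 * Real.pi ^ 2 * dualWeight β ξ) * ‖(𝓕⁻ φ) ξ‖ₑ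
  -- Measurability of `g` is not given, but that of `g Φ` is. Dividing by `Φ` recovers `g` wherever
  -- `Φ` does not vanish, and elsewhere the integrand is zero.
  set G := fun ξ => w ξ * ‖g ξ * Φ ξ * (Φ ξ)⁻¹‖ₑ
  have hwm : Measurable w := by
    unfold w logWeight
    fun_prop
  have hGm : AEMeasurable G := by
    refine hwm.aemeasurable.mul (AEMeasurable.enorm ?_)
    exact hint.aestronglyMeasurable.aemeasurable.mul (by fun_prop)
  have hMm : AEMeasurable M := by
    unfold M dualWeight
    fun_prop
  calc _ ≤ ∫⁻ ξ, ‖g ξ * Φ ξ‖ₑ := enorm_integral_le_lintegral_enorm _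
    _ ≤ ∫⁻ ξ, (G * M) ξ := by
        refine lintegral_mono fun ξ => ?_
        rcases eq_or_ne (Φ ξ) 0 with h0 | h0
        · simp [h0]
        have h1 : ‖Φ ξ‖ₑ ≤ w ξ * M ξ := by
          have hw : 0 ≤ logWeight (11 / 4) β ξ := by unfold logWeight; positivity
          have hd := dualWeight_nonneg hβ ξ
          unfold w M
          rw [← ofReal_norm, ← ofReal_norm, ← ENNReal.ofReal_mul (by positivity),
            ← ENNReal.ofReal_mul hw]
          refine ENNReal.ofReal_le_ofReal ?_
          refine (norm_fourierInv_lineDeriv_lineDeriv_le φ ξ).trans ?_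
          calc _ ≤ 4 * Real.pi ^ 2 * (logWeight (11 / 4) β ξ * dualWeight β ξ) * ‖(𝓕⁻ φ) ξ‖ := by
                gcongr
                exact sq_norm_le_logWeight_mul hβ ξ
            _ = _ := by ring
        have h2 : g ξ * Φ ξ * (Φ ξ)⁻¹ = g ξ := by field_simp
        calc ‖g ξ * Φ ξ‖ₑ = ‖g ξ‖ₑ * ‖Φ ξ‖ₑ := enorm_mul _ _
          _ ≤ ‖g ξ‖ₑ * (w ξ * M ξ) := by gcongr
          _ = (G * M) ξ := by
              simp only [Pi.mul_apply, G, h2]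
              ring
    _ ≤ (∫⁻ ξ, G ξ ^ (2 : ℝ)) ^ (1 / 2 : ℝ) * (∫⁻ ξ, M ξ ^ (2 : ℝ)) ^ (1 / 2 : ℝ) :=
        ENNReal.lintegral_mul_le_Lp_mul_Lq volume Real.HolderConjugate.two_two hGm hMm
    _ ≤ _ := by
        simp only [ENNReal.rpow_ofNat]
        gcongr with ξ
        · unfold G
          gcongr w ξ * ?_
          rcases eq_or_ne (Φ ξ) 0 with h0 | h0
          · simp [h0]
          · rw [mul_assoc, mul_inv_cancel₀ h0, mul_one]
        · exact lintegral_dualWeight_sq_le hβ hK hφ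

end LogWave

/-! ### Local control of the second derivative by the logarithmic Sobolev norm -/

namespace LogWave

open LineDeriv

theorem lineDerivOp_toSchwartzMap_ofReal {φ : Plane → ℝ} (hφ : ContDiff ℝ ∞ φ)
    {Φ : 𝓢(Plane, ℂ)} (hΦ : ∀ x, Φ x = (φ x : ℂ)) (m x : Plane) :
    (∂_{m} Φ) x = ((fderiv ℝ φ x m : ℝ) : ℂ) := by
  rw [SchwartzMap.lineDerivOp_apply_eq_fderiv]
  have h : HasFDerivAt (fun x => Complex.ofRealCLM (φ x)) _ x :=
    Complex.ofRealCLM.hasFDerivAt.comp x (hφ.differentiable (by simp) x).hasFDerivAt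
  have h2 : (Φ : Plane → ℂ) = fun x => Complex.ofRealCLM (φ x) := funext hΦ
  rw [h2, h.fderiv]
  simp

theorem integral_mul_fderiv_fderiv_eq {W φ : Plane → ℝ} (hW : ContDiff ℝ ∞ W)
    (hφ : ContDiff ℝ ∞ φ) (hc : HasCompactSupport φ) (m : Plane) :
    ∫ x, W x * fderiv ℝ (fun x => fderiv ℝ φ x m) x m =
      ∫ x, fderiv ℝ (fun x => fderiv ℝ W x m) x m * φ x := by
  have smooth : ∀ {F : Plane → ℝ}, ContDiff ℝ ∞ F → ContDiff ℝ ∞ fun x => fderiv ℝ F x m :=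
    fun h => (h.fderiv_right (m := ∞) le_rfl).clm_apply contDiff_const
  have cpt : ∀ {F : Plane → ℝ}, HasCompactSupport F → HasCompactSupport fun x => fderiv ℝ F x m :=
    fun h => h.fderiv_apply ℝ m
  have step : ∀ {F H : Plane → ℝ}, ContDiff ℝ ∞ F → ContDiff ℝ ∞ H → HasCompactSupport H →
      ∫ x, F x * fderiv ℝ H x m = - ∫ x, fderiv ℝ F x m * H x := by
    intro F H hF hH hcH
    refine integral_mul_fderiv_eq_neg_fderiv_mul_of_integrable ?_ ?_ ?_
      (fun x _ => hF.differentiable (by simp) x) (fun x _ => hH.differentiable (by simp) x)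
    · exact ((smooth hF).continuous.mul hH.continuous).integrable_of_hasCompactSupport hcH.mul_left
    · exact (hF.continuous.mul (smooth hH).continuous).integrable_of_hasCompactSupport
        (cpt hcH).mul_left
    · exact (hF.continuous.mul hH.continuous).integrable_of_hasCompactSupport hcH.mul_left
  rw [step hW (smooth hφ) (cpt hc), step (smooth hW) hφ hc, neg_neg]

/-- A localized `L²` norm of the second derivative in `x₁` is controlled by the
`H^{11/4} (ln H)^{-β}` norm. -/
theorem lintegral_mul_sq_rpow_le {β : ℝ} (hβ : 1 / 2 < β) {η : Plane → ℝ} (hη : ContDiff ℝ ∞ η)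
    (hc : HasCompactSupport η) (h01 : ∀ x, η x ∈ Icc (0 : ℝ) 1) {W U : Plane → ℝ}
    (hW : ContDiff ℝ ∞ W) (hU : ∀ x ∈ tsupport η, U x = W x) {g : Plane → ℂ}
    (hg : HasFourierTransform U g) :
    (∫⁻ x, ENNReal.ofReal (η x * fderiv ℝ (fun x => fderiv ℝ W x e₁) x e₁ ^ 2)) ^ (1 / 2 : ℝ) ≤
      dualConst β (tsupport η) ^ (1 / 2 : ℝ) *
        (∫⁻ ξ, (ENNReal.ofReal (logWeight (11 / 4) β ξ) * ‖g ξ‖ₑ) ^ 2) ^ (1 / 2 : ℝ) := by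
  have smooth : ∀ {F : Plane → ℝ}, ContDiff ℝ ∞ F → ContDiff ℝ ∞ fun x => fderiv ℝ F x e₁ :=
    fun h => (h.fderiv_right (m := ∞) le_rfl).clm_apply contDiff_const
  set W₂ : Plane → ℝ := fun x => fderiv ℝ (fun x => fderiv ℝ W x e₁) x e₁ with hW₂
  have hW₂s : ContDiff ℝ ∞ W₂ := smooth (smooth hW)
  -- The optimal test function: pairing `W` with `∂∂φ` gives `∫ η W₂²` after two integrations by
  -- parts, while `‖φ‖² ≤ ∫ η W₂²` because `η² ≤ η`. As `φ` is supported where `U = W`, the function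
  -- `W` may be replaced by `U`.
  set φ : Plane → ℝ := fun x => η x * W₂ x with hφ
  have hφs : ContDiff ℝ ∞ φ := hη.mul hW₂s
  have hφc : HasCompactSupport φ := hc.mul_right
  have hts : tsupport φ ⊆ tsupport η := tsupport_mul_subset_left
  have hΦs : ContDiff ℝ ∞ fun x => (φ x : ℂ) := Complex.ofRealCLM.contDiff.comp hφs
  have hΦc : HasCompactSupport fun x => (φ x : ℂ) := hφc.comp_left (g := Complex.ofReal) rfl
  set Φ : 𝓢(Plane, ℂ) := hΦc.toSchwartzMap hΦs
  have hΦ : ∀ x, Φ x = (φ x : ℂ) := fun x => rfl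
  have hK : IsCompact (tsupport η) := hc
  have hΦ0 : ∀ x ∉ tsupport η, Φ x = 0 := fun x hx => by
    rw [hΦ, image_eq_zero_of_notMem_tsupport fun h => hx (hts h), Complex.ofReal_zero]
  have hdual := enorm_integral_mul_lineDeriv_lineDeriv_le hβ hK.isClosed.measurableSet hΦ0 hg
  set S := ∫⁻ x, ‖Φ x‖ₑ ^ 2
  set Q := ∫⁻ x, ENNReal.ofReal (η x * W₂ x ^ 2) with hQ
  have hint : Integrable fun x => η x * W₂ x ^ 2 :=
    (hη.continuous.mul (hW₂s.continuous.pow 2)).integrable_of_hasCompactSupport hc.mul_right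
  have hnn : ∀ x, 0 ≤ η x * W₂ x ^ 2 := fun x => mul_nonneg (h01 x).1 (sq_nonneg _)
  have hQi : Q = ENNReal.ofReal (∫ x, η x * W₂ x ^ 2) :=
    (ofReal_integral_eq_lintegral_ofReal hint (.of_forall hnn)).symm
  have hQtop : Q ≠ ⊤ := hQi ▸ ENNReal.ofReal_ne_top
  have hleft : ∫ x, (U x : ℂ) * (∂_{e₁} (∂_{e₁} Φ)) x = ((∫ x, η x * W₂ x ^ 2 : ℝ) : ℂ) := by
    have h2 : ∀ x, (∂_{e₁} (∂_{e₁} Φ)) x =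
        ((fderiv ℝ (fun x => fderiv ℝ φ x e₁) x e₁ : ℝ) : ℂ) :=
      lineDerivOp_toSchwartzMap_ofReal (smooth hφs)
        (lineDerivOp_toSchwartzMap_ofReal hφs hΦ e₁) e₁
    have h3 : ∀ x, U x * fderiv ℝ (fun x => fderiv ℝ φ x e₁) x e₁ =
        W x * fderiv ℝ (fun x => fderiv ℝ φ x e₁) x e₁ := by
      intro x
      by_cases hx : x ∈ tsupport η
      · rw [hU x hx]
      · have : fderiv ℝ (fun x => fderiv ℝ φ x e₁) x e₁ = 0 := by
          refine image_eq_zero_of_notMem_tsupport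
            (f := fun x => fderiv ℝ (fun x => fderiv ℝ φ x e₁) x e₁) fun h => hx (hts ?_)
          exact tsupport_fderiv_apply_subset ℝ e₁ (tsupport_fderiv_apply_subset ℝ e₁ h)
        rw [this, mul_zero, mul_zero]
    simp_rw [h2, ← Complex.ofReal_mul, h3]
    rw [integral_complex_ofReal, integral_mul_fderiv_fderiv_eq hW hφs hφc]
    congr 1
    refine integral_congr_ae (.of_forall fun x => ?_)
    change W₂ x * (η x * W₂ x) = _
    ring
  have hleft' : ‖∫ x, (U x : ℂ) * (∂_{e₁} (∂_{e₁} Φ)) x‖ₑ = Q := by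
    rw [hleft, hQi, ← ofReal_norm, Complex.norm_real,
      Real.norm_of_nonneg (integral_nonneg hnn)]
  have hS : S ≤ Q := by
    refine lintegral_mono fun x => ?_
    rw [hΦ, ← ofReal_norm, Complex.norm_real, ← ENNReal.ofReal_pow (norm_nonneg _),
      Real.norm_eq_abs, sq_abs]
    refine ENNReal.ofReal_le_ofReal ?_
    have := (h01 x).1
    have := (h01 x).2
    change (η x * W₂ x) ^ 2 ≤ _
    rw [mul_pow]
    gcongr
    nlinarith
  rw [hleft'] at hdual
  set G := (∫⁻ ξ, (ENNReal.ofReal (logWeight (11 / 4) β ξ) * ‖g ξ‖ₑ) ^ 2) ^ (1 / 2 : ℝ)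
  rcases eq_or_ne Q 0 with h0 | h0
  · rw [h0]
    simp
  have hhalf : Q = Q ^ (1 / 2 : ℝ) * Q ^ (1 / 2 : ℝ) := by
    rw [← ENNReal.rpow_add _ _ h0 hQtop]
    norm_num
  -- The dual estimate reads `Q ≤ C Q^{1/2} G`. Since `Q` is finite and nonzero, one factor
  -- `Q^{1/2}` cancels.
  have hle : Q ^ (1 / 2 : ℝ) * Q ^ (1 / 2 : ℝ) ≤
      Q ^ (1 / 2 : ℝ) * (dualConst β (tsupport η) ^ (1 / 2 : ℝ) * G) := by
    rw [← hhalf]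
    refine hdual.trans ?_
    rw [ENNReal.mul_rpow_of_nonneg _ _ (by norm_num)]
    calc _ ≤ G * (dualConst β (tsupport η) ^ (1 / 2 : ℝ) * Q ^ (1 / 2 : ℝ)) := by
          gcongr
      _ = _ := by ring
  exact (ENNReal.mul_le_mul_iff_right (by simp [h0, hQtop]) (by simp [h0, hQtop])).1 hle

theorem fderiv_onPlane_e₁ {w : ℝ → ℝ → ℝ} (hw : ContDiff ℝ ∞ fun q : ℝ × ℝ => w q.1 q.2)
    (x : Plane) : fderiv ℝ (onPlane w) x e₁ = deriv (fun y => w y (x 1)) (x 0) := by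
  have hs : ContDiff ℝ ∞ (onPlane w) :=
    hw.comp (f := fun x : Plane => (x 0, x 1)) (by fun_prop)
  rw [← (hs.differentiable (by simp) x).lineDeriv_eq_fderiv, lineDeriv]
  have : (fun t : ℝ => onPlane w (x + t • e₁)) = fun t => (fun y => w y (x 1)) (x 0 + t) := by
    funext t
    simp [onPlane, e₁]
  rw [this, deriv_comp_const_add (fun y => w y (x 1)) (x 0) 0, add_zero]

theorem fderiv_fderiv_onPlane_e₁ {w : ℝ → ℝ → ℝ}
    (hw : ContDiff ℝ ∞ fun q : ℝ × ℝ => w q.1 q.2) (x : Plane) :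
    fderiv ℝ (fun x => fderiv ℝ (onPlane w) x e₁) x e₁ =
      deriv (fun y => deriv (fun z => w z (x 1)) y) (x 0) := by
  have h1 : (fun x => fderiv ℝ (onPlane w) x e₁) =
      onPlane fun a b => deriv (fun z => w z b) a :=
    funext fun x => fderiv_onPlane_e₁ hw x
  have h2 : ContDiff ℝ ∞ fun q : ℝ × ℝ => deriv (fun z => w z q.2) q.1 := by
    have : (fun q : ℝ × ℝ => deriv (fun z => w z q.2) q.1) =
        fun q => fderiv ℝ (fun q : ℝ × ℝ => w q.1 q.2) q (1, 0) := by
      funext q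
      have h := (hw.differentiable (by simp) q).hasFDerivAt
      have hc : HasDerivAt (fun z : ℝ => (z, q.2)) ((1 : ℝ), (0 : ℝ)) q.1 :=
        (hasDerivAt_id _).prodMk (hasDerivAt_const _ _)
      exact (HasFDerivAt.comp_hasDerivAt q.1 (l := fun q : ℝ × ℝ => w q.1 q.2)
        (f := fun z : ℝ => (z, q.2)) h hc).deriv
    rw [this]
    exact (hw.fderiv_right (m := ∞) le_rfl).clm_apply contDiff_const
  rw [h1, fderiv_onPlane_e₁ h2]

theorem measurePreserving_toPlane :
    MeasurePreserving (fun x : Plane => ((x 0, x 1) : ℝ × ℝ)) :=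
  (volume_preserving_finTwoArrow ℝ).comp (PiLp.volume_preserving_ofLp (Fin 2))

/-- `N` and `C` are fixed before `w` and `U`, so the bound can be used uniformly in time. Requiring
`U = w` only on `N₀` lets `U` be either the solution itself or its product with a cutoff. -/
theorem exists_lintegral_sq_rpow_le {β : ℝ} (hβ : 1 / 2 < β) {p : ℝ × ℝ} {N₀ : Set (ℝ × ℝ)}
    (hN₀ : N₀ ∈ 𝓝 p) :
    ∃ N ∈ 𝓝 p, ∃ C : ℝ≥0∞, C ≠ 0 ∧ C ≠ ⊤ ∧ ∀ w : ℝ → ℝ → ℝ,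
      ContDiff ℝ ∞ (fun q : ℝ × ℝ => w q.1 q.2) →
      ∀ U : Plane → ℝ, (∀ x : Plane, (x 0, x 1) ∈ N₀ → U x = w (x 0) (x 1)) →
      (∫⁻ q in N, ENNReal.ofReal (deriv (fun y => deriv (fun z => w z q.2) y) q.1 ^ 2)) ^
        (1 / 2 : ℝ) / C ≤ logSobolevNorm (11 / 4) β U := by
  set P : Plane := !₂[p.1, p.2] with hP
  have hcont : Continuous fun x : Plane => ((x 0, x 1) : ℝ × ℝ) := by fun_prop
  have hcont' : Continuous fun q : ℝ × ℝ => (!₂[q.1, q.2] : Plane) := by fun_prop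
  have hPN : (fun x : Plane => ((x 0, x 1) : ℝ × ℝ)) ⁻¹' N₀ ∈ 𝓝 P :=
    hcont.continuousAt.preimage_mem_nhds (by simpa [hP] using hN₀)
  obtain ⟨ρ, hρ, hball⟩ := Metric.nhds_basis_closedBall.mem_iff.1 hPN
  let η : ContDiffBump P := ⟨ρ / 2, ρ, by positivity, by linarith⟩
  have hts : tsupport η = Metric.closedBall P ρ := η.tsupport_eq
  refine ⟨(fun q : ℝ × ℝ => (!₂[q.1, q.2] : Plane)) ⁻¹' Metric.ball P (ρ / 2),
    hcont'.continuousAt.preimage_mem_nhds (Metric.ball_mem_nhds _ (by positivity)),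
    -- Adding `1` makes the constant nonzero, so that dividing by it preserves a limit equal to `∞`.
    (dualConst β (tsupport η) + 1) ^ (1 / 2 : ℝ), ?_, ?_, ?_⟩
  · simp
  · have h := dualConst_ne_top (β := β) (K := tsupport η)
      (by rw [hts]; exact measure_closedBall_lt_top.ne)
    exact ENNReal.rpow_ne_top_of_nonneg (by norm_num) (by simp [h])
  intro w hw U hU
  refine le_iInf₂ fun g hg => ENNReal.div_le_of_le_mul' ?_
  have hmain := lintegral_mul_sq_rpow_le hβ (η := η) η.contDiff η.hasCompactSupport
    (fun x => ⟨η.nonneg, η.le_one⟩) (W := onPlane w)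
    (hw.comp (f := fun x : Plane => (x 0, x 1)) (by fun_prop))
    (fun x hx => hU x (hball (hts ▸ hx))) hg
  refine le_trans ?_ (hmain.trans ?_)
  · gcongr
    set N := (fun q : ℝ × ℝ => (!₂[q.1, q.2] : Plane)) ⁻¹' Metric.ball P (ρ / 2)
    have hNm : MeasurableSet N := hcont'.measurable measurableSet_ball
    rw [← lintegral_indicator hNm]
    have hemb : MeasurableEmbedding fun x : Plane => ((x 0, x 1) : ℝ × ℝ) :=
      (MeasurableEquiv.finTwoArrow.measurableEmbedding).comp
        (MeasurableEquiv.toLp 2 (Fin 2 → ℝ)).symm.measurableEmbedding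
    rw [← measurePreserving_toPlane.lintegral_comp_emb hemb]
    refine lintegral_mono fun x => ?_
    have hx2 : (!₂[x 0, x 1] : Plane) = x := by
      ext i
      fin_cases i <;> rfl
    by_cases hx : x ∈ Metric.ball P (ρ / 2)
    · rw [indicator_of_mem (by simpa [N, hx2] using hx), fderiv_fderiv_onPlane_e₁ hw,
        η.one_of_mem_closedBall (Metric.ball_subset_closedBall hx), one_mul]
    · rw [indicator_of_notMem (by simpa [N, hx2] using hx)]
      exact zero_le
  · gcongr
    exact le_self_add

end LogWave

namespace LogWave

/-! ### Finiteness of the norms of the data -/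

theorem logSobolevNorm_zero_lt_top (s β : ℝ) : logSobolevNorm s β (fun _ => 0) < ⊤ := by
  have h : HasFourierTransform (fun _ => 0) (fun _ => 0) := fun φ => by simp
  refine (iInf₂_le (fun _ => 0) h).trans_lt ?_
  simp

theorem hasFourierTransform_fourier {F : Plane → ℝ} {Φ : 𝓢(Plane, ℂ)}
    (hΦ : ∀ x, Φ x = (F x : ℂ)) : HasFourierTransform F (𝓕 Φ : 𝓢(Plane, ℂ)) := by
  have hint : ∀ A B : 𝓢(Plane, ℂ), Integrable fun x => A x * B x := fun A B => by
    obtain ⟨C, hC⟩ := A.decay 0 0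
    refine (B.integrable (μ := volume)).bdd_mul (c := C) A.continuous.aestronglyMeasurable
      (.of_forall fun x => ?_)
    simpa using hC.2 x
  intro φ
  simp_rw [← hΦ]
  exact ⟨hint Φ (𝓕 φ), hint (𝓕 Φ) φ, (SchwartzMap.integral_fourier_mul_eq Φ φ).symm⟩

/-- The logarithmic factor is at most `1` and `|ξ|^s ≤ 1 + |ξ|²`, so the rapid decay of the Fourier
transform suffices. -/
theorem logSobolevNorm_lt_top {s β : ℝ} (hs : 0 ≤ s) (hs2 : s ≤ 2) (hβ : 0 ≤ β) {F : Plane → ℝ}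
    (hF : ContDiff ℝ ∞ F) (hc : HasCompactSupport F) : logSobolevNorm s β F < ⊤ := by
  have hΦs : ContDiff ℝ ∞ fun x => (F x : ℂ) := Complex.ofRealCLM.contDiff.comp hF
  have hΦc : HasCompactSupport fun x => (F x : ℂ) := hc.comp_left (g := Complex.ofReal) rfl
  set Φ : 𝓢(Plane, ℂ) := hΦc.toSchwartzMap hΦs
  refine (iInf₂_le _ (hasFourierTransform_fourier (Φ := Φ) fun x => rfl)).trans_lt ?_
  refine ENNReal.rpow_lt_top_of_nonneg (by norm_num) (ne_of_lt ?_)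
  obtain ⟨M, hM0, hM⟩ := (𝓕 Φ).decay 0 0
  have hM' : ∀ ξ, ‖(𝓕 Φ) ξ‖ ≤ M := fun ξ => by simpa using hM ξ
  have hi : Integrable fun ξ : Plane =>
      M * (‖ξ‖ ^ 0 * ‖(𝓕 Φ) ξ‖ + 2 * (‖ξ‖ ^ 2 * ‖(𝓕 Φ) ξ‖) + ‖ξ‖ ^ 4 * ‖(𝓕 Φ) ξ‖) :=
    ((((𝓕 Φ).integrable_pow_mul volume 0).add
      (((𝓕 Φ).integrable_pow_mul volume 2).const_mul 2)).add
      ((𝓕 Φ).integrable_pow_mul volume 4)).const_mul M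
  refine lt_of_le_of_lt (lintegral_mono fun ξ => ?_)
    ((hasFiniteIntegral_iff_ofReal (.of_forall fun ξ => by positivity)).1 hi.2)
  have hw0 : 0 ≤ logWeight s β ξ := by unfold logWeight; positivity
  have hw : logWeight s β ξ ≤ 1 + ‖ξ‖ ^ 2 := by
    have h1 : (1 + |Real.log ‖ξ‖|) ^ (-β) ≤ 1 :=
      Real.rpow_le_one_of_one_le_of_nonpos (by linarith [abs_nonneg (Real.log ‖ξ‖)]) (by linarith)
    have h2 : ‖ξ‖ ^ s ≤ 1 + ‖ξ‖ ^ 2 := by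
      rcases le_total ‖ξ‖ 1 with h | h
      · exact (Real.rpow_le_one (norm_nonneg _) h hs).trans (by linarith [sq_nonneg ‖ξ‖])
      · have := Real.rpow_le_rpow_of_exponent_le h hs2
        rw [Real.rpow_two] at this
        linarith
    calc logWeight s β ξ ≤ ‖ξ‖ ^ s * 1 := by
          unfold logWeight
          gcongr
      _ ≤ _ := by rw [mul_one]; exact h2
  dsimp only
  rw [← ofReal_norm, ← ENNReal.ofReal_mul hw0, ← ENNReal.ofReal_pow (by positivity)]
  refine ENNReal.ofReal_le_ofReal ?_
  calc (logWeight s β ξ * ‖(𝓕 Φ) ξ‖) ^ 2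
      ≤ ((1 + ‖ξ‖ ^ 2) * ‖(𝓕 Φ) ξ‖) ^ 2 := by gcongr
    _ = (1 + ‖ξ‖ ^ 2) ^ 2 * ‖(𝓕 Φ) ξ‖ * ‖(𝓕 Φ) ξ‖ := by ring
    _ ≤ (1 + ‖ξ‖ ^ 2) ^ 2 * ‖(𝓕 Φ) ξ‖ * M := by
        gcongr
        exact hM' ξ
    _ = _ := by ring

theorem logSobolevNorm_onPlane_lt_top {s β : ℝ} (hs : 0 ≤ s) (hs2 : s ≤ 2) (hβ : 0 ≤ β)
    {w : ℝ → ℝ → ℝ} (hw : ContDiff ℝ ∞ fun x : ℝ × ℝ => w x.1 x.2)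
    (hc : HasCompactSupport fun x : ℝ × ℝ => w x.1 x.2) :
    logSobolevNorm s β (onPlane w) < ⊤ := by
  refine logSobolevNorm_lt_top hs hs2 hβ
    (hw.comp (f := fun x : Plane => (x 0, x 1)) (by fun_prop)) ?_
  let e : Plane ≃ₜ ℝ × ℝ :=
    (PiLp.homeomorph 2 (fun _ : Fin 2 => ℝ)).trans (Homeomorph.finTwoArrow (X := ℝ))
  exact hc.comp_homeomorph e

/-! ### Blow-up at the first focal time -/

theorem tendsto_logSobolevNorm {f : ℝ × ℝ × ℝ × ℝ → ℝ} {χ : ℝ → ℝ → ℝ} {r ρ T β : ℝ}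
    {X V u l : ℝ → ℝ → ℝ → ℝ} (hf : IsSource f) (hβ : 1 / 2 < β)
    (h : IsDevelopment f χ r ρ T X V u l)
    (hχ : ContDiff ℝ ∞ fun x : ℝ × ℝ => χ x.1 x.2)
    (hc : HasCompactSupport fun x : ℝ × ℝ => χ x.1 x.2) {x₀ y₀ : ℝ}
    (h0 : dx₁ X T x₀ y₀ = 0) (hnn : ∀ x y, 0 ≤ dx₁ X T x y)
    {N₀ : Set (ℝ × ℝ)} (hN₀ : N₀ ∈ 𝓝 (X T x₀ y₀, y₀)) {U : ℝ → Plane → ℝ}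
    (hU : ∀ t ∈ Ioo 0 T, ∀ x : Plane, (x 0, x 1) ∈ N₀ → U t x = u t (x 0) (x 1)) :
    Tendsto (fun t => logSobolevNorm (11 / 4) β (U t)) (𝓝[<] T) (𝓝 ⊤) := by
  have hχ' : ∀ x y, HasDerivAt (fun x => χ x y)
      (fderiv ℝ (fun x : ℝ × ℝ => χ x.1 x.2) (x, y) (1, 0)) x := fun x y => by
    have hd := (hχ.differentiable (by simp) (x, y)).hasFDerivAt
    exact HasFDerivAt.comp_hasDerivAt x (l := fun q : ℝ × ℝ => χ q.1 q.2)
      (f := fun z : ℝ => (z, y)) hd ((hasDerivAt_id _).prodMk (hasDerivAt_const _ _))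
  obtain ⟨B₁, hB₁⟩ := hc.exists_bound_of_continuous hχ.continuous
  obtain ⟨B₂, hB₂⟩ := (hc.fderiv_apply ℝ ((1 : ℝ), (0 : ℝ))).exists_bound_of_continuous
    ((hχ.fderiv_right (m := ∞) le_rfl).continuous.clm_apply continuous_const)
  obtain ⟨N, hN, C, hC0, hC, hle⟩ := exists_lintegral_sq_rpow_le hβ hN₀
  have hlim := h.tendsto_lintegral_sq hf hχ' (B := max B₁ B₂)
    (fun x y => (hB₁ (x, y)).trans (le_max_left _ _))
    (fun x y => (hB₂ (x, y)).trans (le_max_right _ _)) h0 hnn hN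
  have hlim2 : Tendsto (fun t => (∫⁻ q in N, ENNReal.ofReal (dx₁ (dx₁ u) t q.1 q.2 ^ 2)) ^
      (1 / 2 : ℝ) / C) (𝓝[<] T) (𝓝 ⊤) := by
    have h1 := (ENNReal.continuous_rpow_const (y := 1 / 2)).continuousAt.tendsto.comp hlim
    rw [ENNReal.top_rpow_of_pos (by norm_num)] at h1
    have h2 := ENNReal.Tendsto.div_const h1 (b := C) (.inr hC0)
    rwa [ENNReal.top_div_of_ne_top hC] at h2
  refine tendsto_nhds_top_mono hlim2 ?_
  filter_upwards [Ioo_mem_nhdsLT h.T_pos] with t ht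
  refine hle (u t) ?_ (U t) (hU t ht)
  have hs : ContDiff ℝ ∞ fun q : ℝ × ℝ => (t, q) := by fun_prop
  exact contDiffOn_univ.1 (h.smooth_u.comp (t := Ioo (-ρ) T ×ˢ univ) hs.contDiffOn
    fun q _ => ⟨⟨by linarith [ht.1, h.ρ_pos], ht.2⟩, mem_univ _⟩)

/-- If two characteristics cross before time `r`, then the problem has a smooth solution up to some
positive time, at which its `H^{11/4} (ln H)^{-β}` norm blows up locally. -/
theorem IsCharacteristics.exists_blowup {f : ℝ × ℝ × ℝ × ℝ → ℝ} {χ : ℝ → ℝ → ℝ} {r β : ℝ}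
    {X V : ℝ → ℝ → ℝ → ℝ} (hf : IsSource f) (hβ : 1 / 2 < β) (h : IsCharacteristics f χ r X V)
    (hχ : ContDiff ℝ ∞ fun x : ℝ × ℝ => χ x.1 x.2)
    (hc : HasCompactSupport fun x : ℝ × ℝ => χ x.1 x.2) (hneg : ∀ x y, χ x y ≤ 0)
    {t₁ a b y : ℝ} (ht₁ : t₁ ∈ Ioo 0 r) (hab : a < b) (hX : X t₁ b y ≤ X t₁ a y) :
    ∃ T ∈ Ioc 0 t₁, (∃ u, IsSolution f χ T u) ∧ ∀ u, IsSolution f χ T u →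
      logSobolevNorm (11 / 4) β (onPlane (u 0)) < ⊤ ∧
      logSobolevNorm (7 / 4) β
        (onPlane fun x₁ x₂ => derivWithin (fun t => u t x₁ x₂) (Ici 0) 0) < ⊤ ∧
      Tendsto (fun t => logSobolevNorm (11 / 4) β (onPlane (u t))) (𝓝[<] T) (𝓝 ⊤) ∧
      ∃ p : ℝ × ℝ, ∀ ζ : ℝ → ℝ → ℝ, (∀ᶠ x in 𝓝 p, ζ x.1 x.2 = 1) →
        Tendsto (fun t => logSobolevNorm (11 / 4) β
          (onPlane fun x₁ x₂ => ζ x₁ x₂ * u t x₁ x₂)) (𝓝[<] T) (𝓝 ⊤) := by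
  obtain ⟨T, hT, ρ, hρ, hpos, hnn, x₀, y₀, h0⟩ := h.exists_first_vanishing hc ht₁ hab hX
  obtain ⟨u, l, hdev⟩ := h.exists_isDevelopment hneg hρ ⟨hT.1, hT.2.trans_lt ht₁.2⟩ hpos
  refine ⟨T, hT, ⟨u, hdev.isSolution⟩, fun w hw => ?_⟩
  have heq := IsDevelopment.eq_of_isSolution hf hdev hw
  -- The blow-up point is the position at time `T` of the focusing characteristic.
  refine ⟨?_, ?_, ?_, (X T x₀ y₀, y₀), fun ζ hζ => ?_⟩
  · have : onPlane (w 0) = fun _ => 0 := funext fun x => hw.initial _ _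
    rw [this]
    exact logSobolevNorm_zero_lt_top _ _
  · have : (fun x₁ x₂ => derivWithin (fun t => w t x₁ x₂) (Ici 0) 0) = fun x₁ x₂ => -χ x₁ x₂ :=
      funext₂ fun x₁ x₂ => (hw.initial_dt x₁ x₂).derivWithin (uniqueDiffOn_Ici 0 0 self_mem_Ici)
    rw [this]
    exact logSobolevNorm_onPlane_lt_top (by norm_num) (by norm_num) (by linarith) hχ.neg hc.neg
  · refine tendsto_logSobolevNorm hf hβ hdev hχ hc h0 hnn univ_mem fun t ht x _ => ?_
    rw [heq t ⟨ht.1.le, ht.2⟩]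
    rfl
  · refine tendsto_logSobolevNorm hf hβ hdev hχ hc h0 hnn hζ fun t ht x hx => ?_
    rw [← heq t ⟨ht.1.le, ht.2⟩]
    simp only [onPlane]
    rw [show ζ (x 0) (x 1) = 1 from hx, one_mul]

/-! ### Crossing of characteristics -/

/-- Speed is increasing in `V`, and the gap in `V` keeps at least half of its initial size `≥ m = K
(b - a)`, because `K ≥ 1` makes the gap in `χ` dominate `b - a`. The speeds differ by `2 (V_a - V_b)
/ ((1 - V_a)(1 - V_b))` with both factors below at most `5/2`, so the distance shrinks at rate at
least `4m / 25`. In time `7/K` it loses `28/25 (b - a)`, more than it had. -/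
theorem IsCharacteristics.crossing {f : ℝ × ℝ × ℝ × ℝ → ℝ} {χ : ℝ → ℝ → ℝ} {r : ℝ}
    {X V : ℝ → ℝ → ℝ → ℝ} (h : IsCharacteristics f χ r X V) (hneg : ∀ x y, χ x y ≤ 0)
    {a b y K : ℝ} (hab : a < b) (hb : -1 ≤ χ b y) (hK : 1 ≤ K)
    (hχ : K * (b - a) ≤ χ a y - χ b y) (hr : 7 / K < r) : X (7 / K) b y ≤ X (7 / K) a y := by
  have hK0 : 0 < K := by linarith
  have ht₁ : 0 < 7 / K := by positivity
  set m := K * (b - a) with hm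
  have hm1 : b - a ≤ m := by rw [hm]; nlinarith
  have hsub : ∀ t ∈ Icc 0 (7 / K), t ∈ Ioo (-r) r := fun t ht =>
    ⟨by linarith [ht.1], by linarith [ht.2]⟩
  have hcont : ∀ x, ContinuousOn (fun t => X t x y) (Icc 0 (7 / K)) := fun x =>
    h.smooth_X.continuousOn.comp (f := fun t : ℝ => (t, x, y)) (by fun_prop)
      fun t ht => ⟨hsub t ht, mem_univ _⟩
  have hanti : AntitoneOn (fun t => X t b y - X t a y + 4 / 25 * m * t) (Icc 0 (7 / K)) := by
    have hd : ∀ t ∈ Ioo 0 (7 / K), HasDerivAt (fun t => X t b y - X t a y + 4 / 25 * m * t)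
        ((1 + V t b y) / (1 - V t b y) - (1 + V t a y) / (1 - V t a y) + 4 / 25 * m * 1) t :=
      fun t ht => ((h.deriv_X t ⟨ht.1, ht.2.trans hr⟩ b y).sub
        (h.deriv_X t ⟨ht.1, ht.2.trans hr⟩ a y)).add ((hasDerivAt_id t).const_mul _)
    refine antitoneOn_of_deriv_nonpos (convex_Icc _ _)
      (((hcont b).sub (hcont a)).add (by fun_prop)) ?_ ?_
    · rw [interior_Icc]
      exact fun t ht => (hd t ht).differentiableAt.differentiableWithinAt
    · rw [interior_Icc]
      intro t ht
      rw [(hd t ht).deriv]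
      have htr := hsub t ⟨ht.1.le, ht.2.le⟩
      have hna := abs_le.1 (h.V_near t htr a y)
      have hnb := abs_le.1 (h.V_near t htr b y)
      have hva := hneg a y
      have hvb := hneg b y
      have hl := (abs_le.1 (h.V_lip t htr b a y)).2
      have hpos : 0 ≤ χ a y - χ b y := by nlinarith
      rw [abs_of_pos (sub_pos.2 hab), abs_sub_comm (χ b y), abs_of_nonneg hpos,
        max_eq_right (by linarith)] at hl
      have hA : 0 < 1 - V t a y := by linarith
      have hB : 0 < 1 - V t b y := by linarith
      have hAB : (1 - V t b y) * (1 - V t a y) ≤ 5 / 2 * (5 / 2) := by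
        gcongr <;> linarith
      have hm0 : 0 < m := by rw [hm]; exact mul_pos hK0 (sub_pos.2 hab)
      rw [div_sub_div _ _ hB.ne' hA.ne', mul_one]
      have : ((1 + V t b y) * (1 - V t a y) - (1 - V t b y) * (1 + V t a y)) /
          ((1 - V t b y) * (1 - V t a y)) ≤ -(4 / 25 * m) := by
        rw [div_le_iff₀ (by positivity)]
        nlinarith
      linarith
  have h1 := hanti (left_mem_Icc.2 ht₁.le) (right_mem_Icc.2 ht₁.le) ht₁.le
  simp only [h.X_zero, mul_zero, add_zero] at h1
  have h2 : m * (7 / K) = 7 * (b - a) := by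
    rw [hm]
    field_simp
  nlinarith

theorem intervalIntegrable_transition {α ε a b : ℝ} (hα : 0 < α) {ψ : ℝ → ℝ} (hε : 0 < ε)
    (hψ : IsTransition ε ψ) (ha : 0 ≤ a) (hb : 0 ≤ b) :
    IntervalIntegrable (fun s => ψ s * |Real.log s| ^ α) volume a b := by
  have hc : ContinuousOn (fun s => ψ s * |Real.log s| ^ α) (Ici 0) := by
    intro s hs
    rcases lt_or_ge s (ε / 2) with h | h
    · refine (continuousAt_const (y := (0 : ℝ))).congr ?_ |>.continuousWithinAt
      filter_upwards [gt_mem_nhds h] with z hz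
      rw [hψ.zero z hz, zero_mul]
    · refine ContinuousAt.continuousWithinAt ?_
      exact hψ.smooth.continuous.continuousAt.mul
        ((Real.continuousAt_log (by linarith : s ≠ 0)).abs.rpow_const (.inr hα.le))
  exact (hc.mono fun s hs => (le_min ha hb).trans hs.1).intervalIntegrable

/-- The segment of the axis on which the profile is prescribed. Crossing on this single slice is
enough. -/
theorem mem_Ω₀_of_mem_Icc {δ x : ℝ} (hx : x ∈ Icc 0 (1 / 2 : ℝ)) : ((x, 0) : ℝ × ℝ) ∈ Ω₀ δ := by
  refine ⟨⟨hx.1, ?_⟩, hx, by norm_num⟩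
  simp only [abs_zero]
  positivity

/-- Only `s ≥ ε/2` contributes to the integral, and there `|ln s| ≤ |ln(ε/2)|`. This keeps the
denominators `1 - V` bounded in `crossing`. -/
theorem IsProfile.neg_one_le {α δ ε x : ℝ} (hα : 0 < α) {ψ : ℝ → ℝ} {χ : ℝ → ℝ → ℝ}
    (hψ : IsTransition ε ψ) (hχ : IsProfile α δ ψ χ) (hε : 0 < ε) (hx : x ∈ Icc 0 (2 * ε))
    (hε4 : ε ≤ 1 / 4) (hsmall : 2 * ε * |Real.log (ε / 2)| ^ α ≤ 1) : -1 ≤ χ x 0 := by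
  have h := hχ.eq_on (x, 0) (mem_Ω₀_of_mem_Icc ⟨hx.1, by linarith [hx.2]⟩)
  simp only at h
  rw [h]
  have hb : ‖∫ s in (0 : ℝ)..x, ψ s * |Real.log s| ^ α‖ ≤ |Real.log (ε / 2)| ^ α * |x - 0| := by
    refine intervalIntegral.norm_integral_le_of_norm_le_const fun s hs => ?_
    rw [uIoc_of_le hx.1] at hs
    rcases lt_or_ge s (ε / 2) with hs2 | hs2
    · rw [hψ.zero s hs2, zero_mul, norm_zero]
      positivity
    · rw [Real.norm_of_nonneg (mul_nonneg (hψ.mem s).1 (by positivity))]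
      have hl : |Real.log s| ≤ |Real.log (ε / 2)| := by
        rw [abs_of_nonpos (Real.log_nonpos (by linarith) (by linarith [hs.2, hx.2])),
          abs_of_nonpos (Real.log_nonpos (by linarith) (by linarith))]
        exact neg_le_neg (Real.log_le_log (by linarith) hs2)
      calc ψ s * |Real.log s| ^ α ≤ 1 * |Real.log (ε / 2)| ^ α := by
            gcongr
            exact (hψ.mem s).2
        _ = _ := one_mul _
  rw [sub_zero, abs_of_nonneg hx.1] at hb
  have h2 := (abs_le.1 hb).2
  have h3 : |Real.log (ε / 2)| ^ α * x ≤ |Real.log (ε / 2)| ^ α * (2 * ε) := by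
    gcongr
    exact hx.2
  linarith

/-- Between `ε` and `2ε` the transition equals `1` and `|ln s|` is at least its value at `2ε`. This
provides the slope `K` for `crossing`. -/
theorem IsProfile.le_sub {α δ ε : ℝ} (hα : 0 < α) {ψ : ℝ → ℝ} {χ : ℝ → ℝ → ℝ}
    (hψ : IsTransition ε ψ) (hχ : IsProfile α δ ψ χ) (hε : 0 < ε) (hε4 : ε ≤ 1 / 4) :
    |Real.log (2 * ε)| ^ α * (2 * ε - ε) ≤ χ ε 0 - χ (2 * ε) 0 := by
  have h₁ := hχ.eq_on (ε, 0) (mem_Ω₀_of_mem_Icc ⟨hε.le, by linarith⟩)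
  have h₂ := hχ.eq_on (2 * ε, 0) (mem_Ω₀_of_mem_Icc ⟨by linarith, by linarith⟩)
  simp only at h₁ h₂
  have hi : ∀ {a b : ℝ}, 0 ≤ a → 0 ≤ b →
      IntervalIntegrable (fun s => ψ s * |Real.log s| ^ α) volume a b :=
    intervalIntegrable_transition hα hε hψ
  rw [h₁, h₂, neg_sub_neg, intervalIntegral.integral_interval_sub_left
    (hi le_rfl (by linarith)) (hi le_rfl hε.le)]
  have hmono := intervalIntegral.integral_mono_on_of_le_Ioo (μ := volume) (by linarith : ε ≤ 2 * ε)
    (f := fun _ => |Real.log (2 * ε)| ^ α) (by simp) (hi hε.le (by linarith)) fun s hs => by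
      rw [hψ.one s hs.1, one_mul]
      refine Real.rpow_le_rpow (abs_nonneg _) ?_ hα.le
      rw [abs_of_nonpos (Real.log_nonpos (by linarith) (by linarith)),
        abs_of_nonpos (Real.log_nonpos (by linarith [hs.1]) (by linarith [hs.2]))]
      exact neg_le_neg (Real.log_le_log (by linarith [hs.1]) hs.2.le)
  rw [intervalIntegral.integral_const, smul_eq_mul, mul_comm] at hmono
  exact hmono

theorem tendsto_abs_log_rpow {α : ℝ} (hα : 0 < α) :
    Tendsto (fun ε : ℝ => |Real.log (2 * ε)| ^ α) (𝓝[>] 0) atTop := by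
  have h2 : Tendsto (fun ε : ℝ => 2 * ε) (𝓝[>] 0) (𝓝[>] 0) := by
    refine tendsto_nhdsWithin_iff.2 ⟨?_, ?_⟩
    · have : Tendsto (fun ε : ℝ => 2 * ε) (𝓝 0) (𝓝 (2 * 0)) := tendsto_id.const_mul 2
      rw [mul_zero] at this
      exact this.mono_left nhdsWithin_le_nhds
    · filter_upwards [self_mem_nhdsWithin] with ε hε
      simpa using hε
  exact (tendsto_rpow_atTop hα).comp
    (tendsto_abs_atBot_atTop.comp (Real.tendsto_log_nhdsGT_zero.comp h2))

theorem tendsto_mul_abs_log_rpow (α : ℝ) :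
    Tendsto (fun ε : ℝ => 2 * ε * |Real.log (ε / 2)| ^ α) (𝓝[>] 0) (𝓝 0) := by
  have h2 : Tendsto (fun ε : ℝ => ε / 2) (𝓝[>] 0) (𝓝[>] 0) := by
    refine tendsto_nhdsWithin_iff.2 ⟨?_, ?_⟩
    · have : Tendsto (fun ε : ℝ => ε / 2) (𝓝 0) (𝓝 (0 / 2)) := tendsto_id.div_const 2
      rw [zero_div] at this
      exact this.mono_left nhdsWithin_le_nhds
    · filter_upwards [self_mem_nhdsWithin] with ε hε
      exact half_pos (mem_Ioi.1 hε)
  have h := (isLittleO_abs_log_rpow_rpow_nhdsGT_zero α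
    (by norm_num : (-1 : ℝ) < 0)).tendsto_div_nhds_zero.comp h2
  have h4 := h.const_mul 4
  rw [mul_zero] at h4
  refine h4.congr' ?_
  filter_upwards [self_mem_nhdsWithin] with ε hε
  have : (0 : ℝ) < ε := hε
  simp only [Function.comp_apply, Real.rpow_neg_one]
  field_simp
  ring

end LogWave

open LogWave
theorem theorem4p1 (α β δ : ℝ) (hα : 0 < α) (hβ : 1 / 2 < β) (hδ : 0 < δ)
    (hαβδ : 2 * α - 2 * β - δ < -1)
    (f : ℝ × ℝ × ℝ × ℝ → ℝ) (hf : IsSource f)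
    (ψ : ℝ → ℝ → ℝ) (hψ : ∀ ε ∈ Ioo (0 : ℝ) (1 / 2), IsTransition ε (ψ ε))
    (χ : ℝ → ℝ → ℝ → ℝ) (hχ : ∀ ε ∈ Ioo (0 : ℝ) (1 / 2), IsProfile α δ (ψ ε) (χ ε)) :
    ∃ ε₀ ∈ Ioo (0 : ℝ) (1 / 2), ∃ τ : ℝ → ℝ,
      Tendsto τ (𝓝[>] 0) (𝓝 0) ∧
      ∀ ε ∈ Ioo 0 ε₀,
        0 < τ ε ∧
        (∃ u, IsSolution f (χ ε) (τ ε) u) ∧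
        ∀ u, IsSolution f (χ ε) (τ ε) u →
          logSobolevNorm (11 / 4) β (onPlane (u 0)) < ⊤ ∧
          logSobolevNorm (7 / 4) β
            (onPlane fun x₁ x₂ => derivWithin (fun t => u t x₁ x₂) (Ici 0) 0) < ⊤ ∧
          Tendsto (fun t => logSobolevNorm (11 / 4) β (onPlane (u t))) (𝓝[<] τ ε) (𝓝 ⊤) ∧
          ∃ p : ℝ × ℝ, ∀ ζ : ℝ → ℝ → ℝ,
            ContDiff ℝ ∞ (fun x : ℝ × ℝ => ζ x.1 x.2) →
            HasCompactSupport (fun x : ℝ × ℝ => ζ x.1 x.2) →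
            (∀ᶠ x in 𝓝 p, ζ x.1 x.2 = 1) →
            Tendsto (fun t => logSobolevNorm (11 / 4) β
              (onPlane fun x₁ x₂ => ζ x₁ x₂ * u t x₁ x₂)) (𝓝[<] τ ε) (𝓝 ⊤) := by
  -- The lifespan `r` of the characteristics is fixed before `ε`, as it depends on `f` only. The
  -- crossing time `7 / |ln 2ε|^α` therefore falls below it for small `ε`.
  obtain ⟨r, hr, hchar⟩ := exists_isCharacteristics hf
  have hL := tendsto_abs_log_rpow hα
  have hdiv : Tendsto (fun ε : ℝ => 7 / |Real.log (2 * ε)| ^ α) (𝓝[>] 0) (𝓝 0) :=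
    hL.const_div_atTop 7
  have hev : ∀ᶠ ε : ℝ in 𝓝[>] 0, 1 ≤ |Real.log (2 * ε)| ^ α ∧
      2 * ε * |Real.log (ε / 2)| ^ α ≤ 1 ∧ 7 / |Real.log (2 * ε)| ^ α < r ∧ ε ≤ 1 / 4 := by
    filter_upwards [hL.eventually_ge_atTop 1,
      (tendsto_mul_abs_log_rpow α).eventually (gt_mem_nhds one_pos),
      hdiv.eventually (gt_mem_nhds hr), Ioo_mem_nhdsGT (by norm_num : (0 : ℝ) < 1 / 4)]
      with ε h1 h2 h3 h4 using ⟨h1, h2.le, h3, h4.2.le⟩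
  obtain ⟨ε₁, hε₁, hsub⟩ := mem_nhdsGT_iff_exists_Ioo_subset.1 hev
  have hε₁ : 0 < ε₁ := hε₁
  -- The range of `ε` is a premise inside the existential, so that the blow-up time can be chosen as
  -- a function on all of `ℝ`, with the value `0` outside the range.
  have hblow : ∀ ε : ℝ, ∃ T : ℝ, ε ∈ Ioo 0 (min ε₁ (1 / 4)) →
      T ∈ Ioc 0 (7 / |Real.log (2 * ε)| ^ α) ∧ (∃ u, IsSolution f (χ ε) T u) ∧
      ∀ u, IsSolution f (χ ε) T u →
        logSobolevNorm (11 / 4) β (onPlane (u 0)) < ⊤ ∧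
        logSobolevNorm (7 / 4) β
          (onPlane fun x₁ x₂ => derivWithin (fun t => u t x₁ x₂) (Ici 0) 0) < ⊤ ∧
        Tendsto (fun t => logSobolevNorm (11 / 4) β (onPlane (u t))) (𝓝[<] T) (𝓝 ⊤) ∧
        ∃ p : ℝ × ℝ, ∀ ζ : ℝ → ℝ → ℝ, (∀ᶠ x in 𝓝 p, ζ x.1 x.2 = 1) →
          Tendsto (fun t => logSobolevNorm (11 / 4) β
            (onPlane fun x₁ x₂ => ζ x₁ x₂ * u t x₁ x₂)) (𝓝[<] T) (𝓝 ⊤) := by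
    intro ε
    by_cases hε : ε ∈ Ioo 0 (min ε₁ (1 / 4))
    · obtain ⟨h1, h2, h3, h4⟩ := hsub ⟨hε.1, hε.2.trans_le (min_le_left _ _)⟩
      have hε0 : 0 < ε := hε.1
      have hψε := hψ ε ⟨hε0, by linarith⟩
      have hp := hχ ε ⟨hε0, by linarith⟩
      obtain ⟨X, V, hXV⟩ := hchar (χ ε) hp.smooth hp.nonpos
      have hcross := hXV.crossing hp.nonpos (by linarith : ε < 2 * ε)
        (hp.neg_one_le hα hψε hε0 ⟨by linarith, le_rfl⟩ h4 h2) h1 (hp.le_sub hα hψε hε0 h4) h3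
      obtain ⟨T, hT⟩ := hXV.exists_blowup hf hβ hp.smooth hp.compact hp.nonpos
        ⟨by positivity, h3⟩ (by linarith) hcross
      exact ⟨T, fun _ => hT⟩
    · exact ⟨0, fun h => absurd h hε⟩
  choose τ hτ using hblow
  refine ⟨min ε₁ (1 / 4), ⟨lt_min hε₁ (by norm_num), (min_le_right _ _).trans_lt (by norm_num)⟩,
    τ, ?_, fun ε hε => ⟨(hτ ε hε).1.1, (hτ ε hε).2.1, fun u hu => ?_⟩⟩
  · refine squeeze_zero' ?_ ?_ hdiv <;>
      filter_upwards [Ioo_mem_nhdsGT (lt_min hε₁ (by norm_num : (0 : ℝ) < 1 / 4))] with ε hε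
    · exact (hτ ε hε).1.1.le
    · exact (hτ ε hε).1.2
  · obtain ⟨ha, hb, hc, p, hp⟩ := (hτ ε hε).2.2 u hu
    exact ⟨ha, hb, hc, p, fun ζ _ _ hζ => hp ζ hζ⟩
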